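/- Let $n>1$ and index by $\{0,\dots,n\}=\mathbb Z/(n+1)$. Let $\langle h_i,\alpha_j\rangle=2\delta_{i,j}-\delta_{i,j+1}-\delta_{i+1,j}$ be the Cartan matrix of type $A_n^{(1)}$, $Q=\bigoplus_{i=0}^n\mathbb Z\alpha_i$ with $(\alpha_i|\alpha_j)=\langle h_i,\alpha_j\rangle$, and $\langle h_i,\Lambda_p\rangle=(\alpha_i|\Lambda_p)=\delta_{ip}$. Let $M=(m_{ij})_{0\le i,j\le n}$ be a skew-symmetric integer matrix, $\kappa\in\mathbb Q(q)^\times$, and put $[k]=\frac{q^k-q^{-k}}{q-q^{-1}}$. The quantum toroidal algebra $U=U_q(\mathfrak{sl}_{n+1,tor})$ is the associative $\mathbb Q(q)$-algebra with generators $E_{i,k},F_{i,k}$ ($k\in\mathbb Z$), $H_{i,l}$ ($l\in\mathbb Z\setminus\{0\}$), $K_i^\pm$, $q^{\pm\frac12c}$, $q^{\pm d_1}$, $q^{\pm d_2}$ ($0\le i\le n$) and the following relations, where $K_i^{\pm}(z)=\sum_{\pm k\ge0}K^\pm_{i,k}z^{-k}:=K_i^\pm\exp\bigl(\pm(q-q^{-1})\sum_{k\ge1}H_{i,\pm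 k}z^{\mp k}\bigr)$ and $K^\pm_{i,k}=0$ for $\pm k<0$: $q^{\pm\frac12c}$ are central; $K_i^+K_i^-=K_i^-K_i^+=1$, and likewise $q^{\frac12c}q^{-\frac12c}=q^{d_r}q^{-d_r}=q^{-d_r}q^{d_r}=1$ ($r=1,2$); the $K_i^\pm$ commute with all $K_j^{\pm}$, $H_{j,l}$, $q^{\pm d_r}$; $$[H_{i,k},H_{j,l}]=\delta_{k+l,0}\tfrac1k[k\langle h_i,\alpha_j\rangle]\tfrac{q^{kc}-q^{-kc}}{q-q^{-1}}\kappa^{-km_{ij}};$$ $$q^{d_1}X_{j,k}q^{-d_1}=q^kX_{j,k}\ (X=E,F,H),\quad [q^{\pm d_2},H_{j,l}]=0,\quad q^{d_2}E_{j,k}q^{-d_2}=q^{\delta_{j0}}E_{j,k},\quad q^{d_2}F_{j,k}q^{-d_2}=q^{-\delta_{j0}}F_{j,k};$$ $$K_i^+E_{j,k}K_i^-=q^{\langle h_i,\alpha_j\rangle}E_{j,k},\qquad K_i^+F_{j,k}K_i^-=q^{-\langle h_i,\alpha_j\rangle}F_{j,k};$$ $$[H_{i,k},E_{j,l}]=\tfrac1k[k\langle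 h_i,\alpha_j\rangle]q^{-\frac12|k|c}\kappa^{-km_{ij}}E_{j,k+l},\qquad [H_{i,k},F_{j,l}]=-\tfrac1k[k\langle h_i,\alpha_j\rangle]q^{\frac12|k|c}\kappa^{-km_{ij}}F_{j,k+l};$$ $$\kappa^{m_{ij}}X_{i,k+1}X_{j,l}-q^{\pm\langle h_i,\alpha_j\rangle}\kappa^{m_{ij}}X_{j,l}X_{i,k+1}=q^{\pm\langle h_i,\alpha_j\rangle}X_{i,k}X_{j,l+1}-X_{j,l+1}X_{i,k}\quad(+\text{ for }X=E,\ -\text{ for }X=F);$$ $$[E_{i,k},F_{j,l}]=\delta_{ij}\tfrac1{q-q^{-1}}\bigl(q^{\frac12(k-l)c}K^+_{i,k+l}-q^{\frac12(l-k)c}K^-_{i,k+l}\bigr);$$ and, for $i\ne j$, $m=1-\langle h_i,\alpha_j\rangle$, $X=E$ or $F$, and all integers $k_1,\dots,k_m,l$, $$\sum_{\sigma\in\mathfrak S_m}\sum_{r=0}^m(-1)^r\begin{bmatrix}m\\r\end{bmatrix}X_{i,k_{\sigma(1)}}\cdots X_{i,k_{\sigma(r)}}X_{j,l}X_{i,k_{\sigma(r+1)}}\cdots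 X_{i,k_{\sigma(m)}}=0.$$ Let $\mathbb K\supseteq\mathbb Q(q)$ be a field with fixed square roots $q^{1/2}$ of $q$ and $\kappa^{1/2}$ of $\kappa$. Let $S_n$ be the $\mathbb K$-algebra generated by $H_{i,l}$ ($0\le i\le n$, $l\neq0$) with $[H_{i,k},H_{j,l}]=\delta_{k+l,0}\frac1k[k\langle h_i,\alpha_j\rangle][k]\kappa^{-km_{ij}}$, and let $\mathcal F_n=S_nv_0$ be the $S_n$-module with defining relations $H_{i,l}v_0=0$ ($l>0$). Let $\mathbb K\{Q\}$ be the $\mathbb K$-algebra generated by invertible symbols $e^{\alpha_0},\dots,e^{\alpha_n}$ with $e^{\alpha_i}e^{\alpha_j}=(-1)^{\langle h_i,\alpha_j\rangle}e^{\alpha_j}e^{\alpha_i}$, and write $e^\beta=(e^{\alpha_0})^{m_0}\cdots(e^{\alpha_n})^{m_n}$ for $\beta=\sum_km_k\alpha_k$. For $0\le p\le n$ let $V(p)_n=\mathcal F_n\otimes\mathbb K\{Q\}e^{\Lambda_p}$, with $e^{\Lambda_p}$ a formal symbol. On $V(p)_n$ let $H_{i,l}$ act on the left factor, let $e^{\pm\alpha_i}$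 act by left multiplication on $\mathbb K\{Q\}$, and for $v\in\mathcal F_n$ and $\beta=\sum_km_k\alpha_k$ put $$\partial_{\alpha_i}(v\otimes e^\beta e^{\Lambda_p})=\langle h_i,\beta+\Lambda_p\rangle\,v\otimes e^\beta e^{\Lambda_p},\qquad z^{H_{i,0}}(v\otimes e^\beta e^{\Lambda_p})=z^{\langle h_i,\beta+\Lambda_p\rangle}\kappa^{\frac12\sum_k\langle h_i,m_k\alpha_k\rangle m_{ik}}\,v\otimes e^\beta e^{\Lambda_p},$$ with $z^{-H_{i,0}}$ the inverse of $z^{H_{i,0}}$; let $d_2$ act on $v\otimes e^\beta e^{\Lambda_p}$ by $m_0$, and $d_1$ on $H_{i_1,-k_1}\cdots H_{i_N,-k_N}v_0\otimes e^\beta e^{\Lambda_p}$ ($k_s>0$) by $-\sum_sk_s-\frac{(\beta|\beta)}2-(\beta|\Lambda_p)$. Then the vertex operators below are well defined (only finitely many coefficients of the exponentials in the $H_{i,k}$, $k\geq 1$, act non-trivially on any given vector), and for each $p$ there is exactly one $U$-module structure on $V(p)_n$, acting by $\mathbb K$-linear operators, such that $q^{\pm\frac12c}\mapsto q^{\pm\frac12}$,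 $q^{\pm d_1}\mapsto q^{\pm d_1}$, $q^{\pm d_2}\mapsto q^{\pm d_2}$, $H_{i,l}\mapsto H_{i,l}$, and for $0\le i\le n$ $$E_i(z)=\sum_kE_{i,k}z^{-k}\mapsto\exp\Bigl(\sum_{k\ge1}\tfrac{H_{i,-k}}{[k]}(q^{-1/2}z)^k\Bigr)\exp\Bigl(-\sum_{k\ge1}\tfrac{H_{i,k}}{[k]}(q^{1/2}z)^{-k}\Bigr)e^{\alpha_i}z^{H_{i,0}+1},$$ $$F_i(z)=\sum_kF_{i,k}z^{-k}\mapsto\exp\Bigl(-\sum_{k\ge1}\tfrac{H_{i,-k}}{[k]}(q^{1/2}z)^k\Bigr)\exp\Bigl(\sum_{k\ge1}\tfrac{H_{i,k}}{[k]}(q^{-1/2}z)^{-k}\Bigr)e^{-\alpha_i}z^{-H_{i,0}+1},$$ $$K_i^\pm(z)\mapsto\exp\Bigl(\pm(q-q^{-1})\sum_{k\ge1}H_{i,\pm k}z^{\mp k}\Bigr)q^{\pm\partial_{\alpha_i}}$$ (in particular $K_i^\pm\mapsto q^{\pm\partial_{\alpha_i}}$). This module has level $(1,1)$: both $q^c$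 and the central element $\prod_{i=0}^nK_i^+$ act as the scalar $q$. -/

import Mathlib

open scoped TensorProduct

namespace QToroidal

noncomputable section

/-! ### Scalars -/

/-- The field `ℚ(q)`. -/
abbrev Qq : Type := RatFunc ℚ

/-- The indeterminate `q`. -/
def q : Qq := RatFunc.X

/-- The quantum integer `[k] = (q^k - q^{-k}) / (q - q⁻¹)`. -/
def qInt (k : ℤ) : Qq := (q ^ k - q ^ (-k)) / (q - q⁻¹)

/-- `[m]! = [1][2] ⋯ [m]`. -/
def qFactorial (m : ℕ) : Qq := ∏ k ∈ Finset.Icc 1 m, qInt (k : ℤ)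

/-- The quantum binomial coefficient. -/
def qBinom (m r : ℕ) : Qq := qFactorial m / (qFactorial r * qFactorial (m - r))

/-- The pairing `⟨h_i, α_j⟩ = (α_i | α_j)` of type `A_n^{(1)}`; the index set `{0, …, n}` is
`Fin (n + 1)`, whose addition is cyclic. -/
def cartan (n : ℕ) (i j : Fin (n + 1)) : ℤ :=
  2 * (if i = j then 1 else 0) - (if i = j + 1 then 1 else 0) - (if i + 1 = j then 1 else 0)

/-- The scalar `(1/k) [k ⟨h_i, α_j⟩] κ^{-k m_{ij}}`. -/
def structConst (n : ℕ) (M : Matrix (Fin (n + 1)) (Fin (n + 1)) ℤ) (κ : Qq)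
    (i j : Fin (n + 1)) (k : ℤ) : Qq :=
  (k : Qq)⁻¹ * qInt (k * cartan n i j) * κ ^ (-k * M i j)

/-- The index set `ℤ \ {0}` of the Heisenberg generators. -/
abbrev NZ : Type := {l : ℤ // l ≠ 0}

/-! ### Exponentials of formal power series -/

/-- `exp f = ∑_N f^N / N!` for a power series `f` with zero constant term and coefficients in a
(not necessarily commutative) algebra. As `f^N` is divisible by `z^N`, only `N ≤ m` contribute
to the coefficient of `z^m`. -/
def expSeries (R : Type*) {A : Type*} [Field R] [Ring A] [Algebra R A] (f : PowerSeries A) :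
    PowerSeries A :=
  PowerSeries.mk fun m =>
    ∑ N ∈ Finset.range (m + 1), ((N.factorial : R)⁻¹) • PowerSeries.coeff m (f ^ N)

/-- `exp (∑_{k ≥ 1} c_k h_{εk} z^k)` for a sign `ε` and a family `(h_l)_{l ≠ 0}`. -/
def halfExp {R A : Type*} [Field R] [Ring A] [Algebra R A] (c : ℕ → R) (ε : ℤˣ) (h : NZ → A) :
    PowerSeries A :=
  expSeries R (PowerSeries.mk fun k =>
    if hk : k = 0 then 0
    else c k • h ⟨(ε : ℤ) * (k : ℤ), mul_ne_zero (Units.ne_zero ε) (Int.natCast_ne_zero.mpr hk)⟩)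

/-- The Fourier components `K^ε_k`, defined by `K^ε(z) = ∑_{k, εk ≥ 0} K^ε_k z^{-k}
= K^ε exp (ε (q - q⁻¹) ∑_{k ≥ 1} h_{εk} z^{-εk})`. -/
def kMode {A : Type*} [Ring A] [Algebra Qq A] (Kgen : ℤˣ → A) (h : NZ → A) (ε : ℤˣ) (k : ℤ) : A :=
  if 0 ≤ (ε : ℤ) * k then
    Kgen ε * PowerSeries.coeff ((ε : ℤ) * k).toNat
      (halfExp (fun _ => (((ε : ℤ) : Qq) * (q - q⁻¹))) ε h)
  else 0

/-! ### The quantum toroidal algebra -/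

/-- Generators of the quantum toroidal algebra. The argument `ε : ℤˣ` is the sign in
`K_i^±`, `q^{±c/2}`, `q^{±d_1}`, `q^{±d_2}`. -/
inductive Gen (n : ℕ) : Type
  | E (i : Fin (n + 1)) (k : ℤ)
  | F (i : Fin (n + 1)) (k : ℤ)
  | H (i : Fin (n + 1)) (l : NZ)
  | K (i : Fin (n + 1)) (ε : ℤˣ)
  | C (ε : ℤˣ)
  | D₁ (ε : ℤˣ)
  | D₂ (ε : ℤˣ)

/-- The free algebra on the generators. -/
abbrev Free (n : ℕ) : Type := FreeAlgebra Qq (Gen n)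

/-- A generator as an element of the free algebra. -/
abbrev g {n : ℕ} (x : Gen n) : Free n := FreeAlgebra.ι Qq x

/-- `(q^{c/2})^m` for an integer `m`. -/
def cPow (n : ℕ) (m : ℤ) : Free n :=
  if 0 ≤ m then g (Gen.C 1) ^ m.toNat else g (Gen.C (-1)) ^ (-m).toNat

/-- The left-hand side of the Serre relation for a family `x` (either `E_i` or `F_i`) and an
element `y` (`E_{j,l}` or `F_{j,l}`):
`∑_σ ∑_r (-1)^r [m choose r] x_{k_σ(1)} ⋯ x_{k_σ(r)} y x_{k_σ(r+1)} ⋯ x_{k_σ(m)}`. -/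
def serre {A : Type*} [Ring A] [Algebra Qq A] (m : ℕ) (x : ℤ → A) (y : A) (k : Fin m → ℤ) : A :=
  ∑ σ : Equiv.Perm (Fin m), ∑ r ∈ Finset.range (m + 1),
    ((-1) ^ r * qBinom m r) •
      (((List.ofFn fun s => x (k (σ s))).take r).prod * y *
        ((List.ofFn fun s => x (k (σ s))).drop r).prod)

/-- The defining relations of the quantum toroidal algebra. -/
inductive Rel (n : ℕ) (M : Matrix (Fin (n + 1)) (Fin (n + 1)) ℤ) (κ : Qq) :
    Free n → Free n → Prop
  | c_inv (ε : ℤˣ) : Rel n M κ (g (.C ε) * g (.C (-ε))) 1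
  | d₁_inv (ε : ℤˣ) : Rel n M κ (g (.D₁ ε) * g (.D₁ (-ε))) 1
  | d₂_inv (ε : ℤˣ) : Rel n M κ (g (.D₂ ε) * g (.D₂ (-ε))) 1
  | c_central (ε : ℤˣ) (x : Gen n) : Rel n M κ (g (.C ε) * g x) (g x * g (.C ε))
  | k_inv (i : Fin (n + 1)) (ε : ℤˣ) : Rel n M κ (g (.K i ε) * g (.K i (-ε))) 1
  | kk (i j : Fin (n + 1)) (ε η : ℤˣ) :
      Rel n M κ (g (.K i ε) * g (.K j η)) (g (.K j η) * g (.K i ε))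
  | kh (i j : Fin (n + 1)) (ε : ℤˣ) (l : NZ) :
      Rel n M κ (g (.K i ε) * g (.H j l)) (g (.H j l) * g (.K i ε))
  | hh (i j : Fin (n + 1)) (k l : NZ) :
      Rel n M κ (g (.H i k) * g (.H j l) - g (.H j l) * g (.H i k))
        (if k.1 + l.1 = 0 then
          (structConst n M κ i j k.1 * (q - q⁻¹)⁻¹) • (cPow n (2 * k.1) - cPow n (-(2 * k.1)))
        else 0)
  | d₁k (j : Fin (n + 1)) (ε η : ℤˣ) :
      Rel n M κ (g (.D₁ ε) * g (.K j η)) (g (.K j η) * g (.D₁ ε))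
  | d₂k (j : Fin (n + 1)) (ε η : ℤˣ) :
      Rel n M κ (g (.D₂ ε) * g (.K j η)) (g (.K j η) * g (.D₂ ε))
  | d₁h (j : Fin (n + 1)) (l : NZ) :
      Rel n M κ (g (.D₁ 1) * g (.H j l) * g (.D₁ (-1))) (q ^ l.1 • g (.H j l))
  | d₂h (j : Fin (n + 1)) (ε : ℤˣ) (l : NZ) :
      Rel n M κ (g (.D₂ ε) * g (.H j l)) (g (.H j l) * g (.D₂ ε))
  | d₁e (j : Fin (n + 1)) (k : ℤ) :
      Rel n M κ (g (.D₁ 1) * g (.E j k) * g (.D₁ (-1))) (q ^ k • g (.E j k))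
  | d₁f (j : Fin (n + 1)) (k : ℤ) :
      Rel n M κ (g (.D₁ 1) * g (.F j k) * g (.D₁ (-1))) (q ^ k • g (.F j k))
  | d₂e (j : Fin (n + 1)) (k : ℤ) :
      Rel n M κ (g (.D₂ 1) * g (.E j k) * g (.D₂ (-1)))
        (q ^ (if j = 0 then 1 else 0 : ℤ) • g (.E j k))
  | d₂f (j : Fin (n + 1)) (k : ℤ) :
      Rel n M κ (g (.D₂ 1) * g (.F j k) * g (.D₂ (-1)))
        (q ^ (-(if j = 0 then 1 else 0 : ℤ)) • g (.F j k))
  | ke (i j : Fin (n + 1)) (k : ℤ) :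
      Rel n M κ (g (.K i 1) * g (.E j k) * g (.K i (-1))) (q ^ cartan n i j • g (.E j k))
  | kf (i j : Fin (n + 1)) (k : ℤ) :
      Rel n M κ (g (.K i 1) * g (.F j k) * g (.K i (-1))) (q ^ (-cartan n i j) • g (.F j k))
  | he (i j : Fin (n + 1)) (k : NZ) (l : ℤ) :
      Rel n M κ (g (.H i k) * g (.E j l) - g (.E j l) * g (.H i k))
        (structConst n M κ i j k.1 • (cPow n (-|k.1|) * g (.E j (k.1 + l))))
  | hf (i j : Fin (n + 1)) (k : NZ) (l : ℤ) :
      Rel n M κ (g (.H i k) * g (.F j l) - g (.F j l) * g (.H i k))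
        (-(structConst n M κ i j k.1 • (cPow n |k.1| * g (.F j (k.1 + l)))))
  | ee (i j : Fin (n + 1)) (k l : ℤ) :
      Rel n M κ
        (κ ^ M i j • (g (.E i (k + 1)) * g (.E j l))
          - (q ^ cartan n i j * κ ^ M i j) • (g (.E j l) * g (.E i (k + 1))))
        (q ^ cartan n i j • (g (.E i k) * g (.E j (l + 1))) - g (.E j (l + 1)) * g (.E i k))
  | ff (i j : Fin (n + 1)) (k l : ℤ) :
      Rel n M κ
        (κ ^ M i j • (g (.F i (k + 1)) * g (.F j l))
          - (q ^ (-cartan n i j) * κ ^ M i j) • (g (.F j l) * g (.F i (k + 1))))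
        (q ^ (-cartan n i j) • (g (.F i k) * g (.F j (l + 1))) - g (.F j (l + 1)) * g (.F i k))
  | ef (i j : Fin (n + 1)) (k l : ℤ) :
      Rel n M κ (g (.E i k) * g (.F j l) - g (.F j l) * g (.E i k))
        (if i = j then
          (q - q⁻¹)⁻¹ •
            (cPow n (k - l) * kMode (fun ε => g (.K i ε)) (fun r => g (.H i r)) 1 (k + l)
              - cPow n (l - k) * kMode (fun ε => g (.K i ε)) (fun r => g (.H i r)) (-1) (k + l))
        else 0)
  | serreE (i j : Fin (n + 1)) (hij : i ≠ j) (k : Fin (1 - cartan n i j).toNat → ℤ) (l : ℤ) :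
      Rel n M κ (serre _ (fun r => g (.E i r)) (g (.E j l)) k) 0
  | serreF (i j : Fin (n + 1)) (hij : i ≠ j) (k : Fin (1 - cartan n i j).toNat → ℤ) (l : ℤ) :
      Rel n M κ (serre _ (fun r => g (.F i r)) (g (.F j l)) k) 0

/-- The quantum toroidal algebra `U_q(sl_{n+1,tor})` over `ℚ(q)` with parameters `M`, `κ`. -/
abbrev Uqtor (n : ℕ) (M : Matrix (Fin (n + 1)) (Fin (n + 1)) ℤ) (κ : Qq) : Type :=
  RingQuot (Rel n M κ)

/-- A generator as an element of the quantum toroidal algebra. -/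
def gen {n : ℕ} (M : Matrix (Fin (n + 1)) (Fin (n + 1)) ℤ) (κ : Qq) (x : Gen n) : Uqtor n M κ :=
  RingQuot.mkAlgHom Qq (Rel n M κ) (g x)

/-! ### The Heisenberg algebra and its Fock space -/

section Fock

variable (n : ℕ) (M : Matrix (Fin (n + 1)) (Fin (n + 1)) ℤ) (κ : Qq)
  (𝕜 : Type*) [Field 𝕜] [Algebra Qq 𝕜]

/-- The relations of the Heisenberg algebra (at `c = 1`). -/
inductive HeisRel : FreeAlgebra 𝕜 (Fin (n + 1) × NZ) → FreeAlgebra 𝕜 (Fin (n + 1) × NZ) → Prop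
  | hh (i j : Fin (n + 1)) (k l : NZ) :
      HeisRel
        (FreeAlgebra.ι 𝕜 (i, k) * FreeAlgebra.ι 𝕜 (j, l)
          - FreeAlgebra.ι 𝕜 (j, l) * FreeAlgebra.ι 𝕜 (i, k))
        (if k.1 + l.1 = 0 then
          algebraMap 𝕜 _ (algebraMap Qq 𝕜 (structConst n M κ i j k.1 * qInt k.1))
        else 0)

/-- The Heisenberg algebra `S_n`, with scalars in `𝕜`. -/
abbrev Heis : Type _ := RingQuot (HeisRel n M κ 𝕜)

/-- The generator `H_{i,l}` of the Heisenberg algebra. -/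
def heisH (i : Fin (n + 1)) (l : NZ) : Heis n M κ 𝕜 :=
  RingQuot.mkAlgHom 𝕜 (HeisRel n M κ 𝕜) (FreeAlgebra.ι 𝕜 (i, l))

/-- The left ideal generated by the `H_{i,l}` with `l > 0`. -/
def annihilators : Submodule (Heis n M κ 𝕜) (Heis n M κ 𝕜) :=
  Submodule.span _ {x | ∃ (i : Fin (n + 1)) (l : NZ), 0 < l.1 ∧ x = heisH n M κ 𝕜 i l}

/-- The Fock space `F_n = S_n v₀`, with defining relations `H_{i,l} v₀ = 0` for `l > 0`. -/
abbrev Fock : Type _ := Heis n M κ 𝕜 ⧸ annihilators n M κ 𝕜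

/-- The vacuum vector `v₀`. -/
def vac : Fock n M κ 𝕜 := Submodule.Quotient.mk 1

/-- The vector `H_{i₁,-k₁} ⋯ H_{i_N,-k_N} v₀`, where the list is `(i₁, k₁), …, (i_N, k_N)`. -/
def monomialVec (L : List (Fin (n + 1) × ℕ+)) : Fock n M κ 𝕜 :=
  (L.map fun x => heisH n M κ 𝕜 x.1
    ⟨-(x.2 : ℤ), neg_ne_zero.mpr (Int.natCast_ne_zero.mpr x.2.ne_zero)⟩).prod • vac n M κ 𝕜

end Fock

/-! ### The twisted group algebra of the affine root lattice -/

section Lattice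

variable (n : ℕ) (𝕜 : Type*) [Field 𝕜]

/-- The relations of the twisted group algebra; the symbol `(i, ε)` is `(e^{α_i})^ε`. -/
inductive TwistRel : FreeAlgebra 𝕜 (Fin (n + 1) × ℤˣ) → FreeAlgebra 𝕜 (Fin (n + 1) × ℤˣ) → Prop
  | inv (i : Fin (n + 1)) (ε : ℤˣ) :
      TwistRel (FreeAlgebra.ι 𝕜 (i, ε) * FreeAlgebra.ι 𝕜 (i, -ε)) 1
  | comm (i j : Fin (n + 1)) :
      TwistRel (FreeAlgebra.ι 𝕜 (i, 1) * FreeAlgebra.ι 𝕜 (j, 1))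
        ((-1 : 𝕜) ^ cartan n i j • (FreeAlgebra.ι 𝕜 (j, 1) * FreeAlgebra.ι 𝕜 (i, 1)))

/-- The twisted group algebra `𝕜{Q}` of the affine root lattice `Q = ⊕ ℤ α_i`. -/
abbrev TwistAlg : Type _ := RingQuot (TwistRel n 𝕜)

/-- The symbol `(e^{α_i})^ε` in the twisted group algebra. -/
def expRoot (i : Fin (n + 1)) (ε : ℤˣ) : TwistAlg n 𝕜 :=
  RingQuot.mkAlgHom 𝕜 (TwistRel n 𝕜) (FreeAlgebra.ι 𝕜 (i, ε))

theorem expRoot_mul (i : Fin (n + 1)) (ε : ℤˣ) :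
    expRoot n 𝕜 i ε * expRoot n 𝕜 i (-ε) = 1 := by
  unfold expRoot
  rw [← map_mul, RingQuot.mkAlgHom_rel 𝕜 (TwistRel.inv i ε), map_one]

/-- `e^{α_i}` as a unit. -/
def expRootUnit (i : Fin (n + 1)) : (TwistAlg n 𝕜)ˣ where
  val := expRoot n 𝕜 i 1
  inv := expRoot n 𝕜 i (-1)
  val_inv := expRoot_mul n 𝕜 i 1
  inv_val := by simpa using expRoot_mul n 𝕜 i (-1)

/-- `e^β = (e^{α_0})^{m_0} (e^{α_1})^{m_1} ⋯ (e^{α_n})^{m_n}` for `β = ∑ m_i α_i`, given by its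
coordinates `m_i = β i`. -/
def expLattice (β : Fin (n + 1) → ℤ) : TwistAlg n 𝕜 :=
  ((List.ofFn fun i => expRootUnit n 𝕜 i ^ β i).prod : (TwistAlg n 𝕜)ˣ)

end Lattice

/-! ### The space `V(p)_n` and the operators on it -/

section Modules

variable (n : ℕ) (M : Matrix (Fin (n + 1)) (Fin (n + 1)) ℤ) (κ : Qq)
  (𝕜 : Type*) [Field 𝕜] [Algebra Qq 𝕜]

/-- The space `V(p)_n = F_n ⊗ 𝕜{Q} e^{Λ_p}`. The symbol `e^{Λ_p}` only records the index `p`: the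
vector `v ⊗ e^β e^{Λ_p}` is written `v ⊗ₜ expLattice n 𝕜 β`, and `p` enters through the formulas
for the operators. -/
abbrev VSpace : Type _ := Fock n M κ 𝕜 ⊗[𝕜] TwistAlg n 𝕜

/-- The vector `v ⊗ e^β e^{Λ_p}`. -/
def vec (v : Fock n M κ 𝕜) (β : Fin (n + 1) → ℤ) : VSpace n M κ 𝕜 := v ⊗ₜ[𝕜] expLattice n 𝕜 β

/-- The operator `H_{i,l}` on `V(p)_n`. -/
def opH (i : Fin (n + 1)) (l : NZ) : Module.End 𝕜 (VSpace n M κ 𝕜) :=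
  LinearMap.rTensor (TwistAlg n 𝕜) (Algebra.lsmul 𝕜 𝕜 (Fock n M κ 𝕜) (heisH n M κ 𝕜 i l))

/-- The operator `(e^{α_i})^ε = e^{ε α_i}` on `V(p)_n`. -/
def opExp (i : Fin (n + 1)) (ε : ℤˣ) : Module.End 𝕜 (VSpace n M κ 𝕜) :=
  LinearMap.lTensor (Fock n M κ 𝕜) (LinearMap.mulLeft 𝕜 (expRoot n 𝕜 i ε))

/-- `⟨h_i, β + Λ_p⟩`. -/
def pairing (p i : Fin (n + 1)) (β : Fin (n + 1) → ℤ) : ℤ :=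
  (∑ k, cartan n i k * β k) + (if i = p then 1 else 0)

/-- `∑_k ⟨h_i, m_k α_k⟩ m_{ik}` for `β = ∑ m_k α_k`; the operator `z^{H_{i,0}}` multiplies
`v ⊗ e^β e^{Λ_p}` by `z^{⟨h_i, β + Λ_p⟩}` and by `κ^{1/2}` to this power. -/
def twist (i : Fin (n + 1)) (β : Fin (n + 1) → ℤ) : ℤ := ∑ k, cartan n i k * β k * M i k

/-- `(β | β)`, an even integer. -/
def normSq (β : Fin (n + 1) → ℤ) : ℤ := ∑ i, ∑ j, cartan n i j * β i * β j

/-- The eigenvalue of `d₁` on `H_{i₁,-k₁} ⋯ H_{i_N,-k_N} v₀ ⊗ e^β e^{Λ_p}`, namely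
`-∑ k_s - (β|β)/2 - (β|Λ_p)`, where `(β|Λ_p) = m_p`. -/
def degOne (p : Fin (n + 1)) (L : List (Fin (n + 1) × ℕ+)) (β : Fin (n + 1) → ℤ) : ℤ :=
  -(L.map fun x => (x.2 : ℤ)).sum - normSq n β / 2 - β p

/-- The coefficient of `z^m` in `A(z) B(z⁻¹) z^N x`, that is `∑_{a - b + N = m} A_a (B_b x)`, for
power series `A`, `B` of operators, where `B_b x = 0` for almost all `b`. -/
def laurentCoeff {V : Type*} [AddCommGroup V] [Module 𝕜 V] (A B : PowerSeries (Module.End 𝕜 V))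
    (N m : ℤ) (x : V) : V :=
  ∑ᶠ b : ℕ, if 0 ≤ m - N + b then
    PowerSeries.coeff (m - N + b).toNat A (PowerSeries.coeff b B x) else 0

variable (s : 𝕜)

/-- `exp (∑_{k ≥ 1} (H_{i,-k} / [k]) (q^{-1/2} z)^k)`, a power series in `z`; here `s = q^{1/2}`. -/
def ePlus (i : Fin (n + 1)) : PowerSeries (Module.End 𝕜 (VSpace n M κ 𝕜)) :=
  halfExp (fun k => (algebraMap Qq 𝕜 (qInt k))⁻¹ * s ^ (-(k : ℤ))) (-1) (opH n M κ 𝕜 i)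

/-- `exp (∑_{k ≥ 1} -(H_{i,k} / [k]) (q^{1/2} z)^{-k})`, a power series in `z⁻¹`. -/
def eMinus (i : Fin (n + 1)) : PowerSeries (Module.End 𝕜 (VSpace n M κ 𝕜)) :=
  halfExp (fun k => -((algebraMap Qq 𝕜 (qInt k))⁻¹ * s ^ (-(k : ℤ)))) 1 (opH n M κ 𝕜 i)

/-- `exp (∑_{k ≥ 1} -(H_{i,-k} / [k]) (q^{1/2} z)^k)`, a power series in `z`. -/
def fPlus (i : Fin (n + 1)) : PowerSeries (Module.End 𝕜 (VSpace n M κ 𝕜)) :=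
  halfExp (fun k => -((algebraMap Qq 𝕜 (qInt k))⁻¹ * s ^ (k : ℤ))) (-1) (opH n M κ 𝕜 i)

/-- `exp (∑_{k ≥ 1} (H_{i,k} / [k]) (q^{-1/2} z)^{-k})`, a power series in `z⁻¹`. -/
def fMinus (i : Fin (n + 1)) : PowerSeries (Module.End 𝕜 (VSpace n M κ 𝕜)) :=
  halfExp (fun k => (algebraMap Qq 𝕜 (qInt k))⁻¹ * s ^ (k : ℤ)) 1 (opH n M κ 𝕜 i)

/-- `exp (ε (q - q⁻¹) ∑_{k ≥ 1} H_{i,εk} z^{-εk})`, a power series in `z^{-ε}`. -/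
def kExp (i : Fin (n + 1)) (ε : ℤˣ) : PowerSeries (Module.End 𝕜 (VSpace n M κ 𝕜)) :=
  halfExp (fun _ => ((ε : ℤ) : 𝕜) * algebraMap Qq 𝕜 (q - q⁻¹)) ε (opH n M κ 𝕜 i)

/-- The action of the generators of the quantum toroidal algebra on `V(p)_n` is the one given by
the vertex operators; `s = q^{1/2}`, `t = κ^{1/2}`. -/
structure IsVertexAction (p : Fin (n + 1)) (t : 𝕜)
    (ρ : Uqtor n M κ →ₐ[Qq] Module.End 𝕜 (VSpace n M κ 𝕜)) : Prop where
  /-- `q^{±c/2} ↦ q^{±1/2}` -/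
  c_eq : ∀ (ε : ℤˣ) (x : VSpace n M κ 𝕜), ρ (gen M κ (.C ε)) x = s ^ (ε : ℤ) • x
  /-- `q^{±d₁} ↦ q^{±d₁}` -/
  d₁_eq : ∀ (ε : ℤˣ) (L : List (Fin (n + 1) × ℕ+)) (β : Fin (n + 1) → ℤ),
    ρ (gen M κ (.D₁ ε)) (vec n M κ 𝕜 (monomialVec n M κ 𝕜 L) β) =
      (algebraMap Qq 𝕜 q) ^ ((ε : ℤ) * degOne n p L β) •
        vec n M κ 𝕜 (monomialVec n M κ 𝕜 L) β
  /-- `q^{±d₂} ↦ q^{±d₂}` -/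
  d₂_eq : ∀ (ε : ℤˣ) (v : Fock n M κ 𝕜) (β : Fin (n + 1) → ℤ),
    ρ (gen M κ (.D₂ ε)) (vec n M κ 𝕜 v β) =
      (algebraMap Qq 𝕜 q) ^ ((ε : ℤ) * β 0) • vec n M κ 𝕜 v β
  /-- `H_{i,l} ↦ H_{i,l}` -/
  h_eq : ∀ (i : Fin (n + 1)) (l : NZ), ρ (gen M κ (.H i l)) = opH n M κ 𝕜 i l
  /-- `K_i^± ↦ q^{±∂_{α_i}}` -/
  k_eq : ∀ (i : Fin (n + 1)) (ε : ℤˣ) (v : Fock n M κ 𝕜) (β : Fin (n + 1) → ℤ),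
    ρ (gen M κ (.K i ε)) (vec n M κ 𝕜 v β) =
      (algebraMap Qq 𝕜 q) ^ ((ε : ℤ) * pairing n p i β) • vec n M κ 𝕜 v β
  /-- `K_i^ε(z) ↦ exp (ε (q - q⁻¹) ∑_{k ≥ 1} H_{i,εk} z^{-εk}) q^{ε ∂_{α_i}}`: equality of the
  coefficients of `z^{-εk}` -/
  kMode_eq : ∀ (i : Fin (n + 1)) (ε : ℤˣ) (k : ℕ) (v : Fock n M κ 𝕜) (β : Fin (n + 1) → ℤ),
    ρ (kMode (fun η => gen M κ (.K i η)) (fun l => gen M κ (.H i l)) ε ((ε : ℤ) * (k : ℤ)))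
        (vec n M κ 𝕜 v β) =
      PowerSeries.coeff k (kExp n M κ 𝕜 i ε)
        ((algebraMap Qq 𝕜 q) ^ ((ε : ℤ) * pairing n p i β) • vec n M κ 𝕜 v β)
  /-- `E_i(z)`: equality of the coefficients of `z^{-k}` -/
  e_eq : ∀ (i : Fin (n + 1)) (k : ℤ) (v : Fock n M κ 𝕜) (β : Fin (n + 1) → ℤ),
    ρ (gen M κ (.E i k)) (vec n M κ 𝕜 v β) =
      laurentCoeff 𝕜 (ePlus n M κ 𝕜 s i) (eMinus n M κ 𝕜 s i) (pairing n p i β + 1) (-k)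
        (opExp n M κ 𝕜 i 1 (t ^ twist n M i β • vec n M κ 𝕜 v β))
  /-- `F_i(z)`: equality of the coefficients of `z^{-k}` -/
  f_eq : ∀ (i : Fin (n + 1)) (k : ℤ) (v : Fock n M κ 𝕜) (β : Fin (n + 1) → ℤ),
    ρ (gen M κ (.F i k)) (vec n M κ 𝕜 v β) =
      laurentCoeff 𝕜 (fPlus n M κ 𝕜 s i) (fMinus n M κ 𝕜 s i) (-pairing n p i β + 1) (-k)
        (opExp n M κ 𝕜 i (-1) (t ^ (-twist n M i β) • vec n M κ 𝕜 v β))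

end Modules

end

end QToroidal

/-! On a vector of weight `β` each vertex operator is a scalar power of `t` times (a mode of an
operator on the Fock space) ⊗ (multiplication by `e^{±α_i}`). The Fock part has the form A(z)B(z⁻¹),
with A an exponential of creation operators and B one of annihilation operators.

The Heisenberg commutators are scalars, so moving B_X(z⁻¹) past A_Y(w) costs only a scalar series
f(w/z) (`contraction`, `Contracts`). With ε = 1 for E and ε = -1 for F, a = ⟨h_i, α_j⟩ and u = w/z,
this series is 1 for a = 0. For two fields of the same kind it is (1 - u)(1 - q^{-2ε}u) on the
diagonal and 1/(1 - q^{-ε}κ^{-m_ij}u) for a = -1; for opposite kinds it is 1/((1 - qu)(1 - q⁻¹u)) on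
the diagonal and 1 - κ^{-m_ij}u for a = -1.

Both orders of a product are thus expressed through the same normally ordered modes :X_c Y_{n-c}:.
On a fixed vector only finitely many of these are nonzero, so any function of c may serve as a
coefficient (`kernel₂`, `kernel₃`). Each quadratic relation becomes an identity of functions on ℤ,
and the Serre relation one on ℤ², symmetrized (`Modes.mode_serre`). For E_i against F_i the two
expansions of the contraction differ by delta functions at z = qw and z = q⁻¹w; there the creation
or the annihilation parts cancel and what remains is K_i^± (`kernel_q`, `kernel_q_inv`,
`mode_opp_self`).

The lattice factor supplies the rest: reordering the `e^{α_i}` gives the signs, and `z^{H_{i,0}}`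
acting after `e^{α_j}` gives the index shifts and the powers of `t`. Operators diagonal in the
weight are built from a coaction and the degree operator from an automorphism of the Heisenberg
algebra, so spanning sets suffice and no basis is needed. Uniqueness holds because each generator is
prescribed on a spanning set, and the second level is 1 because the columns of the Cartan matrix sum
to zero. -/

namespace QToroidal

noncomputable section

/-! ### Exponentials of power series over a noncommutative algebra -/

section Exponentials

/-- The derivation `z d/dz`. -/
def eulerOp {A : Type*} [Ring A] (f : PowerSeries A) : PowerSeries A :=
  PowerSeries.mk fun n => n • PowerSeries.coeff n f

variable {A : Type*} [Ring A]

@[simp] theorem coeff_eulerOp (f : PowerSeries A) (n : ℕ) :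
    PowerSeries.coeff n (eulerOp f) = n • PowerSeries.coeff n f := by
  simp [eulerOp]

theorem eulerOp_add (f g : PowerSeries A) : eulerOp (f + g) = eulerOp f + eulerOp g := by
  ext n; simp

theorem eulerOp_sub (f g : PowerSeries A) : eulerOp (f - g) = eulerOp f - eulerOp g := by
  ext n; simp [nsmul_eq_mul, mul_sub]

theorem eulerOp_C (a : A) : eulerOp (PowerSeries.C a) = 0 := by
  ext n
  rcases n with _ | n <;> simp [PowerSeries.coeff_C]

theorem eulerOp_mul (f g : PowerSeries A) : eulerOp (f * g) = eulerOp f * g + f * eulerOp g := by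
  ext n
  simp only [coeff_eulerOp, map_add, PowerSeries.coeff_mul, Finset.smul_sum,
    ← Finset.sum_add_distrib]
  refine Finset.sum_congr rfl fun p hp => ?_
  rw [← Finset.HasAntidiagonal.mem_antidiagonal.mp hp, add_smul, smul_mul_assoc, mul_smul_comm]

/-- Commutation of `f` with its own derivative is what keeps the power rule valid in a
noncommutative ring. -/
theorem eulerOp_pow {f : PowerSeries A} (h : Commute f (eulerOp f)) (N : ℕ) :
    eulerOp (f ^ (N + 1)) = (N + 1) • (eulerOp f * f ^ N) := by
  induction N with
  | zero => simp
  | succ N ih =>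
    rw [pow_succ, eulerOp_mul, ih, smul_mul_assoc, mul_assoc, ← pow_succ,
      (h.pow_left (N + 1)).eq, ← succ_nsmul]

theorem coeff_pow_eq_zero {f : PowerSeries A} (h : PowerSeries.coeff 0 f = 0) (N n : ℕ)
    (hn : n < N) : PowerSeries.coeff n (f ^ N) = 0 := by
  induction N generalizing n with
  | zero => omega
  | succ N ih =>
    rw [pow_succ', PowerSeries.coeff_mul]
    refine Finset.sum_eq_zero fun p hp => ?_
    have hp' := Finset.HasAntidiagonal.mem_antidiagonal.mp hp
    rcases Nat.eq_zero_or_pos p.1 with h0 | h0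
    · rw [h0, h, zero_mul]
    · rw [ih p.2 (by omega), mul_zero]

/-- `X` satisfies the differential equation and the initial condition that characterize `exp x`. -/
structure IsExp (x X : PowerSeries A) : Prop where
  coeff_zero : PowerSeries.coeff 0 X = 1
  euler : eulerOp X = eulerOp x * X

/-- In n Z_n = ∑ k y_k Z_{n-k} the term k = 0 carries the factor 0, so Z_n is determined by earlier
coefficients after division by n. -/
theorem eq_zero_of_eulerOp [Module ℚ A] {y Z : PowerSeries A} (h0 : PowerSeries.coeff 0 Z = 0)
    (h : eulerOp Z = eulerOp y * Z) : Z = 0 := by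
  ext n
  induction n using Nat.strong_induction_on with
  | _ n ih =>
    rcases Nat.eq_zero_or_pos n with rfl | hn
    · simpa using h0
    have h1 := congrArg (PowerSeries.coeff n) h
    rw [coeff_eulerOp, PowerSeries.coeff_mul, Finset.sum_eq_zero] at h1
    · have h2 : ((n : ℚ)⁻¹ * (n : ℚ)) • PowerSeries.coeff n Z = 0 := by
        rw [mul_smul, Nat.cast_smul_eq_nsmul, h1, smul_zero]
      rwa [inv_mul_cancel₀ (by exact_mod_cast hn.ne'), one_smul] at h2
    · intro p hp
      have hp' := Finset.HasAntidiagonal.mem_antidiagonal.mp hp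
      rcases Nat.eq_zero_or_pos p.1 with h3 | h3
      · simp [h3]
      · rw [ih p.2 (by omega)]; simp

theorem IsExp.unique [Module ℚ A] {x X Y : PowerSeries A} (hX : IsExp x X) (hY : IsExp x Y) :
    X = Y := by
  refine sub_eq_zero.mp (eq_zero_of_eulerOp (y := x) ?_ ?_)
  · simp only [map_sub]; rw [hX.coeff_zero, hY.coeff_zero, sub_self]
  · rw [eulerOp_sub, hX.euler, hY.euler, mul_sub]

/-- By Leibniz the derivative is x'XY + Xy'Y, so it is enough that y' passes to the left of `X`. -/
theorem IsExp.mul {x y X Y : PowerSeries A} (hX : IsExp x X) (hY : IsExp y Y)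
    (h : Commute X (eulerOp y)) : IsExp (x + y) (X * Y) where
  coeff_zero := by
    have h1 := hX.coeff_zero
    have h2 := hY.coeff_zero
    rw [PowerSeries.coeff_zero_eq_constantCoeff_apply] at *
    rw [map_mul, h1, h2, one_mul]
  euler := by
    rw [eulerOp_mul, eulerOp_add, hX.euler, hY.euler, ← mul_assoc X, h.eq, add_mul]
    simp only [mul_assoc]

theorem commute_of_coeff {f g : PowerSeries A}
    (h : ∀ k l, Commute (PowerSeries.coeff k f) (PowerSeries.coeff l g)) : Commute f g := by
  ext n
  rw [PowerSeries.coeff_mul, PowerSeries.coeff_mul, ← Finset.Nat.sum_antidiagonal_swap]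
  exact Finset.sum_congr rfl fun p _ => (h _ _).eq

/-- If `h` commutes with all coefficients of `y` up to the central term `[h, y_k] = μ`, then
`[h, exp y] = μ z^k exp y`. -/
theorem IsExp.commutator [Module ℚ A] {y Y : PowerSeries A} (hY : IsExp y Y) {h : A} {k : ℕ}
    (hk : k ≠ 0) {μ : A} (hμ : ∀ a : A, Commute μ a)
    (hy : ∀ l, l ≠ 0 → h * PowerSeries.coeff l y - PowerSeries.coeff l y * h =
      if l = k then μ else 0) :
    PowerSeries.C h * Y - Y * PowerSeries.C h = PowerSeries.C μ * PowerSeries.X ^ k * Y := by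
  have hc : ∀ a : PowerSeries A, Commute (PowerSeries.C μ * PowerSeries.X ^ k) a := fun a =>
    (commute_of_coeff fun i j => by
      rw [PowerSeries.coeff_C]; split_ifs
      · exact hμ _
      · exact Commute.zero_left _).mul_left (PowerSeries.commute_X_pow a k).symm
  have hE : PowerSeries.C h * eulerOp y - eulerOp y * PowerSeries.C h =
      eulerOp (PowerSeries.C μ * PowerSeries.X ^ k) := by
    ext l
    simp only [map_sub, PowerSeries.coeff_C_mul, PowerSeries.coeff_mul_C, coeff_eulerOp,
      PowerSeries.coeff_X_pow, mul_smul_comm, smul_mul_assoc, ← smul_sub]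
    rcases Nat.eq_zero_or_pos l with rfl | hl
    · simp
    · rw [hy l hl.ne']; simp
  -- The difference Z of the two sides has zero constant term because `k ≠ 0`, and it satisfies Z' =
  -- y'Z; uniqueness makes it vanish.
  refine sub_eq_zero.mp (eq_zero_of_eulerOp (y := y) ?_ ?_)
  · have h1 := hY.coeff_zero
    simp only [map_sub, PowerSeries.coeff_C_mul, PowerSeries.coeff_mul_C, h1, mul_assoc,
      PowerSeries.coeff_X_pow_mul']
    simp [hk]
  · rw [eulerOp_sub, eulerOp_sub, eulerOp_mul, eulerOp_mul, eulerOp_mul _ Y, eulerOp_C, hY.euler,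
      ← hE, zero_mul, mul_zero, mul_sub, ← mul_assoc (eulerOp y) _ Y, ← (hc (eulerOp y)).eq]
    noncomm_ring

/-- The coefficient of a power series at an integer, zero at negative integers. -/
def zCoeff (X : PowerSeries A) (a : ℤ) : A := if 0 ≤ a then PowerSeries.coeff a.toNat X else 0

@[simp] theorem zCoeff_natCast (X : PowerSeries A) (n : ℕ) :
    zCoeff X n = PowerSeries.coeff n X := by simp [zCoeff]

theorem zCoeff_of_neg (X : PowerSeries A) {a : ℤ} (h : ¬ 0 ≤ a) : zCoeff X a = 0 := by
  simp [zCoeff, h]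

theorem zCoeff_C_mul (h : A) (X : PowerSeries A) (a : ℤ) :
    zCoeff (PowerSeries.C h * X) a = h * zCoeff X a := by
  unfold zCoeff; split_ifs <;> simp

theorem zCoeff_mul_C (h : A) (X : PowerSeries A) (a : ℤ) :
    zCoeff (X * PowerSeries.C h) a = zCoeff X a * h := by
  unfold zCoeff; split_ifs <;> simp

theorem zCoeff_sub (X Y : PowerSeries A) (a : ℤ) :
    zCoeff (X - Y) a = zCoeff X a - zCoeff Y a := by
  unfold zCoeff; split_ifs <;> simp

theorem zCoeff_X_pow_mul (X : PowerSeries A) (k : ℕ) (a : ℤ) :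
    zCoeff (PowerSeries.X ^ k * X) a = zCoeff X (a - k) := by
  rcases le_or_gt 0 a with h | h
  · lift a to ℕ using h
    rw [zCoeff_natCast, PowerSeries.coeff_X_pow_mul']
    split_ifs with h1
    · rw [← Nat.cast_sub h1, zCoeff_natCast]
    · rw [zCoeff_of_neg]; omega
  · rw [zCoeff_of_neg, zCoeff_of_neg] <;> omega

theorem IsExp.zCoeff_commutator [Module ℚ A] {y Y : PowerSeries A} (hY : IsExp y Y) {h : A}
    {k : ℕ} (hk : k ≠ 0) {μ : A} (hμ : ∀ a : A, Commute μ a)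
    (hy : ∀ l, l ≠ 0 → h * PowerSeries.coeff l y - PowerSeries.coeff l y * h =
      if l = k then μ else 0) (a : ℤ) :
    h * zCoeff Y a - zCoeff Y a * h = μ * zCoeff Y (a - k) := by
  have := congrArg (fun Z => zCoeff Z a) (hY.commutator hk hμ hy)
  simpa only [zCoeff_sub, zCoeff_C_mul, zCoeff_mul_C, mul_assoc, zCoeff_X_pow_mul] using this

/-- Both sides run over the triples of natural numbers with sum `b`. -/
theorem sum_antidiagonal_assoc {B : Type*} [AddCommMonoid B] (g : ℕ → ℕ → ℕ → B) (b : ℕ) :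
    ∑ p ∈ Finset.HasAntidiagonal.antidiagonal b,
      ∑ r ∈ Finset.HasAntidiagonal.antidiagonal p.2, g p.1 r.1 r.2 =
    ∑ p ∈ Finset.HasAntidiagonal.antidiagonal b,
      ∑ r ∈ Finset.HasAntidiagonal.antidiagonal p.1, g r.1 r.2 p.2 := by
  rw [Finset.sum_sigma', Finset.sum_sigma']
  refine Finset.sum_nbij' (fun z => ⟨(z.1.1 + z.2.1, z.2.2), (z.1.1, z.2.1)⟩)
    (fun z => ⟨(z.2.1, z.2.2 + z.1.2), (z.2.2, z.1.2)⟩) ?_ ?_ ?_ ?_ ?_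
  all_goals
    rintro ⟨⟨a, b⟩, ⟨c, d⟩⟩ h
    simp only [Finset.mem_sigma, Finset.HasAntidiagonal.mem_antidiagonal] at h ⊢
  · exact ⟨by omega, trivial⟩
  · exact ⟨by omega, trivial⟩
  · obtain ⟨h1, rfl⟩ := h; rfl
  · obtain ⟨h1, rfl⟩ := h; rfl

theorem sum_antidiagonal_left_comm {B : Type*} [AddCommMonoid B] (g : ℕ → ℕ → ℕ → B) (b : ℕ) :
    ∑ p ∈ Finset.HasAntidiagonal.antidiagonal b,
      ∑ r ∈ Finset.HasAntidiagonal.antidiagonal p.2, g p.1 r.1 r.2 =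
    ∑ p ∈ Finset.HasAntidiagonal.antidiagonal b,
      ∑ r ∈ Finset.HasAntidiagonal.antidiagonal p.2, g r.1 p.1 r.2 := by
  rw [sum_antidiagonal_assoc, sum_antidiagonal_assoc fun i j l => g j i l]
  exact Finset.sum_congr rfl fun p _ => (Finset.Nat.sum_antidiagonal_swap
    (f := fun r => g r.1 r.2 p.2)).symm

/-- `exp x · exp y = f · exp y · exp x` in coefficients, if `[x_k, y_l] = δ_{kl} μ_k` with scalars
`μ_k`, where `f = exp μ`. -/
theorem contraction_nat {R : Type*} [Field R] [CharZero R] [Algebra R A]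
    {x y X Y : PowerSeries A} {μ f : PowerSeries R} (hX : IsExp x X)
    (hY : IsExp y Y) (hf : IsExp μ f)
    (hxy : ∀ k l, k ≠ 0 → l ≠ 0 →
      PowerSeries.coeff k x * PowerSeries.coeff l y - PowerSeries.coeff l y * PowerSeries.coeff k x =
        if l = k then algebraMap R A (PowerSeries.coeff k μ) else 0) (b : ℕ) (a : ℤ) :
    PowerSeries.coeff b X * zCoeff Y a = ∑ p ∈ Finset.HasAntidiagonal.antidiagonal b,
      PowerSeries.coeff p.1 f • (zCoeff Y (a - p.1) * PowerSeries.coeff p.2 X) := by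
  let _ : Module ℚ A := Module.compHom A (algebraMap ℚ R)
  induction b using Nat.strong_induction_on generalizing a with
  | _ b ih =>
    rcases Nat.eq_zero_or_pos b with rfl | hb
    · simp only [Finset.Nat.antidiagonal_zero, Finset.sum_singleton]
      rw [hX.coeff_zero, hf.coeff_zero]; simp
    -- The Euler equation gives b X_b = ∑ k x_k X_{b-k}. The induction hypothesis moves X_{b-k} past
    -- Y; moving x_k past Y then adds a term with μ_k. The Euler equations for X and for f collect
    -- the two kinds of terms with weights `p.2` and `p.1`, whose sum is `b`.
    have key : (b : R) • (PowerSeries.coeff b X * zCoeff Y a) = (b : R) •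
        ∑ p ∈ Finset.HasAntidiagonal.antidiagonal b,
          PowerSeries.coeff p.1 f • (zCoeff Y (a - p.1) * PowerSeries.coeff p.2 X) := by
      have e1 := congrArg (PowerSeries.coeff b) hX.euler
      rw [coeff_eulerOp, PowerSeries.coeff_mul] at e1
      have e2 : ∀ p ∈ Finset.HasAntidiagonal.antidiagonal b,
          PowerSeries.coeff p.1 (eulerOp x) * PowerSeries.coeff p.2 X * zCoeff Y a =
          ∑ r ∈ Finset.HasAntidiagonal.antidiagonal p.2,
            (PowerSeries.coeff r.1 f • (zCoeff Y (a - r.1) *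
                (PowerSeries.coeff p.1 (eulerOp x) * PowerSeries.coeff r.2 X))
              + (PowerSeries.coeff p.1 (eulerOp μ) * PowerSeries.coeff r.1 f) •
                (zCoeff Y (a - (p.1 + r.1 : ℕ)) * PowerSeries.coeff r.2 X)) := by
        intro p hp
        have hp' := Finset.HasAntidiagonal.mem_antidiagonal.mp hp
        rcases Nat.eq_zero_or_pos p.1 with h0 | h0
        · simp [h0]
        rw [mul_assoc, ih p.2 (by omega), Finset.mul_sum]
        refine Finset.sum_congr rfl fun r _ => ?_
        have e3 := hY.zCoeff_commutator h0.ne' (fun c => Algebra.commutes _ c)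
          (fun l hl => hxy p.1 l h0.ne' hl) (a - r.1)
        rw [coeff_eulerOp, coeff_eulerOp, mul_smul_comm, smul_mul_assoc, ← mul_assoc,
          sub_eq_iff_eq_add.mp e3, add_mul, smul_add, smul_add, add_comm, ← Algebra.smul_def]
        congr 1
        · rw [smul_mul_assoc, mul_smul_comm, mul_assoc]
        · rw [show a - (r.1 : ℤ) - p.1 = a - (p.1 + r.1 : ℕ) by push_cast; ring, smul_mul_assoc,
            ← Nat.cast_smul_eq_nsmul R, ← Nat.cast_smul_eq_nsmul R, smul_eq_mul]
          simp only [smul_smul]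
          congr 1; ring
      rw [Nat.cast_smul_eq_nsmul, ← smul_mul_assoc, e1, Finset.sum_mul, Finset.sum_congr rfl e2]
      simp only [Finset.sum_add_distrib]
      rw [Finset.smul_sum]
      have s1 : ∑ p ∈ Finset.HasAntidiagonal.antidiagonal b, ∑ r ∈ Finset.HasAntidiagonal.antidiagonal p.2,
          PowerSeries.coeff r.1 f • (zCoeff Y (a - r.1) *
                (PowerSeries.coeff p.1 (eulerOp x) * PowerSeries.coeff r.2 X)) =
          ∑ p ∈ Finset.HasAntidiagonal.antidiagonal b, (p.2 : R) • PowerSeries.coeff p.1 f •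
            (zCoeff Y (a - p.1) * PowerSeries.coeff p.2 X) := by
        rw [sum_antidiagonal_left_comm fun i j l => PowerSeries.coeff j f • (zCoeff Y (a - j) *
                (PowerSeries.coeff i (eulerOp x) * PowerSeries.coeff l X))]
        refine Finset.sum_congr rfl fun p _ => ?_
        have e4 := congrArg (PowerSeries.coeff p.2) hX.euler
        rw [coeff_eulerOp, PowerSeries.coeff_mul] at e4
        rw [← Finset.smul_sum, ← Finset.mul_sum, ← e4, mul_smul_comm, Nat.cast_smul_eq_nsmul]
        exact smul_comm _ _ _
      have s2 : ∑ p ∈ Finset.HasAntidiagonal.antidiagonal b, ∑ r ∈ Finset.HasAntidiagonal.antidiagonal p.2,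
          (PowerSeries.coeff p.1 (eulerOp μ) * PowerSeries.coeff r.1 f) •
                (zCoeff Y (a - (p.1 + r.1 : ℕ)) * PowerSeries.coeff r.2 X) =
          ∑ p ∈ Finset.HasAntidiagonal.antidiagonal b, (p.1 : R) • PowerSeries.coeff p.1 f •
            (zCoeff Y (a - p.1) * PowerSeries.coeff p.2 X) := by
        rw [sum_antidiagonal_assoc fun i j l => (PowerSeries.coeff i (eulerOp μ) *
          PowerSeries.coeff j f) • (zCoeff Y (a - (i + j : ℕ)) * PowerSeries.coeff l X)]
        refine Finset.sum_congr rfl fun p _ => ?_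
        have e4 := congrArg (PowerSeries.coeff p.1) hf.euler
        rw [coeff_eulerOp, PowerSeries.coeff_mul] at e4
        rw [smul_smul, ← nsmul_eq_mul, e4, Finset.sum_smul]
        refine Finset.sum_congr rfl fun r hr => ?_
        rw [Finset.HasAntidiagonal.mem_antidiagonal.mp hr]
      rw [s1, s2, ← Finset.sum_add_distrib]
      refine Finset.sum_congr rfl fun p hp => ?_
      rw [← add_smul, ← Nat.cast_add, add_comm, Finset.HasAntidiagonal.mem_antidiagonal.mp hp]
    exact smul_right_injective A (show (b : R) ≠ 0 by exact_mod_cast hb.ne') key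

/-- Coefficients extended by zero to ℤ allow a sum over all integers, so that later changes of index
are plain translations. -/
theorem contraction {R : Type*} [Field R] [CharZero R] [Algebra R A]
    {x y X Y : PowerSeries A} {μ f : PowerSeries R} (hX : IsExp x X)
    (hY : IsExp y Y) (hf : IsExp μ f)
    (hxy : ∀ k l, k ≠ 0 → l ≠ 0 →
      PowerSeries.coeff k x * PowerSeries.coeff l y - PowerSeries.coeff l y * PowerSeries.coeff k x =
        if l = k then algebraMap R A (PowerSeries.coeff k μ) else 0) (b a : ℤ) :
    zCoeff X b * zCoeff Y a = ∑ᶠ c : ℤ,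
      zCoeff f c • (zCoeff Y (a - c) * zCoeff X (b - c)) := by
  rcases le_or_gt 0 b with hb | hb
  · lift b to ℕ using hb
    rw [zCoeff_natCast, contraction_nat hX hY hf hxy, Finset.Nat.sum_antidiagonal_eq_sum_range_succ
      fun i j => PowerSeries.coeff i f • (zCoeff Y (a - i) * PowerSeries.coeff j X)]
    rw [finsum_eq_sum_of_support_subset (s := (Finset.range (b + 1)).map Nat.castEmbedding)]
    · rw [Finset.sum_map]
      refine Finset.sum_congr rfl fun c hc => ?_
      have hc' : c ≤ b := by simpa [Nat.lt_succ_iff] using hc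
      rw [Nat.castEmbedding_apply, zCoeff_natCast, ← Nat.cast_sub hc', zCoeff_natCast]
    · intro c hc
      have h0 : 0 ≤ c := by
        by_contra h; exact hc (by simp [zCoeff_of_neg f h])
      have h1 : 0 ≤ b - c := by
        by_contra h; exact hc (by simp [zCoeff_of_neg X h])
      lift c to ℕ using h0
      simp only [Finset.coe_map, Set.mem_image, Finset.mem_coe, Finset.mem_range]
      exact ⟨c, by omega, rfl⟩
  · rw [zCoeff_of_neg X (by omega), zero_mul, finsum_eq_zero_of_forall_eq_zero]
    intro c
    rcases le_or_gt 0 c with hc | hc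
    · rw [zCoeff_of_neg X (by omega), mul_zero, smul_zero]
    · rw [zCoeff_of_neg f (by omega), zero_smul]

end Exponentials

/-! ### Exponentials of one half of a Heisenberg family. -/

section HalfExp

variable {R A : Type*} [Field R] [Ring A] [Algebra R A]

theorem map_coeff_expSeries {B : Type*} [Ring B] [Algebra R B] (φ : A →ₐ[R] B)
    (f : PowerSeries A) (n : ℕ) :
    φ (PowerSeries.coeff n (expSeries R f)) =
      PowerSeries.coeff n (expSeries R (PowerSeries.map (φ : A →+* B) f)) := by
  simp only [expSeries, PowerSeries.coeff_mk, map_sum, map_smul, ← map_pow]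
  rfl

theorem map_coeff_halfExp {B : Type*} [Ring B] [Algebra R B] (φ : A →ₐ[R] B)
    (c : ℕ → R) (ε : ℤˣ) (h : NZ → A) (n : ℕ) :
    φ (PowerSeries.coeff n (halfExp c ε h)) =
      PowerSeries.coeff n (halfExp c ε fun l => φ (h l)) := by
  unfold halfExp
  rw [map_coeff_expSeries]
  congr 3
  ext k
  simp only [PowerSeries.coeff_map, PowerSeries.coeff_mk]
  split_ifs <;> simp

theorem halfExp_algebraMap {S : Type*} [Field S] [Algebra R S] [Algebra S A] [IsScalarTower R S A]
    (c : ℕ → R) (ε : ℤˣ) (h : NZ → A) :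
    halfExp (fun k => algebraMap R S (c k)) ε h = halfExp c ε h := by
  simp only [halfExp, expSeries, algebraMap_smul]
  ext n
  simp only [PowerSeries.coeff_mk]
  refine Finset.sum_congr rfl fun N _ => ?_
  rw [← algebraMap_smul S ((N.factorial : R)⁻¹), map_inv₀, map_natCast]

/-- The derivative of f^(N+1)/(N+1)! is f' f^N/N!; the work lies in matching the truncations. -/
theorem isExp_expSeries [CharZero R] {f : PowerSeries A} (h0 : PowerSeries.coeff 0 f = 0)
    (hf : Commute f (eulerOp f)) : IsExp f (expSeries R f) where
  coeff_zero := by simp [expSeries]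
  euler := by
    ext n
    rw [coeff_eulerOp, PowerSeries.coeff_mul]
    have e : ∀ p ∈ Finset.HasAntidiagonal.antidiagonal n,
        PowerSeries.coeff p.1 (eulerOp f) * PowerSeries.coeff p.2 (expSeries R f) =
        ∑ N ∈ Finset.range n, ((N.factorial : R)⁻¹) •
          (PowerSeries.coeff p.1 (eulerOp f) * PowerSeries.coeff p.2 (f ^ N)) := by
      intro p hp
      have hp' := Finset.HasAntidiagonal.mem_antidiagonal.mp hp
      rcases Nat.eq_zero_or_pos p.1 with h | h
      · simp [h]
      simp only [expSeries, PowerSeries.coeff_mk, Finset.mul_sum, mul_smul_comm]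
      -- Raising the cut-off to one common to all `p` adds only coefficients of f^N below degree N,
      -- which vanish.
      refine Finset.sum_subset (fun x hx => ?_) fun N _ hN => ?_
      · simp only [Finset.mem_range] at *; omega
      · rw [coeff_pow_eq_zero h0 N p.2 (by simpa using hN), mul_zero, smul_zero]
    rw [Finset.sum_congr rfl e, Finset.sum_comm]
    simp only [← Finset.smul_sum, ← PowerSeries.coeff_mul]
    simp only [expSeries, PowerSeries.coeff_mk, Finset.smul_sum]
    rw [Finset.sum_range_succ']
    -- The term N = 0 is constant and is killed by the derivation; the other terms shift by one.
    have e0 : n • ((Nat.factorial 0 : R)⁻¹ • PowerSeries.coeff n (f ^ 0)) = 0 := by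
      rcases n with _ | n <;> simp [PowerSeries.coeff_one]
    rw [e0, add_zero]
    refine Finset.sum_congr rfl fun N _ => ?_
    have e1 := congrArg (PowerSeries.coeff n) (eulerOp_pow hf N)
    rw [coeff_eulerOp, map_nsmul] at e1
    rw [smul_comm, e1, ← Nat.cast_smul_eq_nsmul R, smul_smul, Nat.factorial_succ]
    congr 1
    have : ((N + 1 : ℕ) : R) ≠ 0 := by exact_mod_cast Nat.succ_ne_zero N
    have h2 : ((N.factorial : ℕ) : R) ≠ 0 := by exact_mod_cast N.factorial_ne_zero
    push_cast at *
    field_simp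

/-- The exponent in `halfExp`. -/
def halfSum (c : ℕ → R) (ε : ℤˣ) (h : NZ → A) : PowerSeries A :=
  PowerSeries.mk fun k =>
    if hk : k = 0 then 0
    else c k • h ⟨(ε : ℤ) * (k : ℤ), mul_ne_zero (Units.ne_zero ε) (Int.natCast_ne_zero.mpr hk)⟩

theorem coeff_halfSum (c : ℕ → R) (ε : ℤˣ) (h : NZ → A) {k : ℕ} (hk : k ≠ 0) :
    PowerSeries.coeff k (halfSum c ε h) = c k •
      h ⟨(ε : ℤ) * (k : ℤ), mul_ne_zero (Units.ne_zero ε) (Int.natCast_ne_zero.mpr hk)⟩ := by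
  simp [halfSum, hk]

theorem coeff_zero_halfSum (c : ℕ → R) (ε : ℤˣ) (h : NZ → A) :
    PowerSeries.coeff 0 (halfSum c ε h) = 0 := by
  simp [halfSum]

variable {ε : ℤˣ} {h h' : NZ → A}

theorem commute_coeff_halfSum (hc : ∀ k l : NZ, 0 < (ε : ℤ) * k → 0 < (ε : ℤ) * l →
    Commute (h k) (h' l)) (c c' : ℕ → R) (k l : ℕ) :
    Commute (PowerSeries.coeff k (halfSum c ε h)) (PowerSeries.coeff l (halfSum c' ε h')) := by
  rcases eq_or_ne k 0 with rfl | hk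
  · rw [coeff_zero_halfSum]; exact Commute.zero_left _
  rcases eq_or_ne l 0 with rfl | hl
  · rw [coeff_zero_halfSum]; exact Commute.zero_right _
  rw [coeff_halfSum _ _ _ hk, coeff_halfSum _ _ _ hl]
  refine ((hc _ _ ?_ ?_).smul_left _).smul_right _
  all_goals
    simp only [← mul_assoc, ← Units.val_mul, Int.units_mul_self]
    simp; omega

theorem isExp_halfExp [CharZero R] (hc : ∀ k l : NZ, 0 < (ε : ℤ) * k → 0 < (ε : ℤ) * l →
    Commute (h k) (h l)) (c : ℕ → R) : IsExp (halfSum c ε h) (halfExp c ε h) :=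
  isExp_expSeries (coeff_zero_halfSum c ε h) (commute_of_coeff fun k l => by
    rw [coeff_eulerOp]
    exact (commute_coeff_halfSum hc c c k l).smul_right l)

theorem coeff_pow_commute {x : A} {f : PowerSeries A}
    (hx : ∀ k, Commute x (PowerSeries.coeff k f)) (N n : ℕ) :
    Commute x (PowerSeries.coeff n (f ^ N)) := by
  induction N generalizing n with
  | zero =>
    rw [pow_zero, PowerSeries.coeff_one]
    split_ifs
    exacts [Commute.one_right _, Commute.zero_right _]
  | succ N ih =>
    rw [pow_succ, PowerSeries.coeff_mul]
    exact Commute.sum_right _ _ _ fun p _ => (ih p.1).mul_right (hx p.2)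

theorem commute_halfExp {x : A} (hx : ∀ k : NZ, 0 < (ε : ℤ) * k → Commute x (h k)) (c : ℕ → R)
    (n : ℕ) : Commute x (PowerSeries.coeff n (halfExp c ε h)) := by
  unfold halfExp expSeries
  rw [PowerSeries.coeff_mk]
  refine Commute.sum_right _ _ _ fun N _ => Commute.smul_right (coeff_pow_commute (fun k => ?_) _ _) _
  rw [PowerSeries.coeff_mk]
  split_ifs with hk
  · exact Commute.zero_right _
  · refine (hx _ ?_).smul_right _
    simp only [← mul_assoc, ← Units.val_mul, Int.units_mul_self]
    simp; omega

theorem commute_halfExp_halfExp (hc : ∀ k l : NZ, 0 < (ε : ℤ) * k → 0 < (ε : ℤ) * l →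
    Commute (h k) (h' l)) (c c' : ℕ → R) (m n : ℕ) :
    Commute (PowerSeries.coeff m (halfExp c ε h)) (PowerSeries.coeff n (halfExp c' ε h')) :=
  commute_halfExp (fun l hl => (commute_halfExp (fun k hk => (hc k l hk hl).symm) c m).symm) c' n

theorem halfExp_add [CharZero R] (hc : ∀ k l : NZ, 0 < (ε : ℤ) * k → 0 < (ε : ℤ) * l →
    Commute (h k) (h l)) (c c' : ℕ → R) :
    halfExp c ε h * halfExp c' ε h = halfExp (fun k => c k + c' k) ε h := by
  let _ : Module ℚ A := Module.compHom A (algebraMap ℚ R)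
  have e : halfSum c ε h + halfSum c' ε h = halfSum (fun k => c k + c' k) ε h := by
    ext k
    simp only [halfSum, map_add, PowerSeries.coeff_mk]
    split_ifs
    · simp
    · rw [add_smul]
  refine IsExp.unique (x := halfSum (fun k => c k + c' k) ε h) ?_ (isExp_halfExp hc _)
  rw [← e]
  refine (isExp_halfExp hc c).mul (isExp_halfExp hc c') (commute_of_coeff fun k l => ?_)
  rw [coeff_eulerOp]
  refine Commute.smul_right ?_ l
  rcases eq_or_ne l 0 with rfl | hl
  · rw [coeff_zero_halfSum]; exact Commute.zero_right _
  rw [coeff_halfSum _ _ _ hl]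
  refine (commute_halfExp (fun k hk => hc _ k ?_ hk) c k).symm.smul_right _
  simp only [← mul_assoc, ← Units.val_mul, Int.units_mul_self]
  simp; omega

theorem coeff_halfExp_zero (c : ℕ → R) (hc : ∀ k, k ≠ 0 → c k = 0) (h : NZ → A) (n : ℕ) :
    PowerSeries.coeff n (halfExp c ε h) = if n = 0 then 1 else 0 := by
  unfold halfExp
  have : (PowerSeries.mk fun k =>
    if hk : k = 0 then 0
    else c k • h ⟨(ε : ℤ) * (k : ℤ), mul_ne_zero (Units.ne_zero ε)
      (Int.natCast_ne_zero.mpr hk)⟩) = (0 : PowerSeries A) := by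
    ext k
    rw [PowerSeries.coeff_mk]
    split_ifs with hk
    · simp
    · rw [hc k hk, zero_smul]; simp
  rw [this]
  simp only [expSeries, PowerSeries.coeff_mk]
  rw [Finset.sum_eq_single 0]
  · simp [PowerSeries.coeff_one]
  · intro N _ hN
    rw [zero_pow hN]; simp
  · simp

/-- This is the substitution z ↦ uz: the rescaled series solves the Euler equation of the rescaled
exponent, so uniqueness applies. -/
theorem coeff_halfExp_scale [CharZero R] (hc : ∀ k l : NZ, 0 < (ε : ℤ) * k → 0 < (ε : ℤ) * l →
    Commute (h k) (h l)) (c : ℕ → R) (u : R) (n : ℕ) :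
    PowerSeries.coeff n (halfExp (fun k => u ^ k * c k) ε h) =
      u ^ n • PowerSeries.coeff n (halfExp c ε h) := by
  let _ : Module ℚ A := Module.compHom A (algebraMap ℚ R)
  have e : PowerSeries.mk (fun n => u ^ n • PowerSeries.coeff n (halfExp c ε h)) =
      halfExp (fun k => u ^ k * c k) ε h := by
    refine IsExp.unique (x := halfSum (fun k => u ^ k * c k) ε h) ⟨?_, ?_⟩ (isExp_halfExp hc _)
    · rw [PowerSeries.coeff_mk, (isExp_halfExp hc c).coeff_zero]; simp
    · ext n
      have e1 := congrArg (PowerSeries.coeff n) (isExp_halfExp hc c).euler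
      rw [coeff_eulerOp, PowerSeries.coeff_mul] at e1 ⊢
      rw [PowerSeries.coeff_mk, smul_comm, e1, Finset.smul_sum]
      refine Finset.sum_congr rfl fun p hp => ?_
      rw [← Finset.HasAntidiagonal.mem_antidiagonal.mp hp, PowerSeries.coeff_mk, coeff_eulerOp,
        coeff_eulerOp]
      rcases eq_or_ne p.1 0 with h0 | h0
      · simp [h0]
      · rw [coeff_halfSum _ _ _ h0, coeff_halfSum _ _ _ h0, pow_add]
        simp only [smul_mul_assoc, mul_smul_comm, smul_smul, ← Nat.cast_smul_eq_nsmul R]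
        congr 1; ring
  rw [← e, PowerSeries.coeff_mk]

end HalfExp

/-! ### Modes of vertex operators -/

section Modes

/-- A pair of families of operators indexed by `G`, thought of as the coefficients of
`A(z) = ∑ A_g z^g` and `B(z⁻¹) = ∑ B_g z^{-g}`, with `B` locally finite. -/
structure Modes (R W G : Type*) [Field R] [AddCommGroup W] [Module R W] [AddCommGroup G]
    [PartialOrder G] where
  pos : G → Module.End R W
  neg : G → Module.End R W
  pos_eq_zero : ∀ g, ¬ 0 ≤ g → pos g = 0
  neg_eq_zero : ∀ g, ¬ 0 ≤ g → neg g = 0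
  finite_neg : ∀ v, (Function.support fun g => neg g v).Finite

namespace Modes

variable {R W : Type*} [Field R] [AddCommGroup W] [Module R W]

section Basic

variable {G : Type*} [AddCommGroup G] [PartialOrder G] (X : Modes R W G)

/-- The coefficient of `z^m` in `A(z) B(z⁻¹)`. -/
def mode (m : G) : Module.End R W where
  toFun v := ∑ᶠ b, X.pos (m + b) (X.neg b v)
  map_add' v w := by
    simp only [map_add]
    refine finsum_add_distrib ((X.finite_neg v).subset fun b hb h => hb ?_)
      ((X.finite_neg w).subset fun b hb h => hb ?_)
    · simp only at h; simp [h]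
    · simp only at h; simp [h]
  map_smul' c v := by
    simp only [map_smul, RingHom.id_apply, smul_finsum]

theorem mode_apply (m : G) (v : W) : X.mode m v = ∑ᶠ b, X.pos (m + b) (X.neg b v) := rfl

theorem finite_support_mode (m : G) (v : W) :
    (Function.support fun b => X.pos (m + b) (X.neg b v)).Finite :=
  (X.finite_neg v).subset fun b hb h => hb (by
    simp only at h ⊢; rw [h, map_zero])

theorem exists_of_mode_ne_zero {m : G} {v : W} (h : X.mode m v ≠ 0) :
    ∃ b, X.neg b v ≠ 0 ∧ 0 ≤ m + b := by
  obtain ⟨b, hb⟩ : ∃ b, X.pos (m + b) (X.neg b v) ≠ 0 := by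
    by_contra! h0
    exact h (finsum_eq_zero_of_forall_eq_zero h0)
  refine ⟨b, fun h0 => hb (by rw [h0, map_zero]), ?_⟩
  by_contra h1
  exact hb (by rw [X.pos_eq_zero _ h1]; rfl)

/-- The normally ordered product of two families. -/
def comp {H : Type*} [AddCommGroup H] [PartialOrder H] (Y : Modes R W H) : Modes R W (G × H) where
  pos g := X.pos g.1 * Y.pos g.2
  neg g := X.neg g.1 * Y.neg g.2
  pos_eq_zero g hg := by
    rw [Prod.le_def, not_and_or] at hg
    rcases hg with h | h
    · rw [X.pos_eq_zero _ h, zero_mul]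
    · rw [Y.pos_eq_zero _ h, mul_zero]
  neg_eq_zero g hg := by
    rw [Prod.le_def, not_and_or] at hg
    rcases hg with h | h
    · rw [X.neg_eq_zero _ h, zero_mul]
    · rw [Y.neg_eq_zero _ h, mul_zero]
  finite_neg v := by
    refine ((Y.finite_neg v).biUnion fun h _ =>
      (X.finite_neg (Y.neg h v)).image fun g => (g, h)).subset fun g hg => ?_
    simp only [Set.mem_iUnion, Set.mem_image]
    have hg' : X.neg g.1 (Y.neg g.2 v) ≠ 0 := hg
    refine ⟨g.2, fun h0 => ?_, g.1, hg, rfl⟩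
    simp only at h0
    rw [h0, map_zero] at hg'
    exact hg' rfl

end Basic

/-! ### Products of modes through normal ordering. -/

section Composition

variable {G : Type*} [AddCommGroup G] [PartialOrder G] [IsOrderedAddMonoid G]
  [LocallyFiniteOrder G] {X : Modes R W ℤ} {Y : Modes R W G} {δ : G →+ ℤ} {F : G → R}

/-- The index group of `Y` is left general so that `Y` may itself be a normally ordered product; `δ
c` is the total degree that a contraction removes from the annihilation part of `X`. -/
theorem mode_mode (hF : ∀ c, ¬ 0 ≤ c → F c = 0)
    (hXY : ∀ b g, X.neg b * Y.pos g = ∑ᶠ c, F c • (Y.pos (g - c) * X.neg (b - δ c)))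
    (m : ℤ) (g : G) (v : W) :
    X.mode m (Y.mode g v) = ∑ᶠ c, F c • (X.comp Y).mode (m + δ c, g - c) v := by
  have hfin : ∀ b g, (Function.support fun c =>
      F c • (Y.pos (g - c) * X.neg (b - δ c))).Finite := fun b g =>
    (Set.finite_Icc (0 : G) g).subset fun c hc => by
      refine ⟨?_, ?_⟩
      · by_contra h; exact hc (by simp [hF c h])
      · by_contra h; exact hc (by
          simp only
          rw [Y.pos_eq_zero (g - c) (by rwa [sub_nonneg]), zero_mul, smul_zero])
  have hfinv : ∀ b g w, (Function.support fun c =>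
      F c • (Y.pos (g - c) (X.neg (b - δ c) w))).Finite := fun b g w =>
    (hfin b g).subset fun c hc h0 => hc (by
      have := LinearMap.congr_fun h0 w
      simpa using this)
  have hXYv : ∀ b g w, X.neg b (Y.pos g w) =
      ∑ᶠ c, F c • (Y.pos (g - c) (X.neg (b - δ c) w)) := by
    intro b g w
    have := LinearMap.congr_fun (hXY b g) w
    rw [Module.End.mul_apply] at this
    rw [this]
    exact (((LinearMap.applyₗ w : Module.End R W →ₗ[R] W).toAddMonoidHom).map_finsum
      (hfin b g))
  set f : G × ℤ × G → W := fun z => F z.1 • X.pos (m + z.2.1 + δ z.1)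
    (Y.pos (g + z.2.2 - z.1) (X.neg z.2.1 (Y.neg z.2.2 v))) with hf
  -- Local finiteness leaves finitely many annihilation indices; for each, `c` is bounded below by
  -- the support of `F` and above by that of `Y.pos`.
  have hS : (Function.support f).Finite := by
    have hT := (X.comp Y).finite_neg v
    refine (((hT.image Prod.snd).biUnion fun b _ => Set.finite_Icc (0 : G) (g + b)).prod hT).subset
      fun z hz => ?_
    have h1 : (X.comp Y).neg z.2 v ≠ 0 := fun h0 => hz (by
      have : X.neg z.2.1 (Y.neg z.2.2 v) = 0 := h0
      simp only [hf, this, map_zero, smul_zero])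
    refine ⟨?_, h1⟩
    simp only [Set.mem_iUnion]
    refine ⟨z.2.2, ⟨z.2, h1, rfl⟩, ?_, ?_⟩
    · by_contra h; exact hz (by simp [hf, hF _ h])
    · by_contra h; exact hz (by
        simp only [hf]
        rw [Y.pos_eq_zero _ (by rwa [sub_nonneg])]; simp)
  have hR : ∑ᶠ c, F c • (X.comp Y).mode (m + δ c, g - c) v = ∑ᶠ z, f z := by
    rw [finsum_curry _ hS]
    refine finsum_congr fun c => ?_
    rw [mode_apply, smul_finsum]
    refine finsum_congr fun b => ?_
    simp only [hf, comp, Module.End.mul_apply, Prod.fst_add, Prod.snd_add]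
    rw [add_right_comm, sub_add_eq_add_sub]
  rw [hR]
  -- The left side is summed over the annihilation index of `Y`, that of `X` before the contraction,
  -- and `c`; replacing the second by its value after the contraction gives the right side.
  let e : G × ℤ × G ≃ G × ℤ × G :=
    { toFun := fun z => (z.2.2, z.2.1 - δ z.2.2, z.1)
      invFun := fun z => (z.2.2, z.2.1 + δ z.1, z.1)
      left_inv := fun z => by simp
      right_inv := fun z => by simp }
  rw [← finsum_comp_equiv e, finsum_curry _ (hS.preimage e.injective.injOn)]
  rw [mode_apply Y, map_finsum _ (Y.finite_support_mode g v)]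
  refine finsum_congr fun b => ?_
  rw [finsum_curry _ ((hS.preimage e.injective.injOn).preimage
    (f := fun z : ℤ × G => (b, z)) fun z _ z' _ h => (Prod.mk.inj h).2), mode_apply]
  refine finsum_congr fun a => ?_
  rw [hXYv, map_finsum _ (hfinv _ _ _)]
  refine finsum_congr fun c => ?_
  simp only [hf, e, Equiv.coe_fn_mk]
  rw [add_assoc m, sub_add_cancel, map_smul]

end Composition

/-! ### Linear functionals on arbitrary kernels. -/

section Kernels

/-- The sum `∑ K_i L_i` for a finitely supported family of vectors `L`. -/
def kernelSum {ι : Type*} (L : ι → W) (hL : (Function.support L).Finite) : (ι → R) →ₗ[R] W where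
  toFun K := ∑ᶠ i, K i • L i
  map_add' K K' := by
    simp only [Pi.add_apply, add_smul]
    refine finsum_add_distrib (hL.subset fun i hi h => hi ?_) (hL.subset fun i hi h => hi ?_)
    all_goals simp only [h, smul_zero]
  map_smul' c K := by
    simp only [Pi.smul_apply, smul_assoc, RingHom.id_apply, smul_finsum]

variable {X Y Z : Modes R W ℤ}

/-- `B_X(z⁻¹) A_Y(w) = f(w / z) A_Y(w) B_X(z⁻¹)` in coefficients. -/
structure Contracts (X Y : Modes R W ℤ) (f : ℤ → R) : Prop where
  eq_zero : ∀ c, ¬ 0 ≤ c → f c = 0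
  mul_eq : ∀ b a, X.neg b * Y.pos a = ∑ᶠ c, f c • (Y.pos (a - c) * X.neg (b - c))

/-- Creation indices must be nonnegative, so each of the finitely many effective annihilation
indices bounds `c` on both sides. Hence kernels with infinite support, such as delta functions, can
be paired with these modes. -/
theorem finite_slice₂ (v : W) (n : ℤ) :
    (Function.support fun c : ℤ => (X.comp Y).mode (c, n - c) v).Finite := by
  refine (((X.comp Y).finite_neg v).biUnion fun b _ => Set.finite_Icc (-b.1) (n + b.2)).subset
    fun c hc => ?_
  obtain ⟨b, hb, h⟩ := exists_of_mode_ne_zero _ hc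
  simp only [Set.mem_iUnion, Set.mem_Icc]
  have h1 : 0 ≤ c + b.1 := h.1
  have h2 : 0 ≤ n - c + b.2 := h.2
  exact ⟨b, hb, by omega, by omega⟩

theorem finite_slice₃ (v : W) (n : ℤ) :
    (Function.support fun z : ℤ × ℤ =>
      (X.comp (Y.comp Z)).mode (z.1, z.2, n - z.1 - z.2) v).Finite := by
  refine (((X.comp (Y.comp Z)).finite_neg v).biUnion fun b _ =>
    (Set.finite_Icc (-b.1) (n + b.2.1 + b.2.2)).prod
      (Set.finite_Icc (-b.2.1) (n + b.1 + b.2.2))).subset fun c hc => ?_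
  obtain ⟨b, hb, h⟩ := exists_of_mode_ne_zero _ hc
  simp only [Set.mem_iUnion, Set.mem_Icc, Set.mem_prod]
  have h1 : 0 ≤ c.1 + b.1 := h.1
  have h2 : 0 ≤ c.2 + b.2.1 := h.2.1
  have h3 : 0 ≤ n - c.1 - c.2 + b.2.2 := h.2.2
  exact ⟨b, hb, by omega, by omega⟩

/-- The linear functional on kernels attached to the normally ordered product of two modes. -/
def kernel₂ (X Y : Modes R W ℤ) (v : W) (n : ℤ) : (ℤ → R) →ₗ[R] W :=
  kernelSum _ (finite_slice₂ (X := X) (Y := Y) v n)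

/-- The linear functional on kernels attached to the normally ordered product of three modes. -/
def kernel₃ (X Y Z : Modes R W ℤ) (v : W) (n : ℤ) : (ℤ × ℤ → R) →ₗ[R] W :=
  kernelSum _ (finite_slice₃ (X := X) (Y := Y) (Z := Z) v n)

theorem kernel₂_apply (v : W) (n : ℤ) (K : ℤ → R) :
    kernel₂ X Y v n K = ∑ᶠ c, K c • (X.comp Y).mode (c, n - c) v := rfl

theorem kernel₃_apply (v : W) (n : ℤ) (K : ℤ × ℤ → R) :
    kernel₃ X Y Z v n K =
      ∑ᶠ z : ℤ × ℤ, K z • (X.comp (Y.comp Z)).mode (z.1, z.2, n - z.1 - z.2) v := rfl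

variable {f f₁₂ f₁₃ f₂₃ f' p : ℤ → R}

theorem Contracts.mode_mode (h : Contracts X Y f) (m l : ℤ) (v : W) :
    X.mode m (Y.mode l v) = ∑ᶠ c, f c • (X.comp Y).mode (m + c, l - c) v :=
  Modes.mode_mode (δ := AddMonoidHom.id ℤ) h.eq_zero h.mul_eq m l v

/-- With its companion for the other order, this expresses both products through the same normally
ordered modes, which turns commutation relations into identities of functions on ℤ. -/
theorem Contracts.mode_mode_eq_kernel (h : Contracts X Y f) (m l : ℤ) (v : W) :
    X.mode m (Y.mode l v) = kernel₂ X Y v (m + l) fun c => f (c - m) := by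
  rw [h.mode_mode, kernel₂_apply, ← finsum_comp_equiv (Equiv.subRight m)]
  refine finsum_congr fun c => ?_
  rw [Equiv.subRight_apply, add_sub_cancel, sub_sub_eq_add_sub, add_comm l]

theorem mode_comp_comm (hp : ∀ a b, Commute (X.pos a) (Y.pos b))
    (hn : ∀ a b, Commute (X.neg a) (Y.neg b)) (a b : ℤ) :
    (Y.comp X).mode (b, a) = (X.comp Y).mode (a, b) := by
  ext v
  rw [mode_apply, mode_apply, ← finsum_comp_equiv (Equiv.prodComm ℤ ℤ)]
  refine finsum_congr fun c => ?_
  simp only [comp, Equiv.prodComm_apply, Prod.fst_add, Prod.snd_add, Prod.fst_swap, Prod.snd_swap,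
    (hp _ _).eq, (hn _ _).eq]

theorem Contracts.mode_mode_eq_kernel_symm (h : Contracts Y X f)
    (hp : ∀ a b, Commute (X.pos a) (Y.pos b)) (hn : ∀ a b, Commute (X.neg a) (Y.neg b))
    (m l : ℤ) (v : W) :
    Y.mode l (X.mode m v) = kernel₂ X Y v (m + l) fun c => f (m - c) := by
  rw [h.mode_mode, kernel₂_apply, ← finsum_comp_equiv (Equiv.subLeft m)]
  refine finsum_congr fun c => ?_
  rw [Equiv.subLeft_apply, mode_comp_comm hp hn, sub_sub_cancel, ← add_sub_assoc, add_comm l]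

/-- Wick's rule: contractions with the factors of a product multiply, since the scalars pass
through. -/
theorem Contracts.comp (h₁₂ : Contracts X Y f₁₂) (h₁₃ : Contracts X Z f₁₃) (b : ℤ) (g : ℤ × ℤ) :
    X.neg b * (Y.comp Z).pos g = ∑ᶠ c : ℤ × ℤ, (f₁₂ c.1 * f₁₃ c.2) •
      ((Y.comp Z).pos (g - c) * X.neg (b - (c.1 + c.2))) := by
  have hfin : (Function.support fun c : ℤ × ℤ => (f₁₂ c.1 * f₁₃ c.2) •
      ((Y.comp Z).pos (g - c) * X.neg (b - (c.1 + c.2)))).Finite :=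
    (Set.finite_Icc (0 : ℤ × ℤ) g).subset fun c hc => by
      refine ⟨?_, ?_⟩
      · by_contra h
        rw [Prod.le_def, not_and_or] at h
        refine hc ?_
        rcases h with h | h
        · simp only; rw [h₁₂.eq_zero _ h, zero_mul, zero_smul]
        · simp only; rw [h₁₃.eq_zero _ h, mul_zero, zero_smul]
      · by_contra h; exact hc (by
          simp only
          rw [(Y.comp Z).pos_eq_zero (g - c) (by rwa [sub_nonneg]), zero_mul, smul_zero])
  have hfin₁ : ∀ b a, (Function.support fun c =>
      f₁₂ c • (Y.pos (a - c) * X.neg (b - c))).Finite := fun b a =>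
    (Set.finite_Icc 0 a).subset fun c hc => by
      refine ⟨?_, ?_⟩
      · by_contra h; exact hc (by simp only; rw [h₁₂.eq_zero _ h, zero_smul])
      · by_contra h; exact hc (by simp only; rw [Y.pos_eq_zero (a - c) (by rwa [sub_nonneg]),
          zero_mul, smul_zero])
  have hfin₂ : ∀ b a, (Function.support fun c =>
      f₁₃ c • (Z.pos (a - c) * X.neg (b - c))).Finite := fun b a =>
    (Set.finite_Icc 0 a).subset fun c hc => by
      refine ⟨?_, ?_⟩
      · by_contra h; exact hc (by simp only; rw [h₁₃.eq_zero _ h, zero_smul])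
      · by_contra h; exact hc (by simp only; rw [Z.pos_eq_zero (a - c) (by rwa [sub_nonneg]),
          zero_mul, smul_zero])
  rw [finsum_curry _ hfin]
  change X.neg b * (Y.pos g.1 * Z.pos g.2) = _
  rw [← mul_assoc, h₁₂.mul_eq, finsum_mul' _ _ (hfin₁ _ _)]
  refine finsum_congr fun c => ?_
  rw [smul_mul_assoc, mul_assoc, h₁₃.mul_eq, mul_finsum' _ _ (hfin₂ _ _), smul_finsum]
  refine finsum_congr fun d => ?_
  simp only [Modes.comp, Prod.fst_sub, Prod.snd_sub, mul_smul_comm, smul_smul, mul_assoc, sub_sub]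

/-- `Y` is contracted with `Z` first, then `X` with their normally ordered product. Finiteness is
part of the conclusion because the triple sum is regrouped later. -/
theorem mode_mode_mode (h₁₂ : Contracts X Y f₁₂) (h₁₃ : Contracts X Z f₁₃)
    (h₂₃ : Contracts Y Z f₂₃) (m₁ m₂ m₃ : ℤ) (v : W) :
    (Function.support fun z : ℤ × ℤ × ℤ => (f₂₃ z.1 * (f₁₂ z.2.1 * f₁₃ z.2.2)) •
      (X.comp (Y.comp Z)).mode (m₁ + (z.2.1 + z.2.2), m₂ + z.1 - z.2.1, m₃ - z.1 - z.2.2) v).Finite ∧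
    X.mode m₁ (Y.mode m₂ (Z.mode m₃ v)) = ∑ᶠ z : ℤ × ℤ × ℤ, (f₂₃ z.1 * (f₁₂ z.2.1 * f₁₃ z.2.2)) •
      (X.comp (Y.comp Z)).mode (m₁ + (z.2.1 + z.2.2), m₂ + z.1 - z.2.1, m₃ - z.1 - z.2.2) v := by
  have hfin : (Function.support fun z : ℤ × ℤ × ℤ => (f₂₃ z.1 * (f₁₂ z.2.1 * f₁₃ z.2.2)) •
      (X.comp (Y.comp Z)).mode (m₁ + (z.2.1 + z.2.2), m₂ + z.1 - z.2.1,
        m₃ - z.1 - z.2.2) v).Finite := by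
    refine (((X.comp (Y.comp Z)).finite_neg v).biUnion fun b _ =>
      (Set.finite_Icc 0 (m₃ + b.2.2)).prod ((Set.finite_Icc 0 (m₂ + m₃ + b.2.2 + b.2.1)).prod
        (Set.finite_Icc 0 (m₃ + b.2.2)))).subset fun c hc => ?_
    obtain ⟨b, hb, h⟩ := exists_of_mode_ne_zero _ (right_ne_zero_of_smul hc)
    simp only [Set.mem_iUnion, Set.mem_Icc, Set.mem_prod]
    have h2 : 0 ≤ m₂ + c.1 - c.2.1 + b.2.1 := h.2.1
    have h3 : 0 ≤ m₃ - c.1 - c.2.2 + b.2.2 := h.2.2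
    have hl := left_ne_zero_of_smul hc
    have k1 : 0 ≤ c.1 := by by_contra h; exact hl (by rw [h₂₃.eq_zero _ h, zero_mul])
    have k2 : 0 ≤ c.2.1 := by by_contra h; exact hl (by rw [h₁₂.eq_zero _ h, zero_mul, mul_zero])
    have k3 : 0 ≤ c.2.2 := by by_contra h; exact hl (by rw [h₁₃.eq_zero _ h, mul_zero, mul_zero])
    exact ⟨b, hb, by omega, by omega, by omega⟩
  refine ⟨hfin, ?_⟩
  rw [finsum_curry _ hfin, h₂₃.mode_mode, map_finsum]
  · refine finsum_congr fun c => ?_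
    have hF : ∀ c : ℤ × ℤ, ¬ 0 ≤ c → f₁₂ c.1 * f₁₃ c.2 = 0 := by
      intro c h
      rw [Prod.le_def, not_and_or] at h
      rcases h with h | h
      · rw [h₁₂.eq_zero _ h, zero_mul]
      · rw [h₁₃.eq_zero _ h, mul_zero]
    rw [map_smul, Modes.mode_mode (Y := Y.comp Z)
      (δ := (AddMonoidHom.fst ℤ ℤ + AddMonoidHom.snd ℤ ℤ)) hF (h₁₂.comp h₁₃), smul_finsum]
    refine finsum_congr fun d => ?_
    rw [smul_smul]
    rfl
  · refine ((finite_slice₂ (X := Y) (Y := Z) v (m₂ + m₃)).preimage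
      (f := fun c => m₂ + c) fun _ _ _ _ => by simp).subset fun c hc => ?_
    have := right_ne_zero_of_smul hc
    simpa [add_sub_add_left_eq_sub] using this

/-! ### Cubic products and the Serre relation. -/

section Serre

/-- Once the exponents of the normally ordered triple are fixed, the only free variable is the
contraction degree of the two equal fields. Their contraction `p` lives in degrees 0, 1, 2, so three
terms remain. -/
theorem kernel₃_eq_of_equiv (hp0 : ∀ c, ¬ 0 ≤ c → p c = 0) (hp3 : ∀ c, 3 ≤ c → p c = 0)
    {h : ℤ × ℤ × ℤ → W} (hh : (Function.support h).Finite) (e : (ℤ × ℤ) × ℤ ≃ ℤ × ℤ × ℤ)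
    (K : ℤ → ℤ × ℤ → R) (v : W) (n : ℤ)
    (he : ∀ z k, h (e (z, k)) =
      (p k * K k z) • (X.comp (Y.comp Z)).mode (z.1, z.2, n - z.1 - z.2) v) :
    ∑ᶠ z, h z = kernel₃ X Y Z v n fun z => p 0 * K 0 z + p 1 * K 1 z + p 2 * K 2 z := by
  rw [← finsum_comp_equiv e, finsum_curry _ (hh.preimage e.injective.injOn), kernel₃_apply]
  refine finsum_congr fun z => ?_
  simp only [he]
  rw [finsum_eq_sum_of_support_subset (s := {0, 1, 2})]
  · simp [add_smul, add_assoc]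
  · intro k hk
    have h0 : 0 ≤ k := by by_contra h; exact hk (by simp only; rw [hp0 k h, zero_mul, zero_smul])
    have h1 : ¬ 3 ≤ k := fun h => hk (by simp only; rw [hp3 k h, zero_mul, zero_smul])
    simp only [Finset.coe_insert, Finset.coe_singleton, Set.mem_insert_iff, Set.mem_singleton_iff]
    omega

/-- Creation parts commute with each other, and so do annihilation parts, so a normally ordered
product does not depend on the order of its factors. -/
theorem mode_comp_comp_swap (hp : ∀ a b, Commute (X.pos a) (X.pos b))
    (hn : ∀ a b, Commute (X.neg a) (X.neg b)) (a b c : ℤ) :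
    (X.comp (X.comp Y)).mode (b, a, c) = (X.comp (X.comp Y)).mode (a, b, c) := by
  ext v
  let e : ℤ × ℤ × ℤ ≃ ℤ × ℤ × ℤ :=
    { toFun := fun z => (z.2.1, z.1, z.2.2)
      invFun := fun z => (z.2.1, z.1, z.2.2)
      left_inv := fun z => rfl
      right_inv := fun z => rfl }
  rw [mode_apply, mode_apply, ← finsum_comp_equiv e]
  refine finsum_congr fun z => ?_
  simp only [comp, e, Equiv.coe_fn_mk, Prod.fst_add, Prod.snd_add]
  rw [← mul_assoc, (hp _ _).eq, mul_assoc, ← mul_assoc (X.neg _), (hn _ _).eq, mul_assoc]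

theorem mode_comp_comp_mid (hp : ∀ a b, Commute (X.pos a) (Y.pos b))
    (hn : ∀ a b, Commute (X.neg a) (Y.neg b)) (a b c : ℤ) :
    (X.comp (Y.comp X)).mode (a, c, b) = (X.comp (X.comp Y)).mode (a, b, c) := by
  ext v
  let e : ℤ × ℤ × ℤ ≃ ℤ × ℤ × ℤ :=
    { toFun := fun z => (z.1, z.2.2, z.2.1)
      invFun := fun z => (z.1, z.2.2, z.2.1)
      left_inv := fun z => rfl
      right_inv := fun z => rfl }
  rw [mode_apply, mode_apply, ← finsum_comp_equiv e]
  refine finsum_congr fun z => ?_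
  simp only [comp, e, Equiv.coe_fn_mk, Prod.fst_add, Prod.snd_add]
  rw [(hp _ _).eq, (hn _ _).eq]

theorem mode_comp_comp_left (hp : ∀ a b, Commute (X.pos a) (Y.pos b))
    (hn : ∀ a b, Commute (X.neg a) (Y.neg b)) (a b c : ℤ) :
    (Y.comp (X.comp X)).mode (c, a, b) = (X.comp (X.comp Y)).mode (a, b, c) := by
  ext v
  let e : ℤ × ℤ × ℤ ≃ ℤ × ℤ × ℤ :=
    { toFun := fun z => (z.2.2, z.1, z.2.1)
      invFun := fun z => (z.2.1, z.2.2, z.1)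
      left_inv := fun z => rfl
      right_inv := fun z => rfl }
  rw [mode_apply, mode_apply, ← finsum_comp_equiv e]
  refine finsum_congr fun z => ?_
  simp only [comp, e, Equiv.coe_fn_mk, Prod.fst_add, Prod.snd_add]
  rw [((hp _ _).mul_left (hp _ _)).symm.eq, ((hn _ _).mul_left (hn _ _)).symm.eq, mul_assoc,
    mul_assoc]

/-- The equivalence solves for the three contraction degrees in terms of the final exponents `z` and
the degree `k` of the X–X contraction. -/
theorem mode_XXY (hXX : Contracts X X p) (hXY : Contracts X Y f)
    (hp3 : ∀ c, 3 ≤ c → p c = 0) (m₁ m₂ m₃ : ℤ) {n : ℤ} (hm : m₁ + m₂ + m₃ = n) (v : W) :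
    X.mode m₁ (X.mode m₂ (Y.mode m₃ v)) = kernel₃ X X Y v n fun z =>
      p 0 * (f (z.2 - m₂) * f (z.1 - m₁)) + p 1 * (f (z.2 - m₂ + 1) * f (z.1 - m₁ - 1)) +
        p 2 * (f (z.2 - m₂ + 2) * f (z.1 - m₁ - 2)) := by
  obtain ⟨hfin, h⟩ := mode_mode_mode hXX hXY hXY m₁ m₂ m₃ v
  rw [h, kernel₃_eq_of_equiv (X := X) (Y := X) (Z := Y) hXX.eq_zero hp3 hfin
    { toFun := fun z => (z.1.2 - m₂ + z.2, z.2, z.1.1 - m₁ - z.2)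
      invFun := fun z => ((m₁ + z.2.1 + z.2.2, m₂ + z.1 - z.2.1), z.2.1)
      left_inv := fun z => by ext <;> dsimp only <;> ring
      right_inv := fun z => by ext <;> dsimp only <;> ring }
    (fun k z => f (z.2 - m₂ + k) * f (z.1 - m₁ - k)) v n]
  · simp only [add_zero, sub_zero]
  · intro z k
    simp only [Equiv.coe_fn_mk]
    congr 1
    · ring
    · congr 3 <;> (try congr 1) <;> linarith

theorem mode_XYX (hXX : Contracts X X p) (hXY : Contracts X Y f) (hYX : Contracts Y X f')
    (hp : ∀ a b, Commute (X.pos a) (Y.pos b)) (hn : ∀ a b, Commute (X.neg a) (Y.neg b))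
    (hp3 : ∀ c, 3 ≤ c → p c = 0) (m₁ m₂ m₃ : ℤ) {n : ℤ} (hm : m₁ + m₂ + m₃ = n) (v : W) :
    X.mode m₁ (Y.mode m₃ (X.mode m₂ v)) = kernel₃ X X Y v n fun z =>
      p 0 * (f (z.1 - m₁) * f' (m₂ - z.2)) + p 1 * (f (z.1 - m₁ - 1) * f' (m₂ - z.2 - 1)) +
        p 2 * (f (z.1 - m₁ - 2) * f' (m₂ - z.2 - 2)) := by
  obtain ⟨hfin, h⟩ := mode_mode_mode hXY hXX hYX m₁ m₃ m₂ v
  rw [h, kernel₃_eq_of_equiv (X := X) (Y := X) (Z := Y) hXX.eq_zero hp3 hfin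
    { toFun := fun z => (m₂ - z.1.2 - z.2, z.1.1 - m₁ - z.2, z.2)
      invFun := fun z => ((m₁ + z.2.1 + z.2.2, m₂ - z.1 - z.2.2), z.2.2)
      left_inv := fun z => by ext <;> dsimp only <;> ring
      right_inv := fun z => by ext <;> dsimp only <;> ring }
    (fun k z => f (z.1 - m₁ - k) * f' (m₂ - z.2 - k)) v n]
  · simp only [sub_zero]
  · intro z k
    simp only [Equiv.coe_fn_mk]
    rw [mode_comp_comp_mid hp hn]
    congr 1
    · ring
    · congr 3 <;> (try congr 1) <;> linarith

theorem mode_YXX (hXX : Contracts X X p) (hYX : Contracts Y X f')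
    (hp : ∀ a b, Commute (X.pos a) (Y.pos b)) (hn : ∀ a b, Commute (X.neg a) (Y.neg b))
    (hp3 : ∀ c, 3 ≤ c → p c = 0) (m₁ m₂ m₃ : ℤ) {n : ℤ} (hm : m₁ + m₂ + m₃ = n) (v : W) :
    Y.mode m₃ (X.mode m₁ (X.mode m₂ v)) = kernel₃ X X Y v n fun z =>
      p 0 * (f' (m₁ - z.1) * f' (m₂ - z.2)) + p 1 * (f' (m₁ - z.1 + 1) * f' (m₂ - z.2 - 1)) +
        p 2 * (f' (m₁ - z.1 + 2) * f' (m₂ - z.2 - 2)) := by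
  obtain ⟨hfin, h⟩ := mode_mode_mode hYX hYX hXX m₃ m₁ m₂ v
  rw [h, kernel₃_eq_of_equiv (X := X) (Y := X) (Z := Y) hXX.eq_zero hp3 hfin
    { toFun := fun z => (z.2, m₁ - z.1.1 + z.2, m₂ - z.1.2 - z.2)
      invFun := fun z => ((m₁ + z.1 - z.2.1, m₂ - z.1 - z.2.2), z.1)
      left_inv := fun z => by ext <;> dsimp only <;> ring
      right_inv := fun z => by ext <;> dsimp only <;> ring }
    (fun k z => f' (m₁ - z.1 + k) * f' (m₂ - z.2 - k)) v n]
  · simp only [sub_zero, add_zero]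
  · intro z k
    simp only [Equiv.coe_fn_mk]
    rw [mode_comp_comp_left hp hn]
    congr 1
    congr 3 <;> (try congr 1) <;> linarith

/-- Because the two X factors are interchangeable, a kernel matters only up to transposition, so it
suffices that the symmetrized Serre kernel vanishes. -/
theorem kernel₃_swap (hp : ∀ a b, Commute (X.pos a) (X.pos b))
    (hn : ∀ a b, Commute (X.neg a) (X.neg b)) (v : W) (n : ℤ) (K : ℤ × ℤ → R) :
    kernel₃ X X Y v n (fun z => K z.swap) = kernel₃ X X Y v n K := by
  rw [kernel₃_apply, kernel₃_apply, ← finsum_comp_equiv (Equiv.prodComm ℤ ℤ)]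
  refine finsum_congr fun z => ?_
  simp only [Equiv.prodComm_apply, Prod.swap_swap, Prod.fst_swap, Prod.snd_swap]
  rw [mode_comp_comp_swap hp hn, sub_right_comm]

/-- The Serre relation for the modes of two families of vertex operators. -/
theorem mode_serre {p f f' : ℤ → R} {Q τ τ' : R} (hQ : Q ≠ 0) (hτ : τ * τ' = 1)
    (hXX : Contracts X X p) (hXY : Contracts X Y f) (hYX : Contracts Y X f')
    (hp₁ : ∀ a b, Commute (X.pos a) (X.pos b)) (hn₁ : ∀ a b, Commute (X.neg a) (X.neg b))
    (hp : ∀ a b, Commute (X.pos a) (Y.pos b)) (hn : ∀ a b, Commute (X.neg a) (Y.neg b))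
    (h0 : p 0 = 1) (h1 : p 1 = -(1 + Q⁻¹ ^ 2)) (h2 : p 2 = Q⁻¹ ^ 2) (h3 : ∀ c, 3 ≤ c → p c = 0)
    (hf : ∀ x, f x = Q⁻¹ * τ ^ 2 * f (x - 1) + if x = 0 then 1 else 0)
    (hf' : ∀ x, f' (-x) = Q⁻¹ * τ' ^ 2 * f' (-x - 1) + if x = 0 then 1 else 0)
    (m₁ m₂ m₃ : ℤ) (v : W) (S : ℤ → ℤ → W) (hS : ∀ m₁ m₂, S m₁ m₂ =
      τ' ^ 2 • Y.mode (m₃ + 2) (X.mode (m₁ - 2) (X.mode m₂ v))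
      + (Q + Q⁻¹) • X.mode (m₁ - 1) (Y.mode (m₃ + 1) (X.mode m₂ v))
      + τ ^ 2 • X.mode (m₁ - 1) (X.mode (m₂ + 1) (Y.mode m₃ v))) :
    S m₁ m₂ + S m₂ m₁ = 0 := by
  have key : ∀ m₁ m₂ n, m₁ + m₂ + m₃ = n → S m₁ m₂ = _ := fun m₁ m₂ n hm => by
    rw [hS, mode_YXX hXX hYX hp hn h3 (m₁ - 2) m₂ (m₃ + 2) (n := n) (by linarith) v,
      mode_XYX hXX hXY hYX hp hn h3 (m₁ - 1) m₂ (m₃ + 1) (n := n) (by linarith) v,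
      mode_XXY hXX hXY h3 (m₁ - 1) (m₂ + 1) m₃ (n := n) (by linarith) v, ← map_smul, ← map_smul,
      ← map_smul, ← map_add, ← map_add]
  -- One kernel is transposed so that in both of them the first exponent is measured from `m₂` and
  -- the second from `m₁`.
  rw [key m₁ m₂ (m₁ + m₂ + m₃) rfl, key m₂ m₁ (m₁ + m₂ + m₃) (by ring),
    ← kernel₃_swap hp₁ hn₁ v (m₁ + m₂ + m₃), ← map_add]
  refine (congrArg _ ?_).trans (map_zero (kernel₃ X X Y v (m₁ + m₂ + m₃)))
  ext ⟨x, y⟩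
  obtain ⟨A, rfl⟩ : ∃ A, x = m₂ + A := ⟨x - m₂, by ring⟩
  obtain ⟨B, rfl⟩ : ∃ B, y = m₁ + B := ⟨y - m₁, by ring⟩
  simp only [Pi.add_apply, Pi.smul_apply, smul_eq_mul, Prod.swap_prod_mk, Pi.zero_apply, h0, h1, h2]
  have a1 : ∀ m A : ℤ, m - 2 - (m + A) = -(A + 2) := fun m A => by ring
  have a2 : ∀ m A : ℤ, m - (m + A) = -A := fun m A => by ring
  have a3 : ∀ A : ℤ, -(A + 2) + 1 = -(A + 1) := fun A => by ring
  have a4 : ∀ A : ℤ, -(A + 2) + 2 = -A := fun A => by ring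
  have a5 : ∀ A : ℤ, -A - 1 = -(A + 1) := fun A => by ring
  have a6 : ∀ A : ℤ, -A - 2 = -(A + 2) := fun A => by ring
  have a7 : ∀ m A : ℤ, m + A - (m - 1) = A + 1 := fun m A => by ring
  have a8 : ∀ m A : ℤ, m + A - (m + 1) = A - 1 := fun m A => by ring
  have a9 : ∀ A : ℤ, A + 1 - 2 = A - 1 := fun A => by ring
  have a10 : ∀ A : ℤ, A - 1 + 2 = A + 1 := fun A => by ring
  have f1 : ∀ A, f (A + 1) = Q⁻¹ * τ ^ 2 * f A + if A + 1 = 0 then 1 else 0 := fun A => by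
    rw [hf, add_sub_cancel_right]
  have f2 : ∀ A, f' (-(A + 1)) = Q⁻¹ * τ' ^ 2 * f' (-(A + 2)) + if A + 1 = 0 then 1 else 0 :=
    fun A => by rw [hf', a5, add_assoc]; rfl
  have f3 : ∀ A, f' (-A) = Q⁻¹ * τ' ^ 2 * f' (-(A + 1)) + if A = 0 then 1 else 0 :=
    fun A => by rw [hf' A, a5]
  simp only [a1, a2, a3, a4, a5, a6, a7, a8, a9, a10, add_sub_cancel_right, sub_add_cancel]
  -- The recursions reduce all values to `f (A - 1)`, `f (B - 1)`, `f' (-(A + 2))`, `f' (-(B + 2))`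
  -- and four delta terms. The kernel vanishes identically in these eight quantities, taken as
  -- independent.
  rw [f1 A, f1 B, hf A, hf B, f3 A, f3 B, f2 A, f2 B]
  generalize f (A - 1) = a, f (B - 1) = b, f' (-(A + 2)) = a', f' (-(B + 2)) = b',
    (if A = 0 then (1 : R) else 0) = d, (if B = 0 then (1 : R) else 0) = e,
    (if A + 1 = 0 then (1 : R) else 0) = d', (if B + 1 = 0 then (1 : R) else 0) = e'
  have hτ0 : τ ≠ 0 := left_ne_zero_of_mul_eq_one hτ
  obtain rfl : τ' = τ⁻¹ := eq_inv_of_mul_eq_one_right hτ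
  field_simp
  ring

end Serre

end Kernels

end Modes

end Modes

/-! ### The weight decomposition of the twisted group algebra -/

section Lattice

variable {n : ℕ} {𝕜 : Type*} [Field 𝕜]

theorem neg_one_zpow_eq_or (a : ℤ) : (-1 : 𝕜) ^ a = 1 ∨ (-1 : 𝕜) ^ a = -1 := by
  rcases Int.even_or_odd a with h | h
  · exact Or.inl h.neg_one_zpow
  · exact Or.inr h.neg_one_zpow

theorem neg_one_zpow_mul_self (a : ℤ) : (-1 : 𝕜) ^ a * (-1 : 𝕜) ^ a = 1 := by
  rcases neg_one_zpow_eq_or (𝕜 := 𝕜) a with h | h <;> simp [h]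

theorem expRoot_inv_mul (i : Fin (n + 1)) (ε : ℤˣ) :
    expRoot n 𝕜 i (-ε) * expRoot n 𝕜 i ε = 1 := by
  have h := expRoot_mul n 𝕜 i (-ε)
  rwa [neg_neg] at h

/-- Conjugation by `u'` inverts the scalar, and `c` is its own inverse; hence the inverse of a
generator obeys the same sign rule. -/
theorem mul_eq_smul_mul_of_inv {A : Type*} [Ring A] [Algebra 𝕜 A] {c : 𝕜} (hc : c * c = 1)
    {u u' v : A} (h : u * v = c • (v * u)) (h1 : u * u' = 1) (h2 : u' * u = 1) :
    u' * v = c • (v * u') := by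
  have e : c • (u' * (u * v) * u') = c • (u' * (c • (v * u)) * u') := by rw [h]
  rw [mul_smul_comm, smul_mul_assoc, smul_smul, hc, one_smul, ← mul_assoc u', h2, one_mul,
    mul_assoc u', mul_assoc v, h1, mul_one] at e
  exact e.symm

theorem expRoot_comm (i j : Fin (n + 1)) (ε η : ℤˣ) :
    expRoot n 𝕜 i ε * expRoot n 𝕜 j η =
      (-1 : 𝕜) ^ cartan n i j • (expRoot n 𝕜 j η * expRoot n 𝕜 i ε) := by
  have hc := neg_one_zpow_mul_self (𝕜 := 𝕜) (cartan n i j)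
  have h11 : expRoot n 𝕜 i 1 * expRoot n 𝕜 j 1 =
      (-1 : 𝕜) ^ cartan n i j • (expRoot n 𝕜 j 1 * expRoot n 𝕜 i 1) := by
    unfold expRoot
    rw [← map_mul, RingQuot.mkAlgHom_rel 𝕜 (TwistRel.comm i j), map_smul, map_mul]
  have h1 : ∀ ε, expRoot n 𝕜 i ε * expRoot n 𝕜 j 1 =
      (-1 : 𝕜) ^ cartan n i j • (expRoot n 𝕜 j 1 * expRoot n 𝕜 i ε) := by
    intro ε
    rcases Int.units_eq_one_or ε with rfl | rfl
    · exact h11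
    · exact mul_eq_smul_mul_of_inv hc h11 (expRoot_mul n 𝕜 i 1) (expRoot_inv_mul i 1)
  rcases Int.units_eq_one_or η with rfl | rfl
  · exact h1 ε
  · have h2 : expRoot n 𝕜 j 1 * expRoot n 𝕜 i ε =
        (-1 : 𝕜) ^ cartan n i j • (expRoot n 𝕜 i ε * expRoot n 𝕜 j 1) := by
      rw [h1 ε, smul_smul, hc, one_smul]
    rw [mul_eq_smul_mul_of_inv hc h2 (expRoot_mul n 𝕜 j 1) (expRoot_inv_mul j 1), smul_smul, hc,
      one_smul]

/-- The coaction that records the weights. -/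
def coaction (n : ℕ) (𝕜 : Type*) [Field 𝕜] :
    TwistAlg n 𝕜 →ₐ[𝕜] AddMonoidAlgebra (TwistAlg n 𝕜) (Fin (n + 1) → ℤ) :=
  RingQuot.liftAlgHom 𝕜 ⟨FreeAlgebra.lift 𝕜 fun x =>
    AddMonoidAlgebra.single (Pi.single x.1 (x.2 : ℤ)) (expRoot n 𝕜 x.1 x.2), by
      intro x y h
      induction h with
      | inv i ε =>
        simp only [map_mul, FreeAlgebra.lift_ι_apply, AddMonoidAlgebra.single_mul_single, map_one,
          expRoot_mul, ← Pi.single_add]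
        simp [AddMonoidAlgebra.one_def]
      | comm i j =>
        simp only [map_mul, map_smul, FreeAlgebra.lift_ι_apply,
          AddMonoidAlgebra.single_mul_single, AddMonoidAlgebra.smul_single, ← expRoot_comm]
        rw [add_comm (Pi.single i _)]⟩

theorem coaction_expRoot (i : Fin (n + 1)) (ε : ℤˣ) :
    coaction n 𝕜 (expRoot n 𝕜 i ε) =
      AddMonoidAlgebra.single (Pi.single i (ε : ℤ)) (expRoot n 𝕜 i ε) := by
  refine (RingQuot.liftAlgHom_mkAlgHom_apply 𝕜 _ _ _).trans ?_
  rw [FreeAlgebra.lift_ι_apply]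

/-- `x` is homogeneous of weight `β`. -/
def HasWeight (x : TwistAlg n 𝕜) (β : Fin (n + 1) → ℤ) : Prop :=
  coaction n 𝕜 x = AddMonoidAlgebra.single β x

theorem HasWeight.mul {x y : TwistAlg n 𝕜} {β γ : Fin (n + 1) → ℤ} (hx : HasWeight x β)
    (hy : HasWeight y γ) : HasWeight (x * y) (β + γ) := by
  unfold HasWeight at *
  rw [map_mul, hx, hy, AddMonoidAlgebra.single_mul_single]

theorem hasWeight_one : HasWeight (1 : TwistAlg n 𝕜) 0 := by
  unfold HasWeight
  rw [map_one, AddMonoidAlgebra.one_def]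

theorem hasWeight_expRoot (i : Fin (n + 1)) (ε : ℤˣ) :
    HasWeight (expRoot n 𝕜 i ε) (Pi.single i (ε : ℤ)) := coaction_expRoot i ε

theorem HasWeight.expRoot_mul {x : TwistAlg n 𝕜} {β : Fin (n + 1) → ℤ} (hx : HasWeight x β)
    (i : Fin (n + 1)) (ε : ℤˣ) :
    HasWeight (expRoot n 𝕜 i ε * x) (β + Pi.single i (ε : ℤ)) := by
  rw [add_comm β]; exact (hasWeight_expRoot i ε).mul hx

theorem hasWeight_zpow (i : Fin (n + 1)) (k : ℤ) :
    HasWeight ((expRootUnit n 𝕜 i ^ k : (TwistAlg n 𝕜)ˣ) : TwistAlg n 𝕜) (Pi.single i k) := by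
  have hp : ∀ (ε : ℤˣ) (m : ℕ), HasWeight (expRoot n 𝕜 i ε ^ m) (Pi.single i ((ε : ℤ) * m)) := by
    intro ε m
    induction m with
    | zero => simpa using hasWeight_one
    | succ m ih =>
      rw [pow_succ]
      convert ih.mul (hasWeight_expRoot i ε) using 1
      rw [← Pi.single_add]; push_cast; ring_nf
  obtain ⟨m, rfl | rfl⟩ := Int.eq_nat_or_neg k
  · rw [zpow_natCast, Units.val_pow_eq_pow_val]
    simpa [expRootUnit] using hp 1 m
  · rw [zpow_neg, zpow_natCast, ← inv_pow, Units.val_pow_eq_pow_val]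
    simpa [expRootUnit] using hp (-1) m

theorem hasWeight_prod_ofFn {m : ℕ} (f : Fin m → (TwistAlg n 𝕜)ˣ) (w : Fin m → Fin (n + 1) → ℤ)
    (h : ∀ i, HasWeight (f i : TwistAlg n 𝕜) (w i)) :
    HasWeight (((List.ofFn f).prod : (TwistAlg n 𝕜)ˣ) : TwistAlg n 𝕜) (∑ i, w i) := by
  induction m with
  | zero => simpa using hasWeight_one
  | succ m ih =>
    rw [List.ofFn_succ, List.prod_cons, Units.val_mul, Fin.sum_univ_succ]
    exact (h 0).mul (ih _ _ fun i => h i.succ)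

theorem hasWeight_expLattice (β : Fin (n + 1) → ℤ) : HasWeight (expLattice n 𝕜 β) β := by
  have := hasWeight_prod_ofFn (fun i => expRootUnit n 𝕜 i ^ β i) (fun i => Pi.single i (β i))
    fun i => hasWeight_zpow i (β i)
  rwa [Finset.univ_sum_single] at this

theorem zpow_mul_prod_ofFn {Q : Type*} [Group Q] {m : ℕ} (v : Fin m → Q)
    (hv : ∀ i j, Commute (v i) (v j)) (β : Fin m → ℤ) (k : Fin m) (e : ℤ) :
    v k ^ e * (List.ofFn fun i => v i ^ β i).prod =
      (List.ofFn fun i => v i ^ (β + Pi.single k e : Fin m → ℤ) i).prod := by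
  induction m with
  | zero => exact k.elim0
  | succ m ih =>
    rw [List.ofFn_succ, List.ofFn_succ, List.prod_cons, List.prod_cons]
    refine Fin.cases ?_ (fun k => ?_) k
    · rw [← mul_assoc, ← zpow_add, add_comm e]
      simp
    · rw [← mul_assoc, (((hv _ _).zpow_left _).zpow_right _).eq, mul_assoc,
        ih (fun i => v i.succ) (fun i j => hv _ _) (fun i => β i.succ) k]
      congr 1
      · simp [(Fin.succ_ne_zero k).symm]
      · congr 2
        funext i
        simp only [Pi.add_apply]
        congr 2
        by_cases h : i = k
        · subst h; simp
        · rw [Pi.single_eq_of_ne h, Pi.single_eq_of_ne (by simpa using h)]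

/-- Units that commute up to signs can be moved into an ordered product up to a scalar. -/
theorem exists_zpow_mul_prod_ofFn {A : Type*} [Ring A] [Algebra 𝕜 A] {m : ℕ} (u : Fin m → Aˣ)
    (a : Fin m → Fin m → ℤ)
    (hu : ∀ i j, (u i : A) * u j = (-1 : 𝕜) ^ a i j • ((u j : A) * u i))
    (k : Fin m) (e : ℤ) (β : Fin m → ℤ) :
    ∃ c : 𝕜, ((u k ^ e * (List.ofFn fun i => u i ^ β i).prod : Aˣ) : A) =
      c • (((List.ofFn fun i => u i ^ (β + Pi.single k e : Fin m → ℤ) i).prod : Aˣ) : A) := by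
  -- Modulo the central subgroup {±1} the units commute, so reordering is exact in the quotient;
  -- lifting the identity costs an element of `N`, which is a scalar.
  let N : Subgroup Aˣ := (Units.map (Int.castRingHom A : ℤ →* A)).range
  have hcent : ∀ x ∈ N, ∀ y, y * x = x * y := by
    rintro x ⟨η, rfl⟩ y
    ext
    exact ((Int.cast_commute (η : ℤ) (y : A)).symm).eq
  have hN : N.Normal := ⟨fun x hx y => by rw [hcent x hx, mul_inv_cancel_right]; exact hx⟩
  have hscal : ∀ x ∈ N, ∃ c : 𝕜, (x : A) = c • 1 := by
    rintro x ⟨η, rfl⟩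
    refine ⟨((η : ℤ) : 𝕜), ?_⟩
    rw [← Algebra.algebraMap_eq_smul_one, map_intCast]
    rfl
  have hneg : (-1 : Aˣ) ∈ N := ⟨-1, by ext; simp⟩
  have hcomm : ∀ i j, Commute (QuotientGroup.mk (s := N) (u i)) (QuotientGroup.mk (s := N) (u j)) := by
    intro i j
    change QuotientGroup.mk (s := N) (_ * _) = QuotientGroup.mk (s := N) (_ * _)
    rw [QuotientGroup.eq]
    have h := hu i j
    rcases neg_one_zpow_eq_or (𝕜 := 𝕜) (a i j) with h0 | h0
    · have : u i * u j = u j * u i := by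
        ext; rwa [h0, one_smul] at h
      rw [this, inv_mul_cancel]; exact N.one_mem
    · have : u i * u j = -(u j * u i) := by
        ext; rwa [h0, neg_one_smul] at h
      have h2 : (u i * u j)⁻¹ * (u j * u i) = -1 := by
        rw [inv_mul_eq_iff_eq_mul, this, mul_neg_one, neg_neg]
      rw [h2]; exact hneg
  have key := zpow_mul_prod_ofFn (fun i => QuotientGroup.mk (s := N) (u i)) hcomm β k e
  have hmk : ∀ γ : Fin m → ℤ, (List.ofFn fun i => QuotientGroup.mk (s := N) (u i) ^ γ i).prod =
      QuotientGroup.mk' N (List.ofFn fun i => u i ^ γ i).prod := by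
    intro γ
    rw [map_list_prod, List.map_ofFn]
    rfl
  rw [hmk, hmk] at key
  change QuotientGroup.mk (s := N) (_ ^ e * _) = QuotientGroup.mk (s := N) _ at key
  rw [eq_comm, QuotientGroup.eq] at key
  obtain ⟨c, hc⟩ := hscal _ key
  refine ⟨c, ?_⟩
  have h : ∀ P S : Aˣ, ((P⁻¹ * S : Aˣ) : A) = c • 1 → (S : A) = c • (P : A) := fun P S h => by
    rw [← mul_one (P : A), ← mul_smul_comm, ← h, ← Units.val_mul, mul_inv_cancel_left]
  exact h _ _ hc

/-- `e^{α_k}` moves into the ordered product up to a scalar. -/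
theorem expRoot_mul_expLattice (k : Fin (n + 1)) (ε : ℤˣ) (β : Fin (n + 1) → ℤ) :
    ∃ c : 𝕜, expRoot n 𝕜 k ε * expLattice n 𝕜 β =
      c • expLattice n 𝕜 (β + Pi.single k (ε : ℤ)) := by
  obtain ⟨c, hc⟩ := exists_zpow_mul_prod_ofFn (expRootUnit n 𝕜) (cartan n)
    (fun i j => expRoot_comm (𝕜 := 𝕜) i j 1 1) k ε β
  refine ⟨c, ?_⟩
  have hε : expRoot n 𝕜 k ε =
      ((expRootUnit n 𝕜 k ^ (ε : ℤ) : (TwistAlg n 𝕜)ˣ) : TwistAlg n 𝕜) := by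
    rcases Int.units_eq_one_or ε with rfl | rfl
    · simp [expRootUnit]
    · simp [expRootUnit]
  rw [hε]
  exact hc

/-- The span contains 1 and is stable under left multiplication by generators. Linear independence
is not needed, since weights are read off from the coaction. -/
theorem span_expLattice : Submodule.span 𝕜 (Set.range (expLattice n 𝕜)) = ⊤ := by
  set S := Submodule.span 𝕜 (Set.range (expLattice n 𝕜)) with hS
  have h1 : ∀ i ε, ∀ x ∈ S, expRoot n 𝕜 i ε * x ∈ S := by
    intro i ε x hx
    induction hx using Submodule.span_induction with
    | mem x hx =>
      obtain ⟨β, rfl⟩ := hx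
      obtain ⟨c, hc⟩ := expRoot_mul_expLattice (𝕜 := 𝕜) i ε β
      rw [hc]
      exact S.smul_mem _ (Submodule.subset_span ⟨_, rfl⟩)
    | zero => rw [mul_zero]; exact S.zero_mem
    | add x y _ _ hx hy => rw [mul_add]; exact S.add_mem hx hy
    | smul c x _ hx => rw [mul_smul_comm]; exact S.smul_mem _ hx
  have h2 : ∀ a : FreeAlgebra 𝕜 (Fin (n + 1) × ℤˣ), ∀ x ∈ S,
      RingQuot.mkAlgHom 𝕜 (TwistRel n 𝕜) a * x ∈ S := by
    intro a
    induction a using FreeAlgebra.induction with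
    | grade0 r =>
      intro x hx
      rw [AlgHom.commutes, ← Algebra.smul_def]; exact S.smul_mem _ hx
    | grade1 z => exact fun x hx => h1 z.1 z.2 x hx
    | mul a b ha hb => intro x hx; rw [map_mul, mul_assoc]; exact ha _ (hb _ hx)
    | add a b ha hb => intro x hx; rw [map_add, add_mul]; exact S.add_mem (ha _ hx) (hb _ hx)
  have h3 : (1 : TwistAlg n 𝕜) ∈ S := Submodule.subset_span ⟨0, by
    unfold expLattice
    rw [Units.val_eq_one]
    refine List.prod_eq_one fun x hx => ?_
    obtain ⟨i, rfl⟩ := (List.mem_ofFn' _ _).mp hx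
    simp⟩
  refine eq_top_iff.mpr fun x _ => ?_
  obtain ⟨a, rfl⟩ := RingQuot.mkAlgHom_surjective 𝕜 (TwistRel n 𝕜) x
  simpa using h2 a 1 h3

end Lattice

/-! ### Operators that depend on the weight. -/

section Diagonal

variable {n : ℕ} {𝕜 : Type*} [Field 𝕜] {W : Type*} [AddCommGroup W] [Module 𝕜 W]

/-- The operator on `W ⊗ 𝕜{Q}` that acts on the left factor by `f_β` in weight `β`. -/
def weightwise (f : (Fin (n + 1) → ℤ) → Module.End 𝕜 W) : Module.End 𝕜 (W ⊗[𝕜] TwistAlg n 𝕜) :=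
  TensorProduct.lift (((Finsupp.lsum 𝕜 fun β =>
    ((TensorProduct.mk 𝕜 W (TwistAlg n 𝕜)).comp (f β)).flip).comp
      ((AddMonoidAlgebra.coeffLinearEquiv 𝕜).toLinearMap.comp
        (coaction n 𝕜).toLinearMap)).flip)

/-- The coaction sends a homogeneous element to a single term, so only one summand of the sum over
weights survives. -/
theorem weightwise_tmul (f : (Fin (n + 1) → ℤ) → Module.End 𝕜 W) (v : W) {x : TwistAlg n 𝕜}
    {β : Fin (n + 1) → ℤ} (hx : HasWeight x β) :
    weightwise f (v ⊗ₜ[𝕜] x) = f β v ⊗ₜ[𝕜] x := by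
  unfold weightwise
  simp only [TensorProduct.lift.tmul, LinearMap.flip_apply, LinearMap.comp_apply,
    AlgHom.toLinearMap_apply]
  rw [hx]
  simp

theorem ext_expLattice {P : Type*} [AddCommGroup P] [Module 𝕜 P]
    {f g : W ⊗[𝕜] TwistAlg n 𝕜 →ₗ[𝕜] P}
    (h : ∀ v β, f (v ⊗ₜ[𝕜] expLattice n 𝕜 β) = g (v ⊗ₜ[𝕜] expLattice n 𝕜 β)) : f = g := by
  refine TensorProduct.ext (LinearMap.ext fun v => ?_)
  exact LinearMap.ext_on_range span_expLattice fun β => h v β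

end Diagonal

/-! ### Quantum integers -/

section Scalars

theorem q_ne_zero : q ≠ 0 := RatFunc.X_ne_zero

/-- That q is not a root of unity is seen from degrees in ℚ[X]; it makes the quantum integers [k]
with k ≠ 0 invertible. -/
theorem q_pow_ne_one {m : ℕ} (hm : m ≠ 0) : q ^ m ≠ 1 := by
  intro h
  have h1 : algebraMap (Polynomial ℚ) Qq (Polynomial.X ^ m) = algebraMap (Polynomial ℚ) Qq 1 := by
    rw [map_pow, RatFunc.algebraMap_X, map_one]; exact h
  have h2 := congrArg Polynomial.natDegree (RatFunc.algebraMap_injective ℚ h1)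
  rw [Polynomial.natDegree_X_pow, Polynomial.natDegree_one] at h2
  exact hm h2

theorem q_zpow_ne_one {m : ℤ} (hm : m ≠ 0) : q ^ m ≠ 1 := by
  obtain ⟨k, rfl | rfl⟩ := Int.eq_nat_or_neg m
  · rw [zpow_natCast]; exact q_pow_ne_one (by omega)
  · rw [zpow_neg, zpow_natCast, ne_eq, inv_eq_one]; exact q_pow_ne_one (by omega)

theorem q_zpow_sub_ne_zero {k : ℤ} (hk : k ≠ 0) : q ^ k - q ^ (-k) ≠ 0 := by
  intro h
  refine q_zpow_ne_one (m := k + k) (by omega) ?_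
  rw [zpow_add₀ q_ne_zero]
  nth_rewrite 2 [sub_eq_zero.mp h]
  rw [← zpow_add₀ q_ne_zero, add_neg_cancel, zpow_zero]

theorem q_sub_inv_ne_zero : q - q⁻¹ ≠ 0 := by
  simpa using q_zpow_sub_ne_zero one_ne_zero

theorem qInt_ne_zero {k : ℤ} (hk : k ≠ 0) : qInt k ≠ 0 :=
  div_ne_zero (q_zpow_sub_ne_zero hk) q_sub_inv_ne_zero

theorem qInt_neg (k : ℤ) : qInt (-k) = -qInt k := by
  unfold qInt; rw [neg_neg, ← neg_sub, neg_div]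

theorem qInt_zero : qInt 0 = 0 := by simp [qInt]

theorem qInt_one : qInt 1 = 1 := by
  unfold qInt
  rw [zpow_one, zpow_neg_one, div_self q_sub_inv_ne_zero]

theorem qInt_mul_two (k : ℤ) : qInt (k * 2) = qInt k * (q ^ k + q ^ (-k)) := by
  unfold qInt
  rw [div_mul_eq_mul_div, mul_two, neg_add, zpow_add₀ q_ne_zero, zpow_add₀ q_ne_zero]
  ring

end Scalars

/-! ### The Fock space -/

theorem smul_smul_of_eq {R W : Type*} [Field R] [AddCommGroup W] [Module R W] {a b c : R}
    (h : a * b = c) (w : W) : a • b • w = c • w := by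
  rw [smul_smul, h]

theorem mem_of_smul_mem {R W : Type*} [Field R] [AddCommGroup W] [Module R W] {a : R} (ha : a ≠ 0)
    {p : Submodule R W} {w : W} (h : a • w ∈ p) : w ∈ p :=
  (p.smul_mem_iff ha).mp h

section Fock

variable {n : ℕ} {M : Matrix (Fin (n + 1)) (Fin (n + 1)) ℤ} {κ : Qq}
  {𝕜 : Type*} [Field 𝕜] [Algebra Qq 𝕜]

theorem charZero_of_algebra (𝕜 : Type*) [Field 𝕜] [Algebra Qq 𝕜] : CharZero 𝕜 :=
  charZero_of_injective_algebraMap (algebraMap Qq 𝕜).injective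

theorem heisH_commutator (i j : Fin (n + 1)) (k l : NZ) :
    heisH n M κ 𝕜 i k * heisH n M κ 𝕜 j l - heisH n M κ 𝕜 j l * heisH n M κ 𝕜 i k =
      if k.1 + l.1 = 0 then
        algebraMap 𝕜 _ (algebraMap Qq 𝕜 (structConst n M κ i j k.1 * qInt k.1)) else 0 := by
  unfold heisH
  rw [← map_mul, ← map_mul, ← map_sub, RingQuot.mkAlgHom_rel 𝕜 (HeisRel.hh i j k l)]
  split_ifs
  · exact AlgHom.commutes _ _
  · exact map_zero _

theorem commute_heisH (i j : Fin (n + 1)) {k l : NZ} (h : k.1 + l.1 ≠ 0) :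
    Commute (heisH n M κ 𝕜 i k) (heisH n M κ 𝕜 j l) := by
  have := heisH_commutator (M := M) (κ := κ) (𝕜 := 𝕜) i j k l
  rw [if_neg h] at this
  exact sub_eq_zero.mp this

theorem commute_heisH_of_sign (i j : Fin (n + 1)) {ε : ℤˣ} (k l : NZ) (hk : 0 < (ε : ℤ) * k)
    (hl : 0 < (ε : ℤ) * l) : Commute (heisH n M κ 𝕜 i k) (heisH n M κ 𝕜 j l) := by
  refine commute_heisH i j ?_
  intro h
  have : (ε : ℤ) * (k.1 + l.1) = 0 := by rw [h, mul_zero]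
  rw [mul_add] at this
  omega

theorem heisH_induction {P : Heis n M κ 𝕜 → Prop}
    (hc : ∀ c : 𝕜, P (algebraMap 𝕜 _ c)) (hH : ∀ i l, P (heisH n M κ 𝕜 i l))
    (hm : ∀ a b, P a → P b → P (a * b)) (ha : ∀ a b, P a → P b → P (a + b)) (x) : P x := by
  obtain ⟨a, rfl⟩ := RingQuot.mkAlgHom_surjective 𝕜 (HeisRel n M κ 𝕜) x
  induction a using FreeAlgebra.induction with
  | grade0 r => rw [AlgHom.commutes]; exact hc r
  | grade1 z => exact hH z.1 z.2
  | mul a b ha hb => rw [map_mul]; exact hm _ _ ha hb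
  | add a b h1 h2 => rw [map_add]; exact ha _ _ h1 h2

theorem heisH_smul_vac (i : Fin (n + 1)) {l : NZ} (hl : 0 < l.1) :
    heisH n M κ 𝕜 i l • vac n M κ 𝕜 = 0 := by
  unfold vac
  rw [← Submodule.Quotient.mk_smul, Submodule.Quotient.mk_eq_zero, smul_eq_mul, mul_one]
  exact Submodule.subset_span ⟨i, l, hl, rfl⟩

/-- The index of the creation operator of degree `k`. -/
def negIdx (k : ℕ+) : NZ := ⟨-(k : ℤ), neg_ne_zero.mpr (Int.natCast_ne_zero.mpr k.ne_zero)⟩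

theorem monomialVec_nil : monomialVec n M κ 𝕜 [] = vac n M κ 𝕜 := by
  simp [monomialVec]

theorem monomialVec_cons (x : Fin (n + 1) × ℕ+) (L : List (Fin (n + 1) × ℕ+)) :
    monomialVec n M κ 𝕜 (x :: L) =
      heisH n M κ 𝕜 x.1 (negIdx x.2) • monomialVec n M κ 𝕜 L := by
  unfold monomialVec
  rw [List.map_cons, List.prod_cons, mul_smul]
  rfl

/-- The degree of a monomial. -/
def monDeg (L : List (Fin (n + 1) × ℕ+)) : ℤ := (L.map fun x => (x.2 : ℤ)).sum

theorem monDeg_nonneg (L : List (Fin (n + 1) × ℕ+)) : 0 ≤ monDeg L :=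
  List.sum_nonneg fun x hx => by
    obtain ⟨y, _, rfl⟩ := List.mem_map.mp hx; positivity

theorem monDeg_cons (x : Fin (n + 1) × ℕ+) (L : List (Fin (n + 1) × ℕ+)) :
    monDeg (x :: L) = x.2 + monDeg L := by simp [monDeg]

/-- The filtration of the Fock space by degree. -/
def fockFil (n : ℕ) (M : Matrix (Fin (n + 1)) (Fin (n + 1)) ℤ) (κ : Qq)
    (𝕜 : Type*) [Field 𝕜] [Algebra Qq 𝕜] (d : ℤ) : Submodule 𝕜 (Fock n M κ 𝕜) :=
  Submodule.span 𝕜 {v | ∃ L, monDeg L ≤ d ∧ v = monomialVec n M κ 𝕜 L}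

theorem fockFil_mono {d e : ℤ} (h : d ≤ e) : fockFil n M κ 𝕜 d ≤ fockFil n M κ 𝕜 e :=
  Submodule.span_mono fun _ ⟨L, hL, hv⟩ => ⟨L, hL.trans h, hv⟩

theorem eq_zero_of_mem_fockFil {d : ℤ} (hd : d < 0) {v : Fock n M κ 𝕜}
    (hv : v ∈ fockFil n M κ 𝕜 d) : v = 0 := by
  have : {v | ∃ L, monDeg L ≤ d ∧ v = monomialVec n M κ 𝕜 L} = ∅ := by
    ext v
    simp only [Set.mem_ofPred_eq, Set.mem_empty_iff_false, iff_false, not_exists, not_and]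
    intro L hL
    have := monDeg_nonneg L
    omega
  rw [fockFil, this, Submodule.span_empty] at hv
  exact hv

/-- For `l < 0` the operator lengthens the monomial. For `l > 0` it is moved right until it kills
the vacuum, and a commutator can only delete a factor of degree `l`. A filtration rather than a
grading avoids asking whether monomials are independent. -/
theorem heisH_smul_monomialVec_mem (i : Fin (n + 1)) (l : NZ) (L : List (Fin (n + 1) × ℕ+)) :
    heisH n M κ 𝕜 i l • monomialVec n M κ 𝕜 L ∈ fockFil n M κ 𝕜 (monDeg L - l.1) := by
  rcases lt_or_gt_of_ne l.2 with hl | hl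
  · refine Submodule.subset_span ⟨(i, ⟨(-l.1).toNat, by omega⟩) :: L, ?_, ?_⟩
    · rw [monDeg_cons]; simp; omega
    · rw [monomialVec_cons]
      congr 2
      ext
      simp [negIdx]; omega
  induction L with
  | nil =>
    rw [monomialVec_nil, heisH_smul_vac i hl]; exact Submodule.zero_mem _
  | cons x L ih =>
    have hc := sub_eq_iff_eq_add.mp
      (heisH_commutator (M := M) (κ := κ) (𝕜 := 𝕜) i x.1 l (negIdx x.2))
    rw [monomialVec_cons, ← mul_smul, hc, add_smul, mul_smul]
    refine Submodule.add_mem _ ?_ ?_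
    · split_ifs with h
      · rw [algebraMap_smul]
        refine Submodule.smul_mem _ _ (Submodule.subset_span ⟨L, ?_, rfl⟩)
        rw [monDeg_cons]
        have : (negIdx x.2).1 = -(x.2 : ℤ) := rfl
        omega
      · rw [zero_smul]; exact Submodule.zero_mem _
    · rw [monDeg_cons]
      generalize heisH n M κ 𝕜 i l • monomialVec n M κ 𝕜 L = w at ih
      induction ih using Submodule.span_induction with
      | mem y hy =>
        obtain ⟨L', hL', rfl⟩ := hy
        refine Submodule.subset_span ⟨x :: L', ?_, (monomialVec_cons _ _).symm⟩
        rw [monDeg_cons]; omega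
      | zero => rw [smul_zero]; exact Submodule.zero_mem _
      | add y z _ _ hy hz => rw [smul_add]; exact Submodule.add_mem _ hy hz
      | smul c y _ hy => rw [smul_comm]; exact Submodule.smul_mem _ _ hy

theorem heisH_smul_mem {i : Fin (n + 1)} {l : NZ} {d : ℤ} {v : Fock n M κ 𝕜}
    (hv : v ∈ fockFil n M κ 𝕜 d) : heisH n M κ 𝕜 i l • v ∈ fockFil n M κ 𝕜 (d - l.1) := by
  induction hv using Submodule.span_induction with
  | mem y hy =>
    obtain ⟨L, hL, rfl⟩ := hy
    exact fockFil_mono (by omega) (heisH_smul_monomialVec_mem i l L)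
  | zero => rw [smul_zero]; exact Submodule.zero_mem _
  | add y z _ _ hy hz => rw [smul_add]; exact Submodule.add_mem _ hy hz
  | smul c y _ hy => rw [smul_comm]; exact Submodule.smul_mem _ _ hy

theorem exists_mem_fockFil (v : Fock n M κ 𝕜) : ∃ d, v ∈ fockFil n M κ 𝕜 d := by
  have h : ∀ x : Heis n M κ 𝕜, ∀ d, ∀ w ∈ fockFil n M κ 𝕜 d, ∃ e, x • w ∈ fockFil n M κ 𝕜 e := by
    intro x
    induction x using heisH_induction with
    | hc c => intro d w hw; exact ⟨d, by rw [algebraMap_smul]; exact Submodule.smul_mem _ _ hw⟩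
    | hH i l => intro d w hw; exact ⟨_, heisH_smul_mem hw⟩
    | hm a b ha hb =>
      intro d w hw
      obtain ⟨e, he⟩ := hb d w hw
      obtain ⟨e', he'⟩ := ha e _ he
      exact ⟨e', by rwa [mul_smul]⟩
    | ha a b ha hb =>
      intro d w hw
      obtain ⟨e, he⟩ := ha d w hw
      obtain ⟨e', he'⟩ := hb d w hw
      refine ⟨max e e', ?_⟩
      rw [add_smul]
      exact Submodule.add_mem _ (fockFil_mono (le_max_left _ _) he)
        (fockFil_mono (le_max_right _ _) he')
  obtain ⟨x, rfl⟩ := Submodule.Quotient.mk_surjective _ v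
  obtain ⟨e, he⟩ := h x 0 (vac n M κ 𝕜) (Submodule.subset_span ⟨[], le_rfl, monomialVec_nil.symm⟩)
  refine ⟨e, ?_⟩
  unfold vac at he
  rwa [← Submodule.Quotient.mk_smul, smul_eq_mul, mul_one] at he

theorem span_monomialVec : Submodule.span 𝕜 (Set.range (monomialVec n M κ 𝕜)) = ⊤ := by
  refine eq_top_iff.mpr fun v _ => ?_
  obtain ⟨d, hd⟩ := exists_mem_fockFil v
  exact Submodule.span_mono (by rintro _ ⟨L, _, hv⟩; exact ⟨L, hv.symm⟩) hd

/-- By the Euler equation b times the b-th coefficient is a combination of `H_{i,k}` applied to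
earlier coefficients, and `H_{i,k}` lowers the degree by k. Since the filtration is zero in negative
degrees, the annihilation exponentials are locally finite. -/
theorem halfExp_smul_mem (c : ℕ → 𝕜) (i : Fin (n + 1)) (b : ℕ) {d : ℤ} {v : Fock n M κ 𝕜}
    (hv : v ∈ fockFil n M κ 𝕜 d) :
    PowerSeries.coeff b (halfExp c 1 (heisH n M κ 𝕜 i)) • v ∈ fockFil n M κ 𝕜 (d - b) := by
  have := charZero_of_algebra 𝕜
  have hE := isExp_halfExp (R := 𝕜) (ε := 1) (h := heisH n M κ 𝕜 i)
    (fun k l => commute_heisH_of_sign i i k l) c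
  induction b using Nat.strong_induction_on with
  | _ b ih =>
    rcases Nat.eq_zero_or_pos b with rfl | hb
    · rw [hE.coeff_zero, one_smul]; simpa using hv
    have e1 := congrArg (PowerSeries.coeff b) hE.euler
    rw [coeff_eulerOp, PowerSeries.coeff_mul] at e1
    have e2 : (b : 𝕜) • (PowerSeries.coeff b (halfExp c 1 (heisH n M κ 𝕜 i)) • v) ∈
        fockFil n M κ 𝕜 (d - b) := by
      rw [← smul_assoc, Nat.cast_smul_eq_nsmul, e1, Finset.sum_smul]
      refine Submodule.sum_mem _ fun p hp => ?_
      have hp' := Finset.HasAntidiagonal.mem_antidiagonal.mp hp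
      rcases Nat.eq_zero_or_pos p.1 with h0 | h0
      · rw [coeff_eulerOp, h0, zero_smul, zero_mul, zero_smul]; exact Submodule.zero_mem _
      rw [coeff_eulerOp, coeff_halfSum _ _ _ h0.ne', mul_smul, smul_assoc, smul_assoc]
      refine nsmul_mem (Submodule.smul_mem _ _ ?_) _
      refine fockFil_mono ?_ (heisH_smul_mem (ih p.2 (by omega)))
      simp; omega
    exact mem_of_smul_mem (R := 𝕜) (W := Fock n M κ 𝕜) (Nat.cast_ne_zero.mpr hb.ne') e2

theorem finite_support_halfExp (c : ℕ → 𝕜) (i : Fin (n + 1)) (v : Fock n M κ 𝕜) :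
    (Function.support fun b : ℤ =>
      zCoeff (halfExp c 1 (heisH n M κ 𝕜 i)) b • v).Finite := by
  obtain ⟨d, hd⟩ := exists_mem_fockFil v
  refine (Set.finite_Icc 0 d).subset fun b hb => ⟨?_, ?_⟩
  · by_contra h; exact hb (by simp only; rw [zCoeff_of_neg _ h, zero_smul])
  · by_contra h
    rcases le_or_gt 0 b with h0 | h0
    · lift b to ℕ using h0
      refine hb ?_
      simp only [zCoeff_natCast]
      exact eq_zero_of_mem_fockFil (by omega) (halfExp_smul_mem c i b hd)
    · exact hb (by simp only; rw [zCoeff_of_neg _ (by omega), zero_smul])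

/-! ### The degree operator -/

/-- The automorphism `H_{i,l} ↦ u^l H_{i,l}`. -/
def degMap (n : ℕ) (M : Matrix (Fin (n + 1)) (Fin (n + 1)) ℤ) (κ : Qq)
    {𝕜 : Type*} [Field 𝕜] [Algebra Qq 𝕜] {u : 𝕜} (hu : u ≠ 0) :
    Heis n M κ 𝕜 →ₐ[𝕜] Heis n M κ 𝕜 :=
  RingQuot.liftAlgHom 𝕜 ⟨FreeAlgebra.lift 𝕜 fun x => u ^ x.2.1 • heisH n M κ 𝕜 x.1 x.2, by
    intro x y h
    induction h with
    | hh i j k l =>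
      rw [map_sub, map_mul, map_mul, FreeAlgebra.lift_ι_apply, FreeAlgebra.lift_ι_apply]
      have e : u ^ k.1 • heisH n M κ 𝕜 i k * u ^ l.1 • heisH n M κ 𝕜 j l -
          u ^ l.1 • heisH n M κ 𝕜 j l * u ^ k.1 • heisH n M κ 𝕜 i k =
          u ^ (k.1 + l.1) • (heisH n M κ 𝕜 i k * heisH n M κ 𝕜 j l -
            heisH n M κ 𝕜 j l * heisH n M κ 𝕜 i k) := by
        rw [smul_mul_smul_comm, smul_mul_smul_comm, smul_sub, zpow_add₀ hu, mul_comm (u ^ l.1)]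
      refine e.trans ?_
      rw [heisH_commutator]
      -- The central term occurs only for k + l = 0, where the factor u^(k+l) is 1.
      split_ifs with h
      · rw [h, zpow_zero, one_smul]; exact (AlgHom.commutes _ _).symm
      · rw [smul_zero, map_zero]⟩

theorem degMap_heisH {u : 𝕜} (hu : u ≠ 0) (i : Fin (n + 1)) (l : NZ) :
    degMap n M κ hu (heisH n M κ 𝕜 i l) = u ^ l.1 • heisH n M κ 𝕜 i l := by
  refine (RingQuot.liftAlgHom_mkAlgHom_apply 𝕜 _ _ _).trans ?_
  rw [FreeAlgebra.lift_ι_apply]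

/-- The degree operator as a semilinear map. -/
def degOpSemilinear (n : ℕ) (M : Matrix (Fin (n + 1)) (Fin (n + 1)) ℤ) (κ : Qq)
    {𝕜 : Type*} [Field 𝕜] [Algebra Qq 𝕜] {u : 𝕜} (hu : u ≠ 0) :
    Fock n M κ 𝕜 →ₛₗ[(degMap n M κ hu : Heis n M κ 𝕜 →+* Heis n M κ 𝕜)] Fock n M κ 𝕜 :=
  Submodule.liftQ (annihilators n M κ 𝕜)
    { toFun := fun x => Submodule.Quotient.mk (degMap n M κ hu x)
      map_add' := fun x y => by rw [map_add]; rfl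
      map_smul' := fun x y => by rw [smul_eq_mul, map_mul]; rfl } (by
    -- The automorphism only rescales the generators of the left ideal, so it descends to the
    -- quotient.
    unfold annihilators
    rw [Submodule.span_le]
    rintro _ ⟨i, l, hl, rfl⟩
    change (Submodule.Quotient.mk _ : Fock n M κ 𝕜) = 0
    rw [degMap_heisH]
    exact (Submodule.Quotient.mk_eq_zero _).mpr
      (Submodule.smul_of_tower_mem _ _ (Submodule.subset_span ⟨i, l, hl, rfl⟩)))

/-- The operator on the Fock space that acts by `u^{-d}` in degree `d`. -/
def degOp (n : ℕ) (M : Matrix (Fin (n + 1)) (Fin (n + 1)) ℤ) (κ : Qq)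
    {𝕜 : Type*} [Field 𝕜] [Algebra Qq 𝕜] {u : 𝕜} (hu : u ≠ 0) :
    Module.End 𝕜 (Fock n M κ 𝕜) where
  toFun := degOpSemilinear n M κ hu
  map_add' := map_add _
  map_smul' c v := by
    rw [← algebraMap_smul (Heis n M κ 𝕜) c v, LinearMap.map_smulₛₗ]
    change degMap n M κ hu _ • _ = _
    rw [AlgHom.commutes, algebraMap_smul]
    rfl

theorem degOp_smul {u : 𝕜} (hu : u ≠ 0) (x : Heis n M κ 𝕜) (v : Fock n M κ 𝕜) :
    degOp n M κ hu (x • v) = degMap n M κ hu x • degOp n M κ hu v :=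
  LinearMap.map_smulₛₗ (degOpSemilinear n M κ hu) x v

theorem degOp_vac {u : 𝕜} (hu : u ≠ 0) : degOp n M κ hu (vac n M κ 𝕜) = vac n M κ 𝕜 := by
  change Submodule.Quotient.mk (degMap n M κ hu 1) = _
  rw [map_one]; rfl

theorem degOp_monomialVec {u : 𝕜} (hu : u ≠ 0) (L : List (Fin (n + 1) × ℕ+)) :
    degOp n M κ hu (monomialVec n M κ 𝕜 L) = u ^ (-monDeg L) • monomialVec n M κ 𝕜 L := by
  induction L with
  | nil =>
    rw [monomialVec_nil, degOp_vac]
    simp only [monDeg, List.map_nil, List.sum_nil, neg_zero, zpow_zero]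
    exact (one_smul 𝕜 (vac n M κ 𝕜)).symm
  | cons x L ih =>
    rw [monomialVec_cons, degOp_smul, ih, degMap_heisH, smul_assoc, smul_comm _ (u ^ _)]
    refine smul_smul_of_eq (R := 𝕜) (W := Fock n M κ 𝕜) ?_ _
    rw [← zpow_add₀ hu, monDeg_cons, neg_add]
    rfl

theorem ext_monomialVec {P : Type*} [AddCommGroup P] [Module 𝕜 P] {f g : Fock n M κ 𝕜 →ₗ[𝕜] P}
    (h : ∀ L, f (monomialVec n M κ 𝕜 L) = g (monomialVec n M κ 𝕜 L)) : f = g :=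
  LinearMap.ext_on_range span_monomialVec h

theorem degOp_degOp {u u' : 𝕜} (hu : u ≠ 0) (hu' : u' ≠ 0) (h : u * u' = 1)
    (v : Fock n M κ 𝕜) : degOp n M κ hu (degOp n M κ hu' v) = v := by
  suffices e : degOp n M κ hu * degOp n M κ hu' = 1 from LinearMap.congr_fun e v
  refine ext_monomialVec fun L => ?_
  rw [Module.End.mul_apply, degOp_monomialVec, map_smul, degOp_monomialVec]
  refine (smul_smul_of_eq (R := 𝕜) (W := Fock n M κ 𝕜) (c := 1) ?_ _).trans
    (one_smul 𝕜 (monomialVec n M κ 𝕜 L))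
  rw [← mul_zpow, mul_comm, h, one_zpow]

/-- Multiplying the operator of degree εk by u^(εk) is the substitution z ↦ u^ε z. -/
theorem degMap_halfExp {u : 𝕜} (hu : u ≠ 0) (c : ℕ → 𝕜) (ε : ℤˣ) (i : Fin (n + 1)) (a : ℤ) :
    degMap n M κ hu (zCoeff (halfExp c ε (heisH n M κ 𝕜 i)) a) =
      u ^ ((ε : ℤ) * a) • zCoeff (halfExp c ε (heisH n M κ 𝕜 i)) a := by
  have := charZero_of_algebra 𝕜
  rcases le_or_gt 0 a with ha | ha
  swap
  · rw [zCoeff_of_neg _ (by omega), map_zero, smul_zero]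
  lift a to ℕ using ha
  rw [zCoeff_natCast, map_coeff_halfExp, zpow_mul, zpow_natCast,
    ← coeff_halfExp_scale (fun k l => commute_heisH_of_sign i i k l)]
  unfold halfExp
  congr 3
  ext k
  split_ifs
  · rfl
  · simp only
    rw [degMap_heisH, zpow_mul, zpow_natCast]
    exact smul_smul_of_eq (R := 𝕜) (W := Heis n M κ 𝕜) (mul_comm _ _) _

end Fock

/-! ### Scalar contraction functions -/

section ScalarExp

variable {R : Type*} [Field R]

/-- The Euler operator does not see the constant term of the exponent, so contraction data are
needed only in degrees k ≠ 0. -/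
theorem IsExp.congr {x x' X : PowerSeries R} (h : IsExp x X)
    (hx : ∀ k, k ≠ 0 → PowerSeries.coeff k x' = PowerSeries.coeff k x) : IsExp x' X where
  coeff_zero := h.coeff_zero
  euler := by
    rw [h.euler]
    congr 1
    ext k
    rw [coeff_eulerOp, coeff_eulerOp]
    rcases eq_or_ne k 0 with rfl | hk
    · simp
    · rw [hx k hk]

/-- `1 / (1 - r u)`. -/
def geomSeries (r : R) : PowerSeries R := PowerSeries.mk fun k => r ^ k

/-- `1 - r u`. -/
def linSeries (r : R) : PowerSeries R := 1 - PowerSeries.C r * PowerSeries.X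

/-- `∑ r^k u^k / k`. -/
def logSeries (r : R) : PowerSeries R := PowerSeries.mk fun k => (k : R)⁻¹ * r ^ k

theorem geomSeries_mul_linSeries (r : R) : geomSeries r * linSeries r = 1 := by
  unfold geomSeries linSeries
  ext k
  rw [mul_sub, mul_one, map_sub, ← mul_assoc, PowerSeries.coeff_mk]
  rcases k with _ | k
  · simp
  · rw [PowerSeries.coeff_succ_mul_X, PowerSeries.coeff_mul_C, PowerSeries.coeff_mk,
      PowerSeries.coeff_one, pow_succ, sub_self]; simp

theorem coeff_logSeries (r : R) (k : ℕ) :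
    PowerSeries.coeff k (logSeries r) = (k : R)⁻¹ * r ^ k := by simp [logSeries]

theorem eulerOp_logSeries [CharZero R] (r : R) :
    eulerOp (logSeries r) = PowerSeries.C r * PowerSeries.X * geomSeries r := by
  ext k
  rw [coeff_eulerOp, coeff_logSeries, nsmul_eq_mul, mul_assoc, PowerSeries.coeff_C_mul]
  rcases k with _ | k
  · simp
  · rw [mul_comm PowerSeries.X, PowerSeries.coeff_succ_mul_X, geomSeries, PowerSeries.coeff_mk,
      mul_inv_cancel_left₀ (Nat.cast_ne_zero.mpr k.succ_ne_zero), pow_succ']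

theorem eulerOp_linSeries (r : R) :
    eulerOp (linSeries r) = -(PowerSeries.C r * PowerSeries.X) := by
  ext k
  rw [coeff_eulerOp]
  simp only [linSeries, map_sub, map_neg, PowerSeries.coeff_C_mul, PowerSeries.coeff_X,
    PowerSeries.coeff_one]
  rcases k with _ | _ | k <;> simp

/-- Obtained by differentiating the identity `geomSeries r * linSeries r = 1`. -/
theorem isExp_geomSeries [CharZero R] (r : R) : IsExp (logSeries r) (geomSeries r) where
  coeff_zero := by simp [geomSeries]
  euler := by
    have h := congrArg eulerOp (geomSeries_mul_linSeries r)
    have h1 : eulerOp (1 : PowerSeries R) = 0 := by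
      rw [← map_one PowerSeries.C, eulerOp_C]
    rw [eulerOp_mul, h1, eulerOp_linSeries, mul_neg, add_neg_eq_zero] at h
    have h2 := congrArg (· * geomSeries r) h
    simp only [mul_assoc] at h2
    rw [mul_comm (linSeries r), geomSeries_mul_linSeries, mul_one] at h2
    rw [h2, eulerOp_logSeries]
    ring

theorem isExp_linSeries [CharZero R] (r : R) : IsExp (-logSeries r) (linSeries r) where
  coeff_zero := by simp [linSeries]
  euler := by
    have h : eulerOp (-logSeries r) = -eulerOp (logSeries r) := by ext; simp
    rw [h, eulerOp_logSeries, eulerOp_linSeries, neg_mul, mul_assoc, geomSeries_mul_linSeries,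
      mul_one]

theorem isExp_one : IsExp (0 : PowerSeries R) 1 where
  coeff_zero := by simp
  euler := by
    ext k
    rw [coeff_eulerOp, PowerSeries.coeff_one]
    have : eulerOp (0 : PowerSeries R) = 0 := by ext; simp
    rw [this]
    rcases k with _ | k <;> simp

/-- The recursion (1 - ru)·f = 1 in a form valid on all of ℤ; the delta term at 0 is the only trace
of the direction of expansion. -/
theorem zCoeff_geomSeries (r : R) (x : ℤ) :
    zCoeff (geomSeries r) x = r * zCoeff (geomSeries r) (x - 1) + if x = 0 then 1 else 0 := by
  unfold zCoeff geomSeries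
  rcases lt_trichotomy x 0 with h | rfl | h
  · rw [if_neg (by omega), if_neg (by omega), if_neg (by omega)]; simp
  · simp
  · rw [if_pos (by omega), if_pos (by omega), if_neg (by omega), PowerSeries.coeff_mk,
      PowerSeries.coeff_mk, ← pow_succ', add_zero]
    congr 1; omega

theorem zCoeff_one (x : ℤ) : zCoeff (1 : PowerSeries R) x = if x = 0 then 1 else 0 := by
  unfold zCoeff
  rw [PowerSeries.coeff_one]
  split_ifs <;> first | rfl | omega

theorem zCoeff_linSeries (r : R) (x : ℤ) :
    zCoeff (linSeries r) x = (if x = 0 then 1 else 0) - r * if x = 1 then 1 else 0 := by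
  rw [linSeries, zCoeff_sub, zCoeff_one, zCoeff_C_mul]
  congr 2
  have := zCoeff_X_pow_mul (1 : PowerSeries R) 1 x
  rw [pow_one, mul_one, zCoeff_one] at this
  rw [this]
  split_ifs <;> first | rfl | (exfalso; push_cast at *; omega)

theorem zCoeff_mul_eq_finsum {A : Type*} [Ring A] (X Y : PowerSeries A) (N : ℤ) :
    zCoeff (X * Y) N = ∑ᶠ a : ℤ, zCoeff X a * zCoeff Y (N - a) := by
  rcases le_or_gt 0 N with hN | hN
  · lift N to ℕ using hN
    rw [zCoeff_natCast, PowerSeries.coeff_mul, Finset.Nat.sum_antidiagonal_eq_sum_range_succ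
      fun i j => PowerSeries.coeff i X * PowerSeries.coeff j Y]
    rw [finsum_eq_sum_of_support_subset (s := (Finset.range (N + 1)).map Nat.castEmbedding)]
    · rw [Finset.sum_map]
      refine Finset.sum_congr rfl fun c hc => ?_
      have hc' : c ≤ N := by simpa [Nat.lt_succ_iff] using hc
      rw [Nat.castEmbedding_apply, zCoeff_natCast, ← Nat.cast_sub hc', zCoeff_natCast]
    · intro c hc
      have h0 : 0 ≤ c := by
        by_contra h; exact hc (by simp [zCoeff_of_neg X h])
      have h1 : 0 ≤ N - c := by
        by_contra h; exact hc (by simp [zCoeff_of_neg Y h])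
      lift c to ℕ using h0
      simp only [Finset.coe_map, Set.mem_image, Finset.mem_coe, Finset.mem_range]
      exact ⟨c, by omega, rfl⟩
  · rw [zCoeff_of_neg _ (by omega), finsum_eq_zero_of_forall_eq_zero]
    intro c
    rcases le_or_gt 0 c with hc | hc
    · rw [zCoeff_of_neg Y (by omega), mul_zero]
    · rw [zCoeff_of_neg X (by omega), zero_mul]

/-- The contraction function of opposite fields at equal nodes. -/
theorem zCoeff_geom_mul_geom (u : R) (x : ℤ) :
    (u - u⁻¹) * zCoeff (geomSeries u * geomSeries u⁻¹) x =
      if 0 ≤ x then u ^ (x + 1) - u ^ (-(x + 1)) else 0 := by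
  split_ifs with h
  · lift x to ℕ using h
    rw [zCoeff_natCast, PowerSeries.coeff_mul, Finset.Nat.sum_antidiagonal_eq_sum_range_succ
      fun i j => PowerSeries.coeff i (geomSeries u) * PowerSeries.coeff j (geomSeries u⁻¹)]
    -- The coefficient is ∑ u^i (u⁻¹)^(x-i), which telescopes on multiplication by u - u⁻¹.
    have := geom_sum₂_mul u u⁻¹ (x + 1)
    rw [mul_comm]
    simp only [geomSeries, PowerSeries.coeff_mk]
    rw [zpow_neg, ← Nat.cast_succ, zpow_natCast, ← inv_pow, ← this]
    congr 1
  · rw [zCoeff_of_neg _ h, mul_zero]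

theorem zCoeff_lin_mul_lin (ρ : R) :
    (zCoeff (linSeries 1 * linSeries ρ) 0 = 1 ∧ zCoeff (linSeries 1 * linSeries ρ) 1 = -(1 + ρ) ∧
      zCoeff (linSeries 1 * linSeries ρ) 2 = ρ) ∧
      ∀ x, x < 0 ∨ 3 ≤ x → zCoeff (linSeries 1 * linSeries ρ) x = 0 := by
  have h : ∀ x, zCoeff (linSeries 1 * linSeries ρ) x =
      zCoeff (linSeries ρ) x - zCoeff (linSeries ρ) (x - 1) := by
    intro x
    have e : linSeries 1 * linSeries ρ = linSeries ρ - PowerSeries.X ^ 1 * linSeries ρ := by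
      rw [linSeries, map_one, pow_one, one_mul, sub_mul, one_mul]
    rw [e, zCoeff_sub, zCoeff_X_pow_mul]; rfl
  simp only [h, zCoeff_linSeries]
  refine ⟨⟨by simp, by simp; ring, by simp⟩, fun x hx => ?_⟩
  rw [if_neg (by omega), if_neg (by omega), if_neg (by omega), if_neg (by omega)]; simp

end ScalarExp

/-! ### Kernel identities for two modes -/

namespace Modes

variable {R W : Type*} [Field R] [AddCommGroup W] [Module R W] {X Y : Modes R W ℤ} {f f' : ℤ → R}

/-- All four products have the same total degree, so a single functional is evaluated on four
kernels. -/
theorem mode_exchange (h : Contracts X Y f) (h' : Contracts Y X f')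
    (hp : ∀ a b, Commute (X.pos a) (Y.pos b)) (hn : ∀ a b, Commute (X.neg a) (Y.neg b))
    {A B C D : R} {m₁ l₁ m₂ l₂ m₃ l₃ m₄ l₄ : ℤ} (h₂ : m₂ + l₂ = m₁ + l₁) (h₃ : m₃ + l₃ = m₁ + l₁)
    (h₄ : m₄ + l₄ = m₁ + l₁)
    (key : ∀ c, A * f (c - m₁) - B * f' (m₂ - c) = C * f (c - m₃) - D * f' (m₄ - c)) (v : W) :
    A • X.mode m₁ (Y.mode l₁ v) - B • Y.mode l₂ (X.mode m₂ v) =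
      C • X.mode m₃ (Y.mode l₃ v) - D • Y.mode l₄ (X.mode m₄ v) := by
  rw [h.mode_mode_eq_kernel, h.mode_mode_eq_kernel, h'.mode_mode_eq_kernel_symm hp hn,
    h'.mode_mode_eq_kernel_symm hp hn, h₂, h₃, h₄, ← map_smul, ← map_smul, ← map_smul, ← map_smul,
    ← map_sub, ← map_sub]
  congr 1
  ext c
  exact key c

/-- The kernel u^c amounts to setting z = uw in the normally ordered product: `P` and `S` are the
coefficients of the merged creation and annihilation parts. -/
theorem kernel₂_zpow {u : R} (hu : u ≠ 0) {P S : ℤ → Module.End R W}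
    (hP : ∀ N, P N = ∑ᶠ a, u ^ a • (X.pos a * Y.pos (N - a)))
    (hS : ∀ N, S N = ∑ᶠ b, u ^ (-b) • (X.neg b * Y.neg (N - b))) (v : W) (n : ℤ) :
    kernel₂ X Y v n (fun c => u ^ c) = ∑ᶠ N, P (n + N) (S N v) := by
  have fP : ∀ N w, P N w = ∑ᶠ a, u ^ a • X.pos a (Y.pos (N - a) w) := fun N w => by
    have hfin : (Function.support fun a => u ^ a • (X.pos a * Y.pos (N - a))).Finite :=
      (Set.finite_Icc 0 N).subset fun a ha => ⟨by
        by_contra h; exact ha (by simp only; rw [X.pos_eq_zero _ h, zero_mul, smul_zero]), by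
        by_contra h; exact ha (by
          simp only; rw [Y.pos_eq_zero _ (by omega), mul_zero, smul_zero])⟩
    rw [hP]
    exact (((LinearMap.applyₗ w : Module.End R W →ₗ[R] W).toAddMonoidHom).map_finsum hfin)
  have finS : ∀ N, (Function.support fun a => u ^ (-a) • (X.neg a * Y.neg (N - a))).Finite :=
    fun N => (Set.finite_Icc 0 N).subset fun a ha => ⟨by
        by_contra h; exact ha (by simp only; rw [X.neg_eq_zero _ h, zero_mul, smul_zero]), by
        by_contra h; exact ha (by
          simp only; rw [Y.neg_eq_zero _ (by omega), mul_zero, smul_zero])⟩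
  have fS : ∀ N w, S N w = ∑ᶠ b, u ^ (-b) • X.neg b (Y.neg (N - b) w) := fun N w => by
    rw [hS]
    exact (((LinearMap.applyₗ w : Module.End R W →ₗ[R] W).toAddMonoidHom).map_finsum (finS N))
  set F : ℤ × ℤ × ℤ → W := fun z => u ^ z.1 • X.pos (z.1 + z.2.1) (Y.pos (n - z.1 + z.2.2)
    (X.neg z.2.1 (Y.neg z.2.2 v))) with hF
  have hfin : (Function.support F).Finite := by
    have hT := (X.comp Y).finite_neg v
    refine ((hT.biUnion fun b _ => Set.finite_Icc (-b.1) (n + b.2)).prod hT).subset fun z hz => ?_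
    have h1 : (X.comp Y).neg z.2 v ≠ 0 := fun h0 => hz (by
      have : X.neg z.2.1 (Y.neg z.2.2 v) = 0 := h0
      simp only [hF, this, map_zero, smul_zero])
    refine ⟨?_, h1⟩
    simp only [Set.mem_iUnion]
    refine ⟨z.2, h1, ?_, ?_⟩
    · by_contra h; exact hz (by simp only [hF]; rw [X.pos_eq_zero _ (by omega)]; simp)
    · by_contra h; exact hz (by simp only [hF]; rw [Y.pos_eq_zero _ (by omega)]; simp)
  have e1 : kernel₂ X Y v n (fun c => u ^ c) = ∑ᶠ z, F z := by
    rw [finsum_curry _ hfin, kernel₂_apply]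
    refine finsum_congr fun c => ?_
    rw [mode_apply, smul_finsum]
    refine finsum_congr fun b => ?_
    simp [hF, comp]
  -- The new variables are the total annihilation degree `N`, the part `b` of it in `X`, and the
  -- creation degree `a` of `X`; thus c = a - b.
  let e : ℤ × ℤ × ℤ ≃ ℤ × ℤ × ℤ :=
    { toFun := fun z => (z.2.2 - z.2.1, z.2.1, z.1 - z.2.1)
      invFun := fun z => (z.2.1 + z.2.2, z.2.1, z.1 + z.2.1)
      left_inv := fun z => by ext <;> dsimp only <;> ring
      right_inv := fun z => by ext <;> dsimp only <;> ring }
  rw [e1, ← finsum_comp_equiv e, finsum_curry _ (hfin.preimage e.injective.injOn)]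
  refine finsum_congr fun N => ?_
  rw [finsum_curry _ ((hfin.preimage e.injective.injOn).preimage
    (f := fun z : ℤ × ℤ => (N, z)) fun z _ z' _ h => (Prod.mk.inj h).2), fS, map_finsum]
  · refine finsum_congr fun b => ?_
    rw [map_smul, fP, smul_finsum]
    refine finsum_congr fun a => ?_
    simp only [hF, e, Equiv.coe_fn_mk]
    rw [smul_smul, ← zpow_add₀ hu, sub_add_cancel, show n - (a - b) + (N - b) = n + N - a by ring,
      sub_eq_neg_add]
  · exact (finS N).subset fun b hb h0 => hb (by
      have := LinearMap.congr_fun h0 v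
      simpa using this)

end Modes

/-! ### The Cartan matrix -/

section Cartan

variable {n : ℕ}

theorem cartan_self (hn : 1 < n) (i : Fin (n + 1)) : cartan n i i = 2 := by
  have h : i ≠ i + 1 := by
    intro h
    have h1 : (1 : Fin (n + 1)) = 0 := by simpa using h.symm
    have := congrArg Fin.val h1
    rw [Fin.val_one', Nat.mod_eq_of_lt (by omega)] at this
    simp at this
  unfold cartan
  rw [if_pos rfl, if_neg h, if_neg h.symm]; rfl

theorem cartan_symm (i j : Fin (n + 1)) : cartan n i j = cartan n j i := by
  unfold cartan
  have h1 : (i = j) = (j = i) := propext eq_comm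
  have h2 : (i = j + 1) = (j + 1 = i) := propext eq_comm
  have h3 : (i + 1 = j) = (j = i + 1) := propext eq_comm
  simp only [h1, h2, h3]
  ring

theorem cartan_of_ne (hn : 1 < n) {i j : Fin (n + 1)} (h : i ≠ j) :
    cartan n i j = 0 ∨ cartan n i j = -1 := by
  unfold cartan
  rw [if_neg h]
  -- For 1 < n a node cannot neighbour another on both sides; for n = 1 it would, and the entry
  -- would be -2.
  have h12 : i = j + 1 → i + 1 ≠ j := by
    rintro rfl h2
    have h1 : (1 + 1 : Fin (n + 1)) = 0 := by
      have : j + (1 + 1) = j + 0 := by rw [← add_assoc, h2, add_zero]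
      exact add_left_cancel this
    have := congrArg Fin.val h1
    rw [Fin.val_add, Fin.val_one', Nat.mod_eq_of_lt (show 1 < n + 1 by omega),
      Nat.mod_eq_of_lt (by omega)] at this
    simp at this
  by_cases h1 : i = j + 1
  · rw [if_pos h1, if_neg (h12 h1)]; right; rfl
  · rw [if_neg h1]
    split_ifs
    · right; rfl
    · left; rfl

theorem sum_cartan (k : Fin (n + 1)) : ∑ i, cartan n i k = 0 := by
  unfold cartan
  simp only [Finset.sum_sub_distrib, ← Finset.mul_sum, ← eq_sub_iff_add_eq]
  simp

variable {M : Matrix (Fin (n + 1)) (Fin (n + 1)) ℤ}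

theorem skew_apply (hM : M.transpose = -M) (i j : Fin (n + 1)) : M j i = -M i j :=
  congrFun (congrFun hM i) j

theorem skew_self (hM : M.transpose = -M) (i : Fin (n + 1)) : M i i = 0 := by
  have := skew_apply hM i i; omega

theorem pairing_add_single (p i j : Fin (n + 1)) (β : Fin (n + 1) → ℤ) (η : ℤ) :
    pairing n p i (β + Pi.single j η) = pairing n p i β + cartan n i j * η := by
  unfold pairing
  simp only [Pi.add_apply, mul_add, Finset.sum_add_distrib]
  rw [Finset.sum_eq_single (f := fun k => cartan n i k * (Pi.single j η : Fin (n + 1) → ℤ) k) j]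
  · rw [Pi.single_eq_same]; ring
  · intro b _ hb; rw [Pi.single_eq_of_ne hb, mul_zero]
  · simp

theorem twist_add_single (i j : Fin (n + 1)) (β : Fin (n + 1) → ℤ) (η : ℤ) :
    twist n M i (β + Pi.single j η) = twist n M i β + cartan n i j * η * M i j := by
  unfold twist
  simp only [Pi.add_apply, mul_add, add_mul, Finset.sum_add_distrib]
  rw [Finset.sum_eq_single
    (f := fun k => cartan n i k * (Pi.single j η : Fin (n + 1) → ℤ) k * M i k) j]
  · rw [Pi.single_eq_same]
  · intro b _ hb; rw [Pi.single_eq_of_ne hb, mul_zero, zero_mul]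
  · simp

/-- The increment of (β|β) is twice an integer, so it passes through the integer division whatever
the parity of (β|β). -/
theorem normSq_add_single (hn : 1 < n) (j : Fin (n + 1)) (β : Fin (n + 1) → ℤ) (ε : ℤˣ) :
    normSq n (β + Pi.single j (ε : ℤ)) / 2 =
      normSq n β / 2 + ((ε : ℤ) * (∑ k, cartan n j k * β k) + 1) := by
  have hs : ∀ (f : Fin (n + 1) → ℤ),
      ∑ k, f k * (Pi.single j (ε : ℤ) : Fin (n + 1) → ℤ) k = f j * ε := by
    intro f
    rw [Finset.sum_eq_single j]
    · rw [Pi.single_eq_same]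
    · intro b _ hb; rw [Pi.single_eq_of_ne hb, mul_zero]
    · simp
  have e : normSq n (β + Pi.single j (ε : ℤ)) =
      normSq n β + 2 * ((ε : ℤ) * (∑ k, cartan n j k * β k) + 1) := by
    unfold normSq
    have h1 : ∀ i, ∑ k, cartan n i k * (β + Pi.single j (ε : ℤ) : Fin (n + 1) → ℤ) i *
        (β + Pi.single j (ε : ℤ) : Fin (n + 1) → ℤ) k =
        ((∑ k, cartan n i k * β k) + cartan n i j * ε) *
          (β i + (Pi.single j (ε : ℤ) : Fin (n + 1) → ℤ) i) := by
      intro i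
      rw [← hs (fun k => cartan n i k), ← Finset.sum_add_distrib, Finset.sum_mul]
      refine Finset.sum_congr rfl fun k _ => ?_
      simp only [Pi.add_apply]; ring
    simp only [h1, mul_add, Finset.sum_add_distrib]
    rw [hs]
    have hε : (ε : ℤ) * ε = 1 := by rw [← Units.val_mul, Int.units_mul_self]; rfl
    have h2 : ∑ i, (∑ k, cartan n i k * β k + cartan n i j * (ε : ℤ)) * β i =
        (∑ i, ∑ k, cartan n i k * β i * β k) + ε * ∑ k, cartan n j k * β k := by
      rw [Finset.mul_sum, ← Finset.sum_add_distrib]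
      refine Finset.sum_congr rfl fun i _ => ?_
      rw [add_mul, Finset.sum_mul, cartan_symm i j]
      congr 1
      · exact Finset.sum_congr rfl fun k _ => by ring
      · ring
    rw [h2, cartan_self hn]
    linear_combination 2 * hε
  rw [e, Int.add_mul_ediv_left _ _ (by norm_num)]

end Cartan

/-! ### Vertex operators on a representation of the Heisenberg algebra -/

/-- A locally nilpotent representation of the Heisenberg algebra with degree operators. -/
structure HeisRep (n : ℕ) (M : Matrix (Fin (n + 1)) (Fin (n + 1)) ℤ) (κ : Qq)
    (𝕜 : Type*) [Field 𝕜] [Algebra Qq 𝕜] (W : Type*) [AddCommGroup W] [Module 𝕜 W] where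
  h : Fin (n + 1) → NZ → Module.End 𝕜 W
  comm : ∀ i j k l, h i k * h j l - h j l * h i k =
    if k.1 + l.1 = 0 then
      algebraMap 𝕜 _ (algebraMap Qq 𝕜 (structConst n M κ i j k.1 * qInt k.1)) else 0
  nil : ∀ (c : ℕ → 𝕜) i v, (Function.support fun b : ℤ => zCoeff (halfExp c 1 (h i)) b v).Finite
  D : ℤˣ → Module.End 𝕜 W
  D_mul : ∀ ε, D ε * D (-ε) = 1
  D_h : ∀ ε i l, D ε * h i l = algebraMap Qq 𝕜 q ^ ((ε : ℤ) * l.1) • (h i l * D ε)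
  D_halfExp : ∀ ε (c : ℕ → 𝕜) (η : ℤˣ) i a, D ε * zCoeff (halfExp c η (h i)) a =
    algebraMap Qq 𝕜 q ^ ((ε : ℤ) * ((η : ℤ) * a)) • (zCoeff (halfExp c η (h i)) a * D ε)

namespace HeisRep

variable {n : ℕ} {M : Matrix (Fin (n + 1)) (Fin (n + 1)) ℤ} {κ : Qq}
  {𝕜 : Type*} [Field 𝕜] [Algebra Qq 𝕜] {W : Type*} [AddCommGroup W] [Module 𝕜 W]
  (X : HeisRep n M κ 𝕜 W) (s : 𝕜)

theorem commute_of_sign (i j : Fin (n + 1)) {ε : ℤˣ} (k l : NZ) (hk : 0 < (ε : ℤ) * k)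
    (hl : 0 < (ε : ℤ) * l) : Commute (X.h i k) (X.h j l) := by
  have h0 : k.1 + l.1 ≠ 0 := by
    intro h
    have : (ε : ℤ) * (k.1 + l.1) = 0 := by rw [h, mul_zero]
    rw [mul_add] at this
    omega
  have := X.comm i j k l
  rw [if_neg h0] at this
  exact sub_eq_zero.mp this

/-- The coefficients in the exponents of the vertex operators. -/
def vertexCoeff (ε : ℤˣ) (k : ℕ) : 𝕜 :=
  ((ε : ℤ) : 𝕜) * ((algebraMap Qq 𝕜 (qInt k))⁻¹ * s ^ (-((ε : ℤ) * k)))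

/-- The Heisenberg part of the vertex operators `E_i(z)` (for `ε = 1`) and `F_i(z)`
(for `ε = -1`). -/
def vertexModes (i : Fin (n + 1)) (ε : ℤˣ) : Modes 𝕜 W ℤ where
  pos a := zCoeff (halfExp (vertexCoeff s ε) (-1) (X.h i)) a
  neg b := zCoeff (halfExp (fun k => -vertexCoeff s ε k) 1 (X.h i)) b
  pos_eq_zero _ h := zCoeff_of_neg _ h
  neg_eq_zero _ h := zCoeff_of_neg _ h
  finite_neg v := X.nil _ i v

theorem commute_zCoeff {A : Type*} [Ring A] {f g : PowerSeries A}
    (h : ∀ a b, Commute (PowerSeries.coeff a f) (PowerSeries.coeff b g)) (a b : ℤ) :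
    Commute (zCoeff f a) (zCoeff g b) := by
  unfold zCoeff
  split_ifs
  · exact h _ _
  · exact Commute.zero_right _
  · exact Commute.zero_left _
  · exact Commute.zero_left _

theorem commute_pos (i j : Fin (n + 1)) (ε η : ℤˣ) (a b : ℤ) :
    Commute ((X.vertexModes s i ε).pos a) ((X.vertexModes s j η).pos b) :=
  commute_zCoeff (commute_halfExp_halfExp (X.commute_of_sign i j) _ _) a b

theorem commute_neg (i j : Fin (n + 1)) (ε η : ℤˣ) (a b : ℤ) :
    Commute ((X.vertexModes s i ε).neg a) ((X.vertexModes s j η).neg b) :=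
  commute_zCoeff (commute_halfExp_halfExp (X.commute_of_sign i j) _ _) a b

/-- Only equal degrees fail to commute, with a scalar commutator. The minus sign comes from the
annihilation exponent, whose coefficients are `-vertexCoeff`. -/
theorem contracts_of_isExp (i j : Fin (n + 1)) (ε η : ℤˣ) {μ f : PowerSeries 𝕜} (hf : IsExp μ f)
    (hμ : ∀ k, k ≠ 0 → PowerSeries.coeff k μ = -(vertexCoeff s ε k * vertexCoeff s η k) *
      algebraMap Qq 𝕜 (structConst n M κ i j k * qInt k)) :
    Modes.Contracts (X.vertexModes s i ε) (X.vertexModes s j η) (zCoeff f) := by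
  have := charZero_of_algebra 𝕜
  refine ⟨fun c hc => zCoeff_of_neg _ hc, fun b a => ?_⟩
  refine contraction (isExp_halfExp (X.commute_of_sign i i) _)
    (isExp_halfExp (X.commute_of_sign j j) _) hf (fun k l hk hl => ?_) b a
  rw [coeff_halfSum _ _ _ hk, coeff_halfSum _ _ _ hl, smul_mul_smul_comm, smul_mul_smul_comm,
    mul_comm (vertexCoeff s η l), ← smul_sub, X.comm]
  by_cases h : l = k
  · subst h
    rw [if_pos rfl, if_pos (by simp), hμ l hk, Algebra.smul_def, ← map_mul]
    simp [neg_mul]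
  · rw [if_neg h, if_neg, smul_zero]
    simp only [Units.val_one, Units.val_neg]
    omega

/-! ### The contraction functions of the vertex operators. -/

section Contractions

variable {s} (hs : s ^ 2 = algebraMap Qq 𝕜 q)

theorem algebraMap_q_ne_zero : algebraMap Qq 𝕜 q ≠ 0 :=
  (map_ne_zero _).mpr q_ne_zero

include hs in
theorem s_ne_zero : s ≠ 0 := by
  rintro rfl
  exact algebraMap_q_ne_zero (𝕜 := 𝕜) (by rw [← hs]; simp)

include hs in
-- For fields of the same kind the half powers of q combine to q^{-εk}; for opposite kinds they
-- cancel. This is the difference between the two families of contraction functions.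
theorem vertexCoeff_mul_self (ε : ℤˣ) {k : ℕ} :
    vertexCoeff s ε k * vertexCoeff s ε k =
      (algebraMap Qq 𝕜 (qInt k))⁻¹ ^ 2 * (algebraMap Qq 𝕜 q ^ (-(ε : ℤ))) ^ k := by
  have hε : ((ε : ℤ) : 𝕜) * ((ε : ℤ) : 𝕜) = 1 := by
    rw [← Int.cast_mul, ← Units.val_mul, Int.units_mul_self]; simp
  have h2 : s ^ (-((ε : ℤ) * k)) * s ^ (-((ε : ℤ) * k)) = (algebraMap Qq 𝕜 q ^ (-(ε : ℤ))) ^ k := by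
    rw [← hs, ← zpow_add₀ (s_ne_zero hs), ← zpow_natCast (_ ^ _), ← zpow_mul, ← zpow_natCast s 2,
      ← zpow_mul]
    congr 1; push_cast; ring
  unfold vertexCoeff
  rw [← h2]
  linear_combination (algebraMap Qq 𝕜 (qInt k))⁻¹ ^ 2 * s ^ (-((ε : ℤ) * k)) *
    s ^ (-((ε : ℤ) * k)) * hε

include hs in
theorem vertexCoeff_mul_neg (ε : ℤˣ) {k : ℕ} :
    vertexCoeff s ε k * vertexCoeff s (-ε) k = -(algebraMap Qq 𝕜 (qInt k))⁻¹ ^ 2 := by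
  have hε : ((ε : ℤ) : 𝕜) * ((ε : ℤ) : 𝕜) = 1 := by
    rw [← Int.cast_mul, ← Units.val_mul, Int.units_mul_self]; simp
  have h2 : s ^ (-((ε : ℤ) * k)) * s ^ (-(((-ε : ℤˣ) : ℤ) * k)) = 1 := by
    rw [← zpow_add₀ (s_ne_zero hs), Units.val_neg]
    convert zpow_zero s; ring
  unfold vertexCoeff
  rw [Units.val_neg] at *
  push_cast
  linear_combination (-(algebraMap Qq 𝕜 (qInt k))⁻¹ ^ 2 * s ^ (-((ε : ℤ) * k)) *
    s ^ (-(-(ε : ℤ) * k))) * hε - (algebraMap Qq 𝕜 (qInt k))⁻¹ ^ 2 * h2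

theorem structConst_of_zero {i j : Fin (n + 1)} (ha : cartan n i j = 0) (k : ℤ) :
    structConst n M κ i j k = 0 := by
  simp [structConst, ha, qInt_zero]

theorem structConst_of_neg_one {i j : Fin (n + 1)} (ha : cartan n i j = -1) (k : ℕ) :
    structConst n M κ i j k = -((k : Qq)⁻¹ * qInt k * (κ ^ (-M i j)) ^ k) := by
  unfold structConst
  rw [ha, mul_neg_one, qInt_neg, ← zpow_natCast, ← zpow_mul, mul_comm (-M i j), neg_mul, mul_neg]
  push_cast; ring

theorem structConst_of_two {i j : Fin (n + 1)} (ha : cartan n i j = 2) (hm : M i j = 0) (k : ℕ) :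
    structConst n M κ i j k = (k : Qq)⁻¹ * qInt k * (q ^ k + (q⁻¹) ^ k) := by
  unfold structConst
  rw [ha, hm, qInt_mul_two, zpow_natCast, zpow_neg, zpow_natCast, inv_pow]
  simp; ring

theorem algebraMap_qInt_ne_zero {k : ℕ} (hk : k ≠ 0) : algebraMap Qq 𝕜 (qInt k) ≠ 0 :=
  (map_ne_zero _).mpr (qInt_ne_zero (by exact_mod_cast hk))

theorem contracts_of_zero {i j : Fin (n + 1)} (ha : cartan n i j = 0) (ε η : ℤˣ) :
    Modes.Contracts (X.vertexModes s i ε) (X.vertexModes s j η)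
      (zCoeff (1 : PowerSeries 𝕜)) := by
  refine X.contracts_of_isExp s i j ε η isExp_one fun k hk => ?_
  rw [structConst_of_zero ha]; simp

include hs in
-- The exponent has coefficients (q^{-ε}κ^{-m_ij})^k / k, the logarithm of a geometric series.
theorem contracts_same_neg_one {i j : Fin (n + 1)} (ha : cartan n i j = -1) (ε : ℤˣ) :
    Modes.Contracts (X.vertexModes s i ε) (X.vertexModes s j ε)
      (zCoeff (geomSeries (algebraMap Qq 𝕜 q ^ (-(ε : ℤ)) * algebraMap Qq 𝕜 κ ^ (-M i j)))) := by
  have := charZero_of_algebra 𝕜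
  refine X.contracts_of_isExp s i j ε ε (isExp_geomSeries _) fun k hk => ?_
  have h1 := algebraMap_qInt_ne_zero (𝕜 := 𝕜) hk
  rw [vertexCoeff_mul_self hs, structConst_of_neg_one ha, coeff_logSeries, mul_pow]
  simp only [map_mul, map_neg, map_inv₀, map_pow, map_zpow₀, map_natCast]
  field_simp

include hs in
-- Since [2k]/[k] = q^k + q^{-k}, the exponent has coefficients -(1 + q^{-2εk})/k.
theorem contracts_same_two {i j : Fin (n + 1)} (ha : cartan n i j = 2) (hm : M i j = 0)
    (ε : ℤˣ) : Modes.Contracts (X.vertexModes s i ε) (X.vertexModes s j ε)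
      (zCoeff (linSeries 1 * linSeries ((algebraMap Qq 𝕜 q ^ (ε : ℤ))⁻¹ ^ 2))) := by
  have := charZero_of_algebra 𝕜
  refine X.contracts_of_isExp s i j ε ε ((isExp_linSeries _).mul (isExp_linSeries _)
    (Commute.all _ _)) fun k hk => ?_
  have h1 := algebraMap_qInt_ne_zero (𝕜 := 𝕜) hk
  have h2 := algebraMap_q_ne_zero (𝕜 := 𝕜)
  rw [vertexCoeff_mul_self hs, structConst_of_two ha hm]
  simp only [map_add, map_neg, coeff_logSeries, map_mul, map_inv₀, map_pow, map_natCast]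
  have hk' : (k : 𝕜) ≠ 0 := Nat.cast_ne_zero.mpr hk
  have h3 : (algebraMap Qq 𝕜 (qInt k))⁻¹ * algebraMap Qq 𝕜 (qInt k) = 1 := inv_mul_cancel₀ h1
  have h4 : algebraMap Qq 𝕜 q ^ k * (algebraMap Qq 𝕜 q)⁻¹ ^ k = 1 := by
    rw [← mul_pow, mul_inv_cancel₀ h2, one_pow]
  generalize algebraMap Qq 𝕜 (qInt k) = u at *
  rcases Int.units_eq_one_or ε with rfl | rfl
  · simp only [Units.val_one, zpow_one, zpow_neg, one_pow, ← pow_mul, mul_comm 2 k]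
    rw [pow_mul]
    generalize algebraMap Qq 𝕜 q ^ k = y at *
    generalize (algebraMap Qq 𝕜 q)⁻¹ ^ k = y' at *
    linear_combination (k : 𝕜)⁻¹ * (y' * (y + y')) * (u⁻¹ * u + 1) * h3 + (k : 𝕜)⁻¹ * h4
  · simp only [Units.val_one, Units.val_neg, zpow_one, zpow_neg, neg_neg, inv_inv, one_pow,
      ← pow_mul, mul_comm 2 k]
    rw [pow_mul]
    generalize algebraMap Qq 𝕜 q ^ k = y at *
    generalize (algebraMap Qq 𝕜 q)⁻¹ ^ k = y' at *
    linear_combination (k : 𝕜)⁻¹ * (y * (y + y')) * (u⁻¹ * u + 1) * h3 + (k : 𝕜)⁻¹ * h4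

include hs in
-- Here the coefficients are (q^k + q^{-k})/k, which put the poles at w = qz and w = q⁻¹z.
theorem contracts_opp_two {i j : Fin (n + 1)} (ha : cartan n i j = 2) (hm : M i j = 0)
    (ε : ℤˣ) : Modes.Contracts (X.vertexModes s i ε) (X.vertexModes s j (-ε))
      (zCoeff (geomSeries (algebraMap Qq 𝕜 q) * geomSeries (algebraMap Qq 𝕜 q)⁻¹)) := by
  have := charZero_of_algebra 𝕜
  refine X.contracts_of_isExp s i j ε (-ε) ((isExp_geomSeries _).mul (isExp_geomSeries _)
    (Commute.all _ _)) fun k hk => ?_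
  have h1 := algebraMap_qInt_ne_zero (𝕜 := 𝕜) hk
  have hk' : (k : 𝕜) ≠ 0 := Nat.cast_ne_zero.mpr hk
  rw [vertexCoeff_mul_neg hs, structConst_of_two ha hm]
  simp only [map_add, coeff_logSeries, map_mul, map_inv₀, map_pow, map_natCast]
  field_simp

include hs in
theorem contracts_opp_neg_one {i j : Fin (n + 1)} (ha : cartan n i j = -1) (ε : ℤˣ) :
    Modes.Contracts (X.vertexModes s i ε) (X.vertexModes s j (-ε))
      (zCoeff (linSeries (algebraMap Qq 𝕜 κ ^ (-M i j)))) := by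
  have := charZero_of_algebra 𝕜
  refine X.contracts_of_isExp s i j ε (-ε) (isExp_linSeries _) fun k hk => ?_
  have h1 := algebraMap_qInt_ne_zero (𝕜 := 𝕜) hk
  rw [vertexCoeff_mul_neg hs, structConst_of_neg_one ha, map_neg, coeff_logSeries]
  simp only [map_mul, map_neg, map_inv₀, map_pow, map_zpow₀, map_natCast]
  field_simp

end Contractions

end HeisRep

/-! ### Commutators of modes with Heisenberg and degree operators. -/

namespace Modes

section Intertwining

variable {R W : Type*} [Field R] [AddCommGroup W] [Module R W] (X : Modes R W ℤ)

/-- Lowering the creation index by `k` and raising the annihilation index by `k` both lower the mode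
by `k`, so the two corrections add. -/
theorem mode_commutator {T : Module.End R W} {k : ℤ} {μ ν : R}
    (hp : ∀ a, T * X.pos a = X.pos a * T + μ • X.pos (a - k))
    (hn : ∀ b, T * X.neg b = X.neg b * T + ν • X.neg (b + k)) (m : ℤ) :
    T * X.mode m = X.mode m * T + (μ + ν) • X.mode (m - k) := by
  ext v
  have hp' : ∀ a w, T (X.pos a w) = X.pos a (T w) + μ • X.pos (a - k) w :=
    fun a w => LinearMap.congr_fun (hp a) w
  have hn' : ∀ b w, T (X.neg b w) = X.neg b (T w) + ν • X.neg (b + k) w :=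
    fun b w => LinearMap.congr_fun (hn b) w
  have e : ∀ b, X.pos (m - k + (b + k)) (X.neg (b + k) v) = X.pos (m + b) (X.neg (b + k) v) :=
    fun b => by rw [show m - k + (b + k) = m + b by ring]
  have f1 := X.finite_support_mode m (T v)
  have f2 := X.finite_support_mode (m - k) v
  have f3 : (Function.support fun b => X.pos (m + b) (X.neg (b + k) v)).Finite := by
    simp only [← e]
    exact f2.preimage (f := fun b => b + k) (add_left_injective k).injOn
  simp only [Module.End.mul_apply, LinearMap.add_apply, LinearMap.smul_apply]
  rw [mode_apply, map_finsum _ (X.finite_support_mode m v)]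
  have e1 : ∀ b, T (X.pos (m + b) (X.neg b v)) = X.pos (m + b) (X.neg b (T v)) +
      (ν • X.pos (m + b) (X.neg (b + k) v) + μ • X.pos (m - k + b) (X.neg b v)) := fun b => by
    rw [hp', hn', map_add, map_smul, show m + b - k = m - k + b by ring, add_assoc]
  simp only [e1]
  have sub : ∀ {g : ℤ → W} (c : R), (Function.support g).Finite →
      (Function.support fun b => c • g b).Finite := fun c hg =>
    hg.subset (Function.support_const_smul_subset c _)
  rw [finsum_add_distrib f1 (((sub ν f3).union (sub μ f2)).subset (Function.support_add _ _)),
    finsum_add_distrib (sub ν f3) (sub μ f2), ← smul_finsum, ← smul_finsum, add_comm μ ν, add_smul]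
  congr 3
  rw [mode_apply, ← finsum_comp_equiv (f := fun b => X.pos (m - k + b) (X.neg b v))
    (Equiv.addRight k)]
  exact finsum_congr fun b => (e b).symm

/-- The factor x^(m+b) · x^(-b) = x^m does not depend on the summation index. -/
theorem mode_scaling {T : Module.End R W} {x : R} (hx : x ≠ 0)
    (hp : ∀ a, T * X.pos a = x ^ a • (X.pos a * T))
    (hn : ∀ b, T * X.neg b = x ^ (-b) • (X.neg b * T)) (m : ℤ) :
    T * X.mode m = x ^ m • (X.mode m * T) := by
  ext v
  simp only [Module.End.mul_apply, LinearMap.smul_apply]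
  rw [mode_apply, map_finsum _ (X.finite_support_mode m v), mode_apply, smul_finsum]
  refine finsum_congr fun b => ?_
  have h1 := LinearMap.congr_fun (hp (m + b)) (X.neg b v)
  have h2 := LinearMap.congr_fun (hn b) v
  simp only [Module.End.mul_apply, LinearMap.smul_apply] at h1 h2
  rw [h1, h2, map_smul, smul_smul, ← zpow_add₀ hx, add_neg_cancel_right]

end Intertwining

end Modes

namespace HeisRep

variable {n : ℕ} {M : Matrix (Fin (n + 1)) (Fin (n + 1)) ℤ} {κ : Qq}
  {𝕜 : Type*} [Field 𝕜] [Algebra Qq 𝕜] {W : Type*} [AddCommGroup W] [Module 𝕜 W]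
  (X : HeisRep n M κ 𝕜 W)

/-- `h_{i,k}` has the opposite sign to the exponent, so it fails to commute only with the term of
degree |k|; as εk = -|k|, the index drops by |k|. -/
theorem zCoeff_halfExp_commutator (i j : Fin (n + 1)) (k : NZ) {ε : ℤˣ} (hk : 0 < -((ε : ℤ) * k.1))
    (c : ℕ → 𝕜) (a : ℤ) :
    X.h i k * zCoeff (halfExp c ε (X.h j)) a - zCoeff (halfExp c ε (X.h j)) a * X.h i k =
      (c k.1.natAbs * algebraMap Qq 𝕜 (structConst n M κ i j k.1 * qInt k.1)) •
        zCoeff (halfExp c ε (X.h j)) (a + (ε : ℤ) * k.1) := by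
  have := charZero_of_algebra 𝕜
  let _ : Module ℚ (Module.End 𝕜 W) := Module.compHom _ (algebraMap ℚ 𝕜)
  have hk' : ((k.1.natAbs : ℕ) : ℤ) = -((ε : ℤ) * k.1) := by
    rcases Int.units_eq_one_or ε with rfl | rfl
    · simp only [Units.val_one] at hk ⊢; omega
    · simp only [Units.val_one, Units.val_neg] at hk ⊢; omega
  rw [(isExp_halfExp (X.commute_of_sign j j) c).zCoeff_commutator (k := k.1.natAbs)
    (μ := algebraMap 𝕜 _ (c k.1.natAbs * algebraMap Qq 𝕜 (structConst n M κ i j k.1 * qInt k.1)))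
    (by have := k.2; omega) (fun a => Algebra.commutes _ _) (fun l hl => ?_) a, hk',
    sub_neg_eq_add, ← Algebra.smul_def]
  rw [coeff_halfSum _ _ _ hl, mul_smul_comm, smul_mul_assoc, ← smul_sub, X.comm]
  have e : k.1 + (ε : ℤ) * (l : ℤ) = 0 ↔ l = k.1.natAbs := by
    rw [← Int.natCast_inj, hk']
    rcases Int.units_eq_one_or ε with rfl | rfl
    · simp only [Units.val_one]; omega
    · simp only [Units.val_one, Units.val_neg]; omega
  by_cases h : l = k.1.natAbs
  · rw [if_pos (e.mpr h), if_pos h, h, map_mul (algebraMap 𝕜 (Module.End 𝕜 W)), Algebra.smul_def]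
  · rw [if_neg (e.not.mpr h), if_neg h, smul_zero]

theorem commute_h_halfExp (i j : Fin (n + 1)) (k : NZ) {ε : ℤˣ} (hk : 0 < (ε : ℤ) * k.1)
    (c : ℕ → 𝕜) (a : ℤ) : Commute (X.h i k) (zCoeff (halfExp c ε (X.h j)) a) := by
  unfold zCoeff
  split_ifs
  · exact commute_halfExp (fun l hl => X.commute_of_sign i j k l hk hl) c _
  · exact Commute.zero_right _

/-- For k < 0 only the annihilation part contributes and for k > 0 only the creation part. The [k]
in the Heisenberg commutator cancels the 1/[k] in the exponents. -/
theorem h_mode {s : 𝕜} (i j : Fin (n + 1)) (ε : ℤˣ) (k : NZ) (m : ℤ) :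
    X.h i k * (X.vertexModes s j ε).mode m - (X.vertexModes s j ε).mode m * X.h i k =
      (((ε : ℤ) : 𝕜) * (algebraMap Qq 𝕜 (structConst n M κ i j k.1) * s ^ (-((ε : ℤ) * |k.1|)))) •
        (X.vertexModes s j ε).mode (m - k.1) := by
  have hq : algebraMap Qq 𝕜 (qInt k.1) ≠ 0 := (map_ne_zero _).mpr (qInt_ne_zero k.2)
  rcases lt_or_gt_of_ne k.2 with hk | hk
  · have e : (k.1.natAbs : ℤ) = -k.1 := by omega
    rw [(X.vertexModes s j ε).mode_commutator (T := X.h i k) (k := k.1) (μ := 0)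
      (fun a => ?_) (fun b => ?_), add_sub_cancel_left, zero_add]
    · rw [zero_smul, add_zero]
      exact (X.commute_h_halfExp i j k (by simp; omega) _ a).eq
    · rw [← sub_eq_iff_eq_add']
      refine (X.zCoeff_halfExp_commutator i j k (ε := 1) (by simp; omega) _ b).trans ?_
      rw [Units.val_one, one_mul]
      refine congrArg (· • _) ?_
      simp only [vertexCoeff, e, qInt_neg, map_mul, map_neg, abs_of_neg hk]
      field_simp
  · have e : (k.1.natAbs : ℤ) = k.1 := by omega
    rw [(X.vertexModes s j ε).mode_commutator (T := X.h i k) (k := k.1) (ν := 0)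
      (fun a => ?_) (fun b => ?_), add_sub_cancel_left, add_zero]
    · rw [← sub_eq_iff_eq_add']
      refine (X.zCoeff_halfExp_commutator i j k (ε := -1) (by simp; omega) _ a).trans ?_
      rw [Units.val_neg, Units.val_one, neg_one_mul, ← sub_eq_add_neg]
      refine congrArg (· • _) ?_
      simp only [vertexCoeff, e, map_mul, abs_of_pos hk]
      field_simp
    · rw [zero_smul, add_zero]
      exact (X.commute_h_halfExp i j k (by simp; omega) _ b).eq

theorem D_mode {s : 𝕜} (ε η : ℤˣ) (i : Fin (n + 1)) (m : ℤ) :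
    X.D ε * (X.vertexModes s i η).mode m =
      algebraMap Qq 𝕜 q ^ (-((ε : ℤ) * m)) • ((X.vertexModes s i η).mode m * X.D ε) := by
  have h := (X.vertexModes s i η).mode_scaling (T := X.D ε) (x := algebraMap Qq 𝕜 q ^ (-(ε : ℤ)))
    (zpow_ne_zero _ algebraMap_q_ne_zero) (fun a => ?_) (fun b => ?_) m
  · rw [h, ← zpow_mul, neg_mul]
  · refine (X.D_halfExp ε _ (-1) i a).trans ?_
    rw [← zpow_mul]
    congr 2
    simp
  · refine (X.D_halfExp ε _ 1 i b).trans ?_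
    rw [← zpow_mul]
    congr 2
    simp

theorem finsum_zpow_smul_halfExp (c c' : ℕ → 𝕜) (ε : ℤˣ) (i : Fin (n + 1)) (u : 𝕜) (N : ℤ) :
    ∑ᶠ a : ℤ, u ^ a • (zCoeff (halfExp c ε (X.h i)) a * zCoeff (halfExp c' ε (X.h i)) (N - a)) =
      zCoeff (halfExp (fun k => u ^ k * c k + c' k) ε (X.h i)) N := by
  have := charZero_of_algebra 𝕜
  rw [← halfExp_add (X.commute_of_sign i i), zCoeff_mul_eq_finsum]
  refine finsum_congr fun a => ?_
  rw [← smul_mul_assoc]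
  congr 1
  unfold zCoeff
  split_ifs with h
  · lift a to ℕ using h
    rw [Int.toNat_natCast, coeff_halfExp_scale (X.commute_of_sign i i), zpow_natCast]
  · rw [smul_zero]

theorem zCoeff_halfExp_congr {c c' : ℕ → 𝕜} (h : ∀ k, k ≠ 0 → c k = c' k) (ε : ℤˣ)
    (i : Fin (n + 1)) : halfExp c ε (X.h i) = halfExp c' ε (X.h i) := by
  unfold halfExp
  congr 2
  ext k
  split_ifs with hk
  · rfl
  · rw [h k hk]

theorem zCoeff_halfExp_scale (c : ℕ → 𝕜) (ε : ℤˣ) (i : Fin (n + 1)) (u : 𝕜) (N : ℤ) :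
    zCoeff (halfExp (fun k => u ^ k * c k) ε (X.h i)) N =
      u ^ N • zCoeff (halfExp c ε (X.h i)) N := by
  have := charZero_of_algebra 𝕜
  unfold zCoeff
  split_ifs with h
  · lift N to ℕ using h
    rw [Int.toNat_natCast, coeff_halfExp_scale (X.commute_of_sign i i), zpow_natCast]
  · rw [smul_zero]

theorem zCoeff_halfExp_zero (ε : ℤˣ) (i : Fin (n + 1)) (N : ℤ) :
    zCoeff (halfExp (fun _ => (0 : 𝕜)) ε (X.h i)) N = if N = 0 then 1 else 0 := by
  unfold zCoeff
  rw [coeff_halfExp_zero _ (fun _ _ => rfl)]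
  split_ifs <;> first | rfl | omega

/-- `exp (ε (q - q⁻¹) ∑_{k ≥ 1} h_{i,εk} z^{-εk})`. -/
def cartanSeries (i : Fin (n + 1)) (ε : ℤˣ) : PowerSeries (Module.End 𝕜 W) :=
  halfExp (fun _ => ((ε : ℤ) : 𝕜) * algebraMap Qq 𝕜 (q - q⁻¹)) ε (X.h i)

/-! ### Relations between modes, as identities of kernels. -/

section Relations

variable {s : 𝕜} (hs : s ^ 2 = algebraMap Qq 𝕜 q)

theorem vertexCoeff_one (k : ℕ) :
    vertexCoeff s 1 k = (algebraMap Qq 𝕜 (qInt k))⁻¹ * (s ^ k)⁻¹ := by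
  simp [vertexCoeff]

theorem vertexCoeff_neg_one (k : ℕ) :
    vertexCoeff s (-1) k = -((algebraMap Qq 𝕜 (qInt k))⁻¹ * s ^ k) := by
  simp [vertexCoeff]

include hs in
theorem algebraMap_q_sub_inv {k : ℕ} (hk : k ≠ 0) : algebraMap Qq 𝕜 (q - q⁻¹) =
    (algebraMap Qq 𝕜 (qInt k))⁻¹ * ((s ^ k) ^ 2 - ((s ^ k)⁻¹) ^ 2) := by
  have h1 := algebraMap_qInt_ne_zero (𝕜 := 𝕜) hk
  have e : algebraMap Qq 𝕜 (qInt k) * algebraMap Qq 𝕜 (q - q⁻¹) = (s ^ 2) ^ k - ((s ^ 2)⁻¹) ^ k := by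
    rw [← map_mul, qInt, div_mul_cancel₀ _ q_sub_inv_ne_zero, hs]
    simp [zpow_neg]
  rw [eq_inv_mul_iff_mul_eq₀ h1, e, ← inv_pow, ← inv_pow, pow_right_comm, pow_right_comm s⁻¹]

include hs in
-- At z = qw the creation exponents cancel, because q^k q^{-k/2} = q^{k/2}, while the annihilation
-- exponents add up to (q - q⁻¹)s^{-k}: the series K⁺ with rescaled argument.
theorem kernel_q (i : Fin (n + 1)) (v : W) (N : ℤ) :
    Modes.kernel₂ (X.vertexModes s i 1) (X.vertexModes s i (-1)) v N
      (fun c => algebraMap Qq 𝕜 q ^ c) = s ^ N • zCoeff (X.cartanSeries i 1) (-N) v := by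
  have s0 := s_ne_zero hs
  rw [Modes.kernel₂_zpow algebraMap_q_ne_zero (P := fun N => if N = 0 then 1 else 0)
    (S := fun N => s⁻¹ ^ N • zCoeff (X.cartanSeries i 1) N) (fun N => ?_) (fun N => ?_),
    finsum_eq_single _ (-N)]
  · simp
  · intro x hx
    rw [if_neg (by omega)]; rfl
  · refine ((X.finsum_zpow_smul_halfExp _ _ _ i _ N).trans ?_).symm
    rw [X.zCoeff_halfExp_congr (c' := fun _ => 0) (fun k hk => ?_), X.zCoeff_halfExp_zero]
    rw [vertexCoeff_one, vertexCoeff_neg_one, ← hs, pow_right_comm]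
    field_simp
    ring
  · simp only [zpow_neg, ← inv_zpow]
    refine (Eq.trans (X.finsum_zpow_smul_halfExp _ _ _ i _ N) ?_).symm
    rw [cartanSeries, ← X.zCoeff_halfExp_scale]
    refine congrArg (zCoeff · N) (X.zCoeff_halfExp_congr (fun k hk => ?_) _ _)
    rw [vertexCoeff_one, vertexCoeff_neg_one, algebraMap_q_sub_inv hs hk, ← hs, inv_pow, inv_pow,
      pow_right_comm, Units.val_one, Int.cast_one]
    field_simp
    ring

include hs in
-- Here the annihilation exponents cancel, and the creation exponents add up to -(q - q⁻¹)s^{-k},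
-- giving K⁻.
theorem kernel_q_inv (i : Fin (n + 1)) (v : W) (N : ℤ) :
    Modes.kernel₂ (X.vertexModes s i 1) (X.vertexModes s i (-1)) v N
      (fun c => (algebraMap Qq 𝕜 q)⁻¹ ^ c) = s ^ (-N) • zCoeff (X.cartanSeries i (-1)) N v := by
  have s0 := s_ne_zero hs
  rw [Modes.kernel₂_zpow (inv_ne_zero algebraMap_q_ne_zero)
    (P := fun N => s⁻¹ ^ N • zCoeff (X.cartanSeries i (-1)) N)
    (S := fun N => if N = 0 then 1 else 0) (fun N => ?_) (fun N => ?_), finsum_eq_single _ 0]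
  · simp
  · intro x hx
    rw [if_neg hx]; simp
  · refine (Eq.trans (X.finsum_zpow_smul_halfExp _ _ _ i _ N) ?_).symm
    rw [cartanSeries, ← X.zCoeff_halfExp_scale]
    refine congrArg (zCoeff · N) (X.zCoeff_halfExp_congr (fun k hk => ?_) _ _)
    rw [vertexCoeff_one, vertexCoeff_neg_one, algebraMap_q_sub_inv hs hk, ← hs, inv_pow, inv_pow,
      pow_right_comm, Units.val_neg, Units.val_one, Int.cast_neg, Int.cast_one]
    field_simp
    ring
  · simp only [zpow_neg, inv_zpow, inv_inv]
    refine ((X.finsum_zpow_smul_halfExp _ _ _ i _ N).trans ?_).symm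
    rw [X.zCoeff_halfExp_congr (c' := fun _ => 0) (fun k hk => ?_), X.zCoeff_halfExp_zero]
    rw [vertexCoeff_one, vertexCoeff_neg_one, ← hs, pow_right_comm]
    field_simp
    ring

include hs in
-- The two orders expand one rational function in opposite directions. Multiplied by q - q⁻¹, the
-- two halves glue to q^{c-m-1} - q^{m+1-c} on all of ℤ, a difference of two delta functions.
theorem mode_opp_self (hn : 1 < n) (hM : M.transpose = -M) (i : Fin (n + 1)) (m l N : ℤ)
    (hN : N = m + l + 2) (v : W) :
    algebraMap Qq 𝕜 (q - q⁻¹) • ((X.vertexModes s i 1).mode (m + 2)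
        ((X.vertexModes s i (-1)).mode l v) -
      (X.vertexModes s i (-1)).mode (l + 2) ((X.vertexModes s i 1).mode m v)) =
    algebraMap Qq 𝕜 q ^ (-m - 1) • s ^ N • zCoeff (X.cartanSeries i 1) (-N) v -
      algebraMap Qq 𝕜 q ^ (m + 1) • s ^ (-N) • zCoeff (X.cartanSeries i (-1)) N v := by
  have q0 := algebraMap_q_ne_zero (𝕜 := 𝕜)
  have ha := cartan_self hn i
  have hm := skew_self hM i
  have h1 := X.contracts_opp_two hs ha hm 1
  have h2 := X.contracts_opp_two hs ha hm (-1)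
  rw [neg_neg] at h2
  rw [h1.mode_mode_eq_kernel, h2.mode_mode_eq_kernel_symm (fun a b => X.commute_pos s i i _ _ a b)
    (fun a b => X.commute_neg s i i _ _ a b), show m + 2 + l = N by omega,
    show m + (l + 2) = N by omega, ← X.kernel_q hs, ← X.kernel_q_inv hs, ← map_sub, ← map_smul,
    ← map_smul, ← map_smul, ← map_sub]
  refine congrArg _ (funext fun c => ?_)
  simp only [Pi.smul_apply, Pi.sub_apply, smul_eq_mul]
  have hQ : algebraMap Qq 𝕜 (q - q⁻¹) = algebraMap Qq 𝕜 q - (algebraMap Qq 𝕜 q)⁻¹ := by simp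
  rw [mul_sub, hQ, zCoeff_geom_mul_geom, zCoeff_geom_mul_geom, inv_zpow', ← zpow_add₀ q0,
    ← zpow_add₀ q0]
  -- The first product contributes for c > m + 1 and the second for c < m + 1; at c = m + 1 neither
  -- does, and the glued kernel is zero as well.
  rcases lt_trichotomy c (m + 1) with h | rfl | h
  · rw [if_neg (by omega), if_pos (by omega), zero_sub, neg_sub]
    congr 2 <;> ring
  · rw [if_neg (by omega), if_neg (by omega), sub_self, eq_comm, sub_eq_zero]
    congr 1; ring
  · rw [if_pos (by omega), if_neg (by omega), sub_zero]
    congr 2 <;> ring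

variable {t : 𝕜} (ht : t ^ 2 = algebraMap Qq 𝕜 κ) (hκ : κ ≠ 0)

include ht hκ in
theorem t_ne_zero : t ≠ 0 := by
  rintro rfl
  exact (map_ne_zero (algebraMap Qq 𝕜)).mpr hκ (by rw [← ht]; simp)

theorem mode_comm_of_zero {i j : Fin (n + 1)} (ha : cartan n i j = 0) (ε η : ℤˣ) (m l : ℤ)
    (v : W) :
    (X.vertexModes s i ε).mode m ((X.vertexModes s j η).mode l v) =
      (X.vertexModes s j η).mode l ((X.vertexModes s i ε).mode m v) := by
  have h1 := X.contracts_of_zero (s := s) ha ε η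
  have h2 := X.contracts_of_zero (s := s) (cartan_symm i j ▸ ha) η ε
  rw [h1.mode_mode_eq_kernel, h2.mode_mode_eq_kernel_symm (fun a b => X.commute_pos s i j _ _ a b)
    (fun a b => X.commute_neg s i j _ _ a b)]
  refine congrArg _ (funext fun c => ?_)
  simp only [zCoeff_one]
  exact if_congr (by omega) rfl rfl

include hs ht hκ in
-- Fock-space part of the exchange relation: the shifts by `cartan n i j`, the signs and the powers
-- of `t` are those left by the lattice factor after factoring out a common scalar and tensor.
theorem mode_exchange (hn : 1 < n) (hM : M.transpose = -M) (i j : Fin (n + 1)) (ε : ℤˣ) (m l : ℤ)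
    (v : W) :
    (algebraMap Qq 𝕜 κ ^ M i j * t ^ (cartan n i j * M i j)) •
        (X.vertexModes s i ε).mode (m - 1 - cartan n i j) ((X.vertexModes s j ε).mode l v) -
      (algebraMap Qq 𝕜 q ^ ((ε : ℤ) * cartan n i j) * algebraMap Qq 𝕜 κ ^ M i j *
        (-1) ^ cartan n i j * t ^ (-(cartan n i j * M i j))) •
        (X.vertexModes s j ε).mode (l - cartan n i j) ((X.vertexModes s i ε).mode (m - 1) v) =
    (algebraMap Qq 𝕜 q ^ ((ε : ℤ) * cartan n i j) * t ^ (cartan n i j * M i j)) •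
        (X.vertexModes s i ε).mode (m - cartan n i j) ((X.vertexModes s j ε).mode (l - 1) v) -
      ((-1) ^ cartan n i j * t ^ (-(cartan n i j * M i j))) •
        (X.vertexModes s j ε).mode (l - 1 - cartan n i j) ((X.vertexModes s i ε).mode m v) := by
  have q0 := algebraMap_q_ne_zero (𝕜 := 𝕜)
  have t0 := t_ne_zero ht hκ
  have hp := fun a b => X.commute_pos s i j ε ε a b
  have hng := fun a b => X.commute_neg s i j ε ε a b
  have hk : algebraMap Qq 𝕜 κ ^ M i j = (t ^ M i j) ^ 2 := by
    rw [← ht, ← zpow_natCast, ← zpow_natCast, ← zpow_mul, ← zpow_mul, mul_comm]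
  by_cases hij : i = j
  · subst hij
    have ha := cartan_self hn i
    have hm := skew_self hM i
    have h := X.contracts_same_two hs ha hm ε
    obtain ⟨⟨e0, e1, e2⟩, e3⟩ := zCoeff_lin_mul_lin ((algebraMap Qq 𝕜 q ^ (ε : ℤ))⁻¹ ^ 2)
    refine Modes.mode_exchange h h hp hng (by ring) (by ring) (by ring) (fun c => ?_) v
    generalize hg : zCoeff (linSeries 1 * linSeries ((algebraMap Qq 𝕜 q ^ (ε : ℤ))⁻¹ ^ 2)) = f at *
    have hQ : algebraMap Qq 𝕜 q ^ ((ε : ℤ) * 2) = (algebraMap Qq 𝕜 q ^ (ε : ℤ)) ^ 2 := by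
      rw [zpow_mul]; exact zpow_ofNat _ 2
    have hP := zpow_ne_zero (ε : ℤ) q0
    rw [ha, hm, hQ]
    generalize algebraMap Qq 𝕜 q ^ (ε : ℤ) = P at *
    obtain ⟨x, rfl⟩ : ∃ x, c = m + x := ⟨c - m, by ring⟩
    rw [show m + x - (m - 1 - 2) = x + 3 by ring, show m - 1 - (m + x) = -x - 1 by ring,
      show m + x - (m - 2) = x + 2 by ring, show m - (m + x) = -x by ring]
    -- The contraction is a polynomial of degree 2, so the four kernels vanish outside -3 ≤ x ≤ 0.
    rcases lt_or_ge x (-3) with hx | hx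
    · rw [e3 _ (by omega), e3 _ (by omega), e3 _ (by omega), e3 _ (by omega)]; simp
    rcases lt_or_ge 0 x with hx' | hx'
    · rw [e3 _ (by omega), e3 _ (by omega), e3 _ (by omega), e3 _ (by omega)]; simp
    obtain rfl | rfl | rfl | rfl : x = -3 ∨ x = -2 ∨ x = -1 ∨ x = 0 := by omega
    · norm_num [e0, e1, e2, e3 3, e3 (-1)]
      field_simp
      ring
    · norm_num [e0, e1, e2, e3 3, e3 (-1)]
      field_simp
      ring
    · norm_num [e0, e1, e2, e3 3, e3 (-1)]
      field_simp
      ring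
    · norm_num [e0, e1, e2, e3 3, e3 (-1)]
      field_simp
      ring
  · rcases cartan_of_ne hn hij with ha | ha
    · refine Modes.mode_exchange (X.contracts_of_zero ha ε ε)
        (X.contracts_of_zero (cartan_symm i j ▸ ha) ε ε) hp hng (by rw [ha]; ring)
        (by rw [ha]; ring) (by rw [ha]; ring) (fun c => ?_) v
      simp only [ha, zCoeff_one]
      by_cases h1 : c = m
      · subst h1; simp
      by_cases h2 : c = m - 1
      · subst h2; simp
      rw [if_neg (by omega), if_neg (by omega), if_neg (by omega), if_neg (by omega)]
      simp
    · have ha' := cartan_symm i j ▸ ha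
      refine Modes.mode_exchange (X.contracts_same_neg_one hs ha ε)
        (X.contracts_same_neg_one hs ha' ε) hp hng (by rw [ha]; ring)
        (by rw [ha]; ring) (by rw [ha]; ring) (fun c => ?_) v
      obtain ⟨x, rfl⟩ : ∃ x, c = m + x := ⟨c - m, by ring⟩
      rw [ha, hk, skew_apply hM i j, neg_neg, zpow_neg, hk]
      rw [show m + x - (m - 1 - -1) = x by ring, show m - 1 - (m + x) = -x - 1 by ring,
        show m + x - (m - -1) = x - 1 by ring, show m - (m + x) = -x by ring]
      -- After one step of each recursion the identity holds with the remaining series values and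
      -- the delta term treated as independent.
      rw [zCoeff_geomSeries _ x, zCoeff_geomSeries _ (-x)]
      simp only [neg_eq_zero, mul_neg_one, neg_mul, one_mul, neg_neg, zpow_neg, zpow_one, hk]
      have hT := zpow_ne_zero (M i j) t0
      have hP := zpow_ne_zero (ε : ℤ) q0
      generalize t ^ M i j = T at *
      generalize algebraMap Qq 𝕜 q ^ (ε : ℤ) = P at *
      generalize zCoeff (A := 𝕜) _ (x - 1) = a, zCoeff (A := 𝕜) _ (-x - 1) = b, (if x = 0 then (1 : 𝕜) else 0) = d
      field_simp
      ring

include hs ht hκ in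
-- For neighbours the contractions 1 - κ^{-m_ij}u and 1 - κ^{m_ij}u⁻¹ are Laurent polynomials
-- proportional up to a monomial, so no delta function arises.
theorem mode_opp_of_ne (hn : 1 < n) (hM : M.transpose = -M) {i j : Fin (n + 1)} (hij : i ≠ j)
    (ε : ℤˣ) (m l : ℤ) (v : W) :
    t ^ (-(cartan n i j * M i j)) •
        (X.vertexModes s i ε).mode (m + cartan n i j) ((X.vertexModes s j (-ε)).mode l v) =
      ((-1) ^ cartan n i j * t ^ (cartan n i j * M i j)) •
        (X.vertexModes s j (-ε)).mode (l + cartan n i j) ((X.vertexModes s i ε).mode m v) := by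
  have t0 := t_ne_zero ht hκ
  have hp := fun a b => X.commute_pos s i j ε (-ε) a b
  have hng := fun a b => X.commute_neg s i j ε (-ε) a b
  have hk : algebraMap Qq 𝕜 κ ^ M i j = (t ^ M i j) ^ 2 := by
    rw [← ht, ← zpow_natCast, ← zpow_natCast, ← zpow_mul, ← zpow_mul, mul_comm]
  rcases cartan_of_ne hn hij with ha | ha
  · rw [X.mode_comm_of_zero ha, ha]
    simp
  · have h1 := X.contracts_opp_neg_one hs ha ε
    have h2 := X.contracts_opp_neg_one hs (cartan_symm i j ▸ ha) (-ε)
    rw [neg_neg] at h2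
    rw [h1.mode_mode_eq_kernel, h2.mode_mode_eq_kernel_symm hp hng, ← map_smul, ← map_smul,
      show m + cartan n i j + l = m + (l + cartan n i j) by ring]
    refine congrArg _ (funext fun c => ?_)
    obtain ⟨x, rfl⟩ : ∃ x, c = m + x := ⟨c - m, by ring⟩
    simp only [Pi.smul_apply, ha, smul_eq_mul]
    rw [show m + x - (m + -1) = x + 1 by ring, show m - (m + x) = -x by ring,
      skew_apply hM i j, neg_neg, zpow_neg (algebraMap Qq 𝕜 κ), hk, zCoeff_linSeries,
      zCoeff_linSeries]
    have e1 : (-x = 1) = (x + 1 = 0) := by rw [eq_iff_iff]; omega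
    simp only [e1, neg_eq_zero, add_eq_right, neg_mul, one_mul, neg_neg, zpow_neg, zpow_one]
    have hT := zpow_ne_zero (M i j) t0
    generalize t ^ M i j = T at *
    generalize (if x = 0 then (1 : 𝕜) else 0) = d, (if x + 1 = 0 then (1 : 𝕜) else 0) = e
    field_simp
    ring

end Relations

end HeisRep

/-! ### Vertex operators on the tensor product with the twisted group algebra -/

section Tensor

variable {n : ℕ} {𝕜 : Type*} [Field 𝕜] {W : Type*} [AddCommGroup W] [Module 𝕜 W]

theorem ext_hasWeight {P : Type*} [AddCommGroup P] [Module 𝕜 P]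
    {f g : W ⊗[𝕜] TwistAlg n 𝕜 →ₗ[𝕜] P}
    (h : ∀ v x β, HasWeight x β → f (v ⊗ₜ[𝕜] x) = g (v ⊗ₜ[𝕜] x)) : f = g :=
  ext_expLattice fun v β => h v _ β (hasWeight_expLattice β)

theorem tmul_expRoot_comm (i j : Fin (n + 1)) (ε η : ℤˣ) (w : W) (x : TwistAlg n 𝕜) :
    w ⊗ₜ[𝕜] (expRoot n 𝕜 i ε * (expRoot n 𝕜 j η * x)) =
      (-1 : 𝕜) ^ cartan n i j • w ⊗ₜ[𝕜] (expRoot n 𝕜 j η * (expRoot n 𝕜 i ε * x)) := by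
  rw [← mul_assoc, expRoot_comm, ← mul_assoc]
  generalize expRoot n 𝕜 j η * expRoot n 𝕜 i ε = y
  have : ((-1 : 𝕜) ^ cartan n i j • y) * x = (-1 : 𝕜) ^ cartan n i j • (y * x) :=
    Algebra.smul_mul_assoc _ _ _
  rw [this]
  exact TensorProduct.tmul_smul _ _ _

theorem expRoot_anticomm {i j : Fin (n + 1)} (ha : cartan n i j = -1) (ε : ℤˣ) (x : TwistAlg n 𝕜) :
    expRoot n 𝕜 i ε * (expRoot n 𝕜 j ε * x) = -(expRoot n 𝕜 j ε * (expRoot n 𝕜 i ε * x)) := by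
  rw [← mul_assoc, expRoot_comm, ha, zpow_neg_one, inv_neg_one, ← mul_assoc]
  generalize expRoot n 𝕜 j ε * expRoot n 𝕜 i ε = y
  have : (-1 : 𝕜) • y = -y := neg_one_smul 𝕜 y
  rw [this]
  exact neg_mul y x

theorem mul_mul_mul_of_anticomm {A : Type*} [Ring A] {a b : A} (h : ∀ x, b * (a * x) = -(a * (b * x)))
    (x : A) : b * (a * (a * x)) = a * (a * (b * x)) := by
  rw [h, h, mul_neg, neg_neg]

theorem tmul_mul_of_eq_neg {y z : TwistAlg n 𝕜} (h : y = -z) (a : TwistAlg n 𝕜) (w : W) :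
    w ⊗ₜ[𝕜] (a * y) = -(w ⊗ₜ[𝕜] (a * z)) := by
  have e : a * y = -(a * z) := by
    rw [h]
    exact mul_neg a z
  rw [e]
  exact TensorProduct.tmul_neg _ _

end Tensor

namespace HeisRep

variable {n : ℕ} {M : Matrix (Fin (n + 1)) (Fin (n + 1)) ℤ} {κ : Qq}
  {𝕜 : Type*} [Field 𝕜] [Algebra Qq 𝕜] {W : Type*} [AddCommGroup W] [Module 𝕜 W]
  (X : HeisRep n M κ 𝕜 W) (s t : 𝕜) (p : Fin (n + 1))

/-- The mode of degree `k` of the vertex operator `E_i(z)` (for `ε = 1`) or `F_i(z)`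
(for `ε = -1`). -/
def vertexOp (i : Fin (n + 1)) (ε : ℤˣ) (k : ℤ) : Module.End 𝕜 (W ⊗[𝕜] TwistAlg n 𝕜) :=
  LinearMap.lTensor W (LinearMap.mulLeft 𝕜 (expRoot n 𝕜 i ε)) ∘ₗ
    weightwise fun β => t ^ ((ε : ℤ) * twist n M i β) •
      (X.vertexModes s i ε).mode (-k - (ε : ℤ) * pairing n p i β - 1)

/-- The operator that multiplies vectors of weight `β` by `q^{ε f(β)}`. -/
def diagOp (W : Type*) [AddCommGroup W] [Module 𝕜 W] (f : (Fin (n + 1) → ℤ) → ℤ) (ε : ℤˣ) :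
    Module.End 𝕜 (W ⊗[𝕜] TwistAlg n 𝕜) :=
  weightwise fun β => algebraMap Qq 𝕜 q ^ ((ε : ℤ) * f β) • 1

/-- The operator `q^{ε d₁}`. -/
def dOneOp (ε : ℤˣ) : Module.End 𝕜 (W ⊗[𝕜] TwistAlg n 𝕜) :=
  weightwise fun β => algebraMap Qq 𝕜 q ^ ((ε : ℤ) * (-(normSq n β / 2) - β p)) • X.D ε

/-- The operator `H_{i,l}`. -/
def heisOp (i : Fin (n + 1)) (l : NZ) : Module.End 𝕜 (W ⊗[𝕜] TwistAlg n 𝕜) :=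
  LinearMap.rTensor (TwistAlg n 𝕜) (X.h i l)

variable {β : Fin (n + 1) → ℤ} {x : TwistAlg n 𝕜} (hx : HasWeight x β) (v : W)

section Action

include hx

theorem vertexOp_tmul (i : Fin (n + 1)) (ε : ℤˣ) (k : ℤ) :
    X.vertexOp s t p i ε k (v ⊗ₜ[𝕜] x) = t ^ ((ε : ℤ) * twist n M i β) •
      (X.vertexModes s i ε).mode (-k - (ε : ℤ) * pairing n p i β - 1) v ⊗ₜ[𝕜]
        (expRoot n 𝕜 i ε * x) := by
  unfold vertexOp
  rw [LinearMap.comp_apply, weightwise_tmul _ _ hx, LinearMap.lTensor_tmul,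
    LinearMap.mulLeft_apply, LinearMap.smul_apply, TensorProduct.smul_tmul']

theorem diagOp_tmul (f : (Fin (n + 1) → ℤ) → ℤ) (ε : ℤˣ) :
    diagOp W f ε (v ⊗ₜ[𝕜] x) = algebraMap Qq 𝕜 q ^ ((ε : ℤ) * f β) • v ⊗ₜ[𝕜] x := by
  unfold diagOp
  rw [weightwise_tmul _ _ hx, LinearMap.smul_apply, Module.End.one_apply, TensorProduct.smul_tmul']

theorem dOneOp_tmul (ε : ℤˣ) :
    X.dOneOp p ε (v ⊗ₜ[𝕜] x) =
      algebraMap Qq 𝕜 q ^ ((ε : ℤ) * (-(normSq n β / 2) - β p)) • X.D ε v ⊗ₜ[𝕜] x := by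
  unfold dOneOp
  rw [weightwise_tmul _ _ hx, LinearMap.smul_apply, TensorProduct.smul_tmul']

/-- The inner operator raises the weight by ηα_j before `z^{H_{i,0}}` of the outer one acts; this is
the source of the index shift and of the extra power of `t`. -/
theorem vertexOp_vertexOp_tmul (ht0 : t ≠ 0) (i j : Fin (n + 1)) (ε η : ℤˣ) (k l : ℤ) :
    X.vertexOp s t p i ε k (X.vertexOp s t p j η l (v ⊗ₜ[𝕜] x)) =
      (t ^ ((ε : ℤ) * twist n M i β + (η : ℤ) * twist n M j β) *
        t ^ ((ε : ℤ) * η * (cartan n i j * M i j))) •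
      (X.vertexModes s i ε).mode
        (-k - (ε : ℤ) * pairing n p i β - 1 - (ε : ℤ) * η * cartan n i j)
        ((X.vertexModes s j η).mode (-l - (η : ℤ) * pairing n p j β - 1) v) ⊗ₜ[𝕜]
        (expRoot n 𝕜 i ε * (expRoot n 𝕜 j η * x)) := by
  rw [X.vertexOp_tmul s t p hx, map_smul, X.vertexOp_tmul s t p (hx.expRoot_mul j η), smul_smul,
    twist_add_single, pairing_add_single, ← zpow_add₀ ht0 (_ + _), ← zpow_add₀ ht0]
  congr 2
  · ring
  · congr 2; ring

end Action

theorem heisOp_tmul (i : Fin (n + 1)) (l : NZ) (x : TwistAlg n 𝕜) :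
    X.heisOp i l (v ⊗ₜ[𝕜] x) = X.h i l v ⊗ₜ[𝕜] x := LinearMap.rTensor_tmul _ _ _ _

/-! ### Relations of the toroidal algebra on the tensor product. -/

section Relations

variable {s t}

theorem diagOp_mul_neg (f : (Fin (n + 1) → ℤ) → ℤ) (ε : ℤˣ) :
    diagOp (𝕜 := 𝕜) W f ε * diagOp W f (-ε) = 1 := by
  refine ext_hasWeight fun v x β hx => ?_
  rw [Module.End.mul_apply, diagOp_tmul hx, map_smul, diagOp_tmul hx, smul_smul,
    ← zpow_add₀ algebraMap_q_ne_zero, Units.val_neg, neg_mul, neg_add_cancel, zpow_zero, one_smul]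
  rfl

theorem diagOp_comm (f f' : (Fin (n + 1) → ℤ) → ℤ) (ε η : ℤˣ) :
    diagOp (𝕜 := 𝕜) W f ε * diagOp W f' η = diagOp W f' η * diagOp W f ε := by
  refine ext_hasWeight fun v x β hx => ?_
  simp only [Module.End.mul_apply, diagOp_tmul hx, map_smul]
  rw [smul_comm]

theorem diagOp_heisOp (f : (Fin (n + 1) → ℤ) → ℤ) (ε : ℤˣ) (j : Fin (n + 1)) (l : NZ) :
    diagOp W f ε * X.heisOp j l = X.heisOp j l * diagOp W f ε := by
  refine ext_hasWeight fun v x β hx => ?_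
  simp only [Module.End.mul_apply, diagOp_tmul hx, map_smul, heisOp_tmul]

theorem dOneOp_mul_neg (ε : ℤˣ) : X.dOneOp p ε * X.dOneOp p (-ε) = 1 := by
  refine ext_hasWeight fun v x β hx => ?_
  rw [Module.End.mul_apply, X.dOneOp_tmul p hx, map_smul, X.dOneOp_tmul p hx, smul_smul,
    ← zpow_add₀ algebraMap_q_ne_zero, Units.val_neg, neg_mul, neg_add_cancel, zpow_zero, one_smul,
    ← Module.End.mul_apply, X.D_mul]
  rfl

theorem dOneOp_diagOp (f : (Fin (n + 1) → ℤ) → ℤ) (ε η : ℤˣ) :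
    X.dOneOp p ε * diagOp W f η = diagOp W f η * X.dOneOp p ε := by
  refine ext_hasWeight fun v x β hx => ?_
  simp only [Module.End.mul_apply, diagOp_tmul hx, X.dOneOp_tmul p hx, map_smul]
  rw [smul_comm]

theorem dOneOp_heisOp (j : Fin (n + 1)) (l : NZ) :
    X.dOneOp p 1 * X.heisOp j l * X.dOneOp p (-1) = algebraMap Qq 𝕜 q ^ l.1 • X.heisOp j l := by
  have e : X.dOneOp p 1 * X.heisOp j l = algebraMap Qq 𝕜 q ^ l.1 • (X.heisOp j l * X.dOneOp p 1) := by
    refine ext_hasWeight fun v x β hx => ?_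
    have := LinearMap.congr_fun (X.D_h 1 j l) v
    simp only [Module.End.mul_apply, LinearMap.smul_apply, Units.val_one, one_mul] at this
    simp only [Module.End.mul_apply, LinearMap.smul_apply, X.dOneOp_tmul p hx, map_smul,
      heisOp_tmul]
    rw [this, ← TensorProduct.smul_tmul', smul_comm]
  have e1 := X.dOneOp_mul_neg p 1
  rw [e, smul_mul_assoc, mul_assoc, e1, mul_one]

theorem diagOp_vertexOp {f : (Fin (n + 1) → ℤ) → ℤ} {c : ℤ} {j : Fin (n + 1)} {ε : ℤˣ}
    (hf : ∀ β, f (β + Pi.single j (ε : ℤ)) = f β + c) (k : ℤ) :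
    diagOp W f 1 * X.vertexOp s t p j ε k * diagOp W f (-1) =
      algebraMap Qq 𝕜 q ^ c • X.vertexOp s t p j ε k := by
  refine ext_hasWeight fun v x β hx => ?_
  simp only [Module.End.mul_apply, LinearMap.smul_apply, diagOp_tmul hx, map_smul,
    X.vertexOp_tmul s t p hx, diagOp_tmul (hx.expRoot_mul j ε), hf]
  rw [smul_comm (algebraMap Qq 𝕜 q ^ c), smul_comm (algebraMap Qq 𝕜 q ^ (((-1 : ℤˣ) : ℤ) * f β)),
    smul_smul (algebraMap Qq 𝕜 q ^ (((-1 : ℤˣ) : ℤ) * f β)), ← zpow_add₀ algebraMap_q_ne_zero]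
  congr 3
  simp

/-- The mode of degree m = -k - ε⟨h_j, β + Λ_p⟩ - 1 changes the Fock eigenvalue exponent by -m, and
the lattice part changes it by -ε⟨h_j, β + Λ_p⟩ - 1; the total is k. -/
theorem dOneOp_vertexOp (hn : 1 < n) (j : Fin (n + 1)) (ε : ℤˣ) (k : ℤ) :
    X.dOneOp p 1 * X.vertexOp s t p j ε k * X.dOneOp p (-1) =
      algebraMap Qq 𝕜 q ^ k • X.vertexOp s t p j ε k := by
  refine ext_hasWeight fun v x β hx => ?_
  have h1 := fun m => LinearMap.congr_fun (X.D_mode (s := s) 1 ε j m) (X.D (-1) v)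
  have h2 : X.D 1 (X.D (-1) v) = v := LinearMap.congr_fun (X.D_mul 1) v
  simp only [Module.End.mul_apply, LinearMap.smul_apply, h2] at h1
  simp only [Module.End.mul_apply, LinearMap.smul_apply, X.dOneOp_tmul p hx, map_smul,
    X.vertexOp_tmul s t p hx, X.dOneOp_tmul p (hx.expRoot_mul j ε), h1]
  rw [smul_comm (algebraMap Qq 𝕜 q ^ k),
    smul_comm (algebraMap Qq 𝕜 q ^ (((-1 : ℤˣ) : ℤ) * _)), ← TensorProduct.smul_tmul',
    smul_smul (algebraMap Qq 𝕜 q ^ (((-1 : ℤˣ) : ℤ) * _)), smul_smul (_ * _),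
    ← zpow_add₀ algebraMap_q_ne_zero, ← zpow_add₀ algebraMap_q_ne_zero, normSq_add_single hn]
  congr 3
  simp only [Units.val_one, Units.val_neg, Pi.add_apply, pairing, Pi.single_apply]
  have : (if p = j then (ε : ℤ) else 0) = ε * if j = p then 1 else 0 := by
    rw [mul_ite, mul_one, mul_zero]
    exact if_congr eq_comm rfl rfl
  rw [this]
  ring

theorem heisOp_vertexOp (i j : Fin (n + 1)) (ε : ℤˣ) (k : NZ) (l : ℤ) :
    X.heisOp i k * X.vertexOp s t p j ε l - X.vertexOp s t p j ε l * X.heisOp i k =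
      (((ε : ℤ) : 𝕜) * (algebraMap Qq 𝕜 (structConst n M κ i j k.1) * s ^ (-((ε : ℤ) * |k.1|)))) •
        X.vertexOp s t p j ε (k.1 + l) := by
  refine ext_hasWeight fun v x β hx => ?_
  have h1 := fun m => LinearMap.congr_fun (X.h_mode (s := s) i j ε k m) v
  simp only [Module.End.mul_apply, LinearMap.smul_apply, LinearMap.sub_apply] at h1
  simp only [Module.End.mul_apply, LinearMap.smul_apply, LinearMap.sub_apply, map_smul,
    X.vertexOp_tmul s t p hx, heisOp_tmul]
  rw [← smul_sub, ← TensorProduct.sub_tmul, h1, ← TensorProduct.smul_tmul', smul_comm]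
  congr 5
  ring

theorem heisOp_comm (i j : Fin (n + 1)) (k l : NZ) :
    X.heisOp i k * X.heisOp j l - X.heisOp j l * X.heisOp i k =
      if k.1 + l.1 = 0 then algebraMap Qq 𝕜 (structConst n M κ i j k.1 * qInt k.1) • 1 else 0 := by
  unfold heisOp
  rw [← LinearMap.rTensor_mul, ← LinearMap.rTensor_mul, ← LinearMap.rTensor_sub, X.comm]
  split_ifs
  · rw [Algebra.algebraMap_eq_smul_one, LinearMap.rTensor_smul]
    congr 1
    exact LinearMap.rTensor_id _ _
  · exact LinearMap.rTensor_zero _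

/-- The Fourier modes of `K_i^ε(z)`. -/
def cartanMode (i : Fin (n + 1)) (ε : ℤˣ) (k : ℤ) : Module.End 𝕜 (W ⊗[𝕜] TwistAlg n 𝕜) :=
  LinearMap.rTensor (TwistAlg n 𝕜) (zCoeff (X.cartanSeries i ε) ((ε : ℤ) * k)) *
    diagOp W (pairing n p i) ε

theorem cartanMode_tmul (hx : HasWeight x β) (i : Fin (n + 1)) (ε : ℤˣ) (k : ℤ) :
    X.cartanMode p i ε k (v ⊗ₜ[𝕜] x) = algebraMap Qq 𝕜 q ^ ((ε : ℤ) * pairing n p i β) •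
      zCoeff (X.cartanSeries i ε) ((ε : ℤ) * k) v ⊗ₜ[𝕜] x := by
  rw [cartanMode, Module.End.mul_apply, diagOp_tmul hx, map_smul, LinearMap.rTensor_tmul]

variable (hs : s ^ 2 = algebraMap Qq 𝕜 q) (ht : t ^ 2 = algebraMap Qq 𝕜 κ) (hκ : κ ≠ 0)
  (hn : 1 < n) (hM : M.transpose = -M)

include hs ht hκ hn hM

theorem vertexOp_exchange (i j : Fin (n + 1)) (ε : ℤˣ) (k l : ℤ) :
    algebraMap Qq 𝕜 κ ^ M i j • (X.vertexOp s t p i ε (k + 1) * X.vertexOp s t p j ε l) -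
      (algebraMap Qq 𝕜 q ^ ((ε : ℤ) * cartan n i j) * algebraMap Qq 𝕜 κ ^ M i j) •
        (X.vertexOp s t p j ε l * X.vertexOp s t p i ε (k + 1)) =
    algebraMap Qq 𝕜 q ^ ((ε : ℤ) * cartan n i j) •
        (X.vertexOp s t p i ε k * X.vertexOp s t p j ε (l + 1)) -
      X.vertexOp s t p j ε (l + 1) * X.vertexOp s t p i ε k := by
  have t0 := t_ne_zero ht hκ
  refine ext_hasWeight fun v x β hx => ?_
  have hε : (ε : ℤ) * ε = 1 := by rw [← Units.val_mul, Int.units_mul_self]; rfl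
  have key := X.mode_exchange hs ht hκ hn hM i j ε (-k - (ε : ℤ) * pairing n p i β - 1)
    (-l - (ε : ℤ) * pairing n p j β - 1) v
  have key' := congrArg (fun w => t ^ ((ε : ℤ) * twist n M i β + (ε : ℤ) * twist n M j β) •
    w ⊗ₜ[𝕜] (expRoot n 𝕜 i ε * (expRoot n 𝕜 j ε * x))) key
  simp only [TensorProduct.sub_tmul, ← TensorProduct.smul_tmul', smul_sub, smul_smul] at key'
  simp only [LinearMap.sub_apply, LinearMap.smul_apply, Module.End.mul_apply,
    X.vertexOp_vertexOp_tmul s t p hx v t0, tmul_expRoot_comm j i, smul_smul]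
  have e : ∀ k y : ℤ, -(k + 1) - y - 1 = -k - y - 1 - 1 := fun k y => by ring
  simp only [cartan_symm j i, skew_apply hM i j, add_comm ((ε : ℤ) * twist n M j β), hε, e,
    one_mul, mul_neg]
  convert key' using 3 <;> ring

theorem vertexOp_opp_of_ne {i j : Fin (n + 1)} (hij : i ≠ j) (k l : ℤ) :
    X.vertexOp s t p i 1 k * X.vertexOp s t p j (-1) l =
      X.vertexOp s t p j (-1) l * X.vertexOp s t p i 1 k := by
  have t0 := t_ne_zero ht hκ
  refine ext_hasWeight fun v x β hx => ?_
  have key := congrArg (fun w => t ^ (twist n M i β - twist n M j β) •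
    w ⊗ₜ[𝕜] (expRoot n 𝕜 i 1 * (expRoot n 𝕜 j (-1) * x)))
    (X.mode_opp_of_ne hs ht hκ hn hM hij 1 (-k - pairing n p i β - 1)
      (-l + pairing n p j β - 1) v)
  simp only [← TensorProduct.smul_tmul', smul_smul] at key
  simp only [Module.End.mul_apply, X.vertexOp_vertexOp_tmul s t p hx v t0, tmul_expRoot_comm j i,
    smul_smul, cartan_symm j i, skew_apply hM i j, Units.val_one, Units.val_neg, one_mul, neg_mul,
    mul_neg, sub_neg_eq_add, mul_one, neg_neg, ← sub_eq_add_neg]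
  convert key using 2
  rw [neg_add_eq_sub]
  ring

/-- `e^{α_i}` and `e^{-α_i}` cancel in either order and the diagonal of `M` is zero, so only the
Fock identity and powers of `s` remain. -/
theorem vertexOp_opp_self (i : Fin (n + 1)) (k l : ℤ) :
    algebraMap Qq 𝕜 (q - q⁻¹) • (X.vertexOp s t p i 1 k * X.vertexOp s t p i (-1) l -
      X.vertexOp s t p i (-1) l * X.vertexOp s t p i 1 k) =
    s ^ (k - l) • X.cartanMode p i 1 (k + l) - s ^ (l - k) • X.cartanMode p i (-1) (k + l) := by
  have t0 := t_ne_zero ht hκ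
  have s0 := s_ne_zero hs
  refine ext_hasWeight fun v x β hx => ?_
  have key := congrArg (fun w => w ⊗ₜ[𝕜] x) (X.mode_opp_self hs hn hM i
    (-k - pairing n p i β - 1) (-l + pairing n p i β - 1) (-k - l) (by ring) v)
  simp only [TensorProduct.sub_tmul, ← TensorProduct.smul_tmul'] at key
  have e1 : expRoot n 𝕜 i 1 * (expRoot n 𝕜 i (-1) * x) = x := by
    rw [← mul_assoc, expRoot_mul, one_mul]
  have e2 : expRoot n 𝕜 i (-1) * (expRoot n 𝕜 i 1 * x) = x := by
    rw [← mul_assoc, expRoot_inv_mul, one_mul]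
  have e3 : ∀ m : ℤ, algebraMap Qq 𝕜 q ^ m = s ^ (2 * m) := fun m => by
    rw [← hs, zpow_mul, zpow_ofNat]
  simp only [LinearMap.sub_apply, LinearMap.smul_apply, Module.End.mul_apply,
    X.vertexOp_vertexOp_tmul s t p hx v t0, X.cartanMode_tmul p v hx, Units.val_one, Units.val_neg,
    one_mul, neg_mul, mul_neg, sub_neg_eq_add, mul_one, neg_neg, e1, e2, cartan_self hn,
    skew_self hM, mul_zero, zpow_zero, add_neg_cancel, neg_add_cancel, one_smul, key,
    smul_smul, e3, ← zpow_add₀ s0]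
  congr 3 <;> ring_nf

omit hn hM hs hκ ht in
theorem vertexOp₃_tmul {x : TwistAlg n 𝕜} {β : Fin (n + 1) → ℤ} (hx : HasWeight x β) (v : W)
    (ht0 : t ≠ 0) (i₁ i₂ i₃ : Fin (n + 1)) (ε : ℤˣ) (k₁ k₂ k₃ : ℤ) :
    X.vertexOp s t p i₁ ε k₁ (X.vertexOp s t p i₂ ε k₂ (X.vertexOp s t p i₃ ε k₃ (v ⊗ₜ[𝕜] x))) =
      (t ^ ((ε : ℤ) * (twist n M i₁ β + twist n M i₂ β + twist n M i₃ β)) *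
        t ^ (cartan n i₁ i₂ * M i₁ i₂ + cartan n i₁ i₃ * M i₁ i₃ + cartan n i₂ i₃ * M i₂ i₃)) •
      (X.vertexModes s i₁ ε).mode
        (-k₁ - (ε : ℤ) * pairing n p i₁ β - 1 - cartan n i₁ i₂ - cartan n i₁ i₃)
        ((X.vertexModes s i₂ ε).mode
          (-k₂ - (ε : ℤ) * pairing n p i₂ β - 1 - cartan n i₂ i₃)
          ((X.vertexModes s i₃ ε).mode (-k₃ - (ε : ℤ) * pairing n p i₃ β - 1) v)) ⊗ₜ[𝕜]
        (expRoot n 𝕜 i₁ ε * (expRoot n 𝕜 i₂ ε * (expRoot n 𝕜 i₃ ε * x))) := by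
  have hε : (ε : ℤ) * ε = 1 := by rw [← Units.val_mul, Int.units_mul_self]; rfl
  rw [X.vertexOp_vertexOp_tmul s t p hx v ht0, map_smul,
    X.vertexOp_tmul s t p ((hx.expRoot_mul i₃ ε).expRoot_mul i₂ ε), smul_smul,
    twist_add_single, twist_add_single, pairing_add_single, pairing_add_single, hε, one_mul,
    ← zpow_add₀ ht0 (_ + _), ← zpow_add₀ ht0, ← zpow_add₀ ht0 ((ε : ℤ) * (_ + _))]
  congr 2
  · linear_combination (cartan n i₁ i₂ * M i₁ i₂ + cartan n i₁ i₃ * M i₁ i₃) * hε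
  · congr 2
    · linear_combination -(cartan n i₁ i₂ + cartan n i₁ i₃) * hε
    · ring_nf

omit hs hn hM in
theorem vertexOp_comm_of_zero {i j : Fin (n + 1)} (ha : cartan n i j = 0) (ε : ℤˣ) (k l : ℤ) :
    X.vertexOp s t p i ε k * X.vertexOp s t p j ε l =
      X.vertexOp s t p j ε l * X.vertexOp s t p i ε k := by
  have t0 := t_ne_zero ht hκ
  refine ext_hasWeight fun v x β hx => ?_
  simp only [Module.End.mul_apply, X.vertexOp_vertexOp_tmul s t p hx v t0, tmul_expRoot_comm j i,
    cartan_symm j i, ha, X.mode_comm_of_zero ha, zero_mul, mul_zero, zpow_zero, mul_one, one_smul,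
    sub_zero]
  rw [add_comm ((ε : ℤ) * twist n M j β)]

/-- After all lattice factors are put in one order this is `Modes.mode_serre`. -/
theorem vertexOp_serre {i j : Fin (n + 1)} (ha : cartan n i j = -1) (ε : ℤˣ) (k₁ k₂ l : ℤ)
    (S : ℤ → ℤ → Module.End 𝕜 (W ⊗[𝕜] TwistAlg n 𝕜))
    (hS : ∀ k₁ k₂, S k₁ k₂ =
      X.vertexOp s t p j ε l * X.vertexOp s t p i ε k₁ * X.vertexOp s t p i ε k₂ -
      algebraMap Qq 𝕜 (q + q⁻¹) •
        (X.vertexOp s t p i ε k₁ * X.vertexOp s t p j ε l * X.vertexOp s t p i ε k₂) +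
      X.vertexOp s t p i ε k₁ * X.vertexOp s t p i ε k₂ * X.vertexOp s t p j ε l) :
    S k₁ k₂ + S k₂ k₁ = 0 := by
  have t0 := t_ne_zero ht hκ
  have ha' := cartan_symm i j ▸ ha
  have hQ : algebraMap Qq 𝕜 (q + q⁻¹) =
      algebraMap Qq 𝕜 q ^ (ε : ℤ) + (algebraMap Qq 𝕜 q ^ (ε : ℤ))⁻¹ := by
    rcases Int.units_eq_one_or ε with rfl | rfl
    · simp
    · simp [add_comm]
  have hk : algebraMap Qq 𝕜 κ ^ M i j = (t ^ M i j) ^ 2 := by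
    rw [← ht, ← zpow_natCast, ← zpow_natCast, ← zpow_mul, ← zpow_mul, mul_comm]
  refine ext_hasWeight fun v x β hx => ?_
  obtain ⟨⟨e0, e1, e2⟩, e3⟩ := zCoeff_lin_mul_lin ((algebraMap Qq 𝕜 q ^ (ε : ℤ))⁻¹ ^ 2)
  have c1 : expRoot n 𝕜 j ε * (expRoot n 𝕜 i ε * (expRoot n 𝕜 i ε * x)) =
      expRoot n 𝕜 i ε * (expRoot n 𝕜 i ε * (expRoot n 𝕜 j ε * x)) :=
    mul_mul_mul_of_anticomm (expRoot_anticomm ha' ε) x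
  -- A single transposition of anticommuting factors: it turns the coefficient -[2] of the middle
  -- term into the +[2] of `Modes.mode_serre`, while `c1` uses two transpositions and keeps the
  -- sign.
  have c2 : ∀ w : W, w ⊗ₜ[𝕜] (expRoot n 𝕜 i ε * (expRoot n 𝕜 j ε * (expRoot n 𝕜 i ε * x))) =
      -(w ⊗ₜ[𝕜] (expRoot n 𝕜 i ε * (expRoot n 𝕜 i ε * (expRoot n 𝕜 j ε * x)))) :=
    fun w => tmul_mul_of_eq_neg (expRoot_anticomm ha' ε x) _ w
  have main := Modes.mode_serre (Q := algebraMap Qq 𝕜 q ^ (ε : ℤ)) (τ := (t ^ M i j)⁻¹)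
    (τ' := t ^ M i j) (zpow_ne_zero _ algebraMap_q_ne_zero)
    (inv_mul_cancel₀ (zpow_ne_zero _ t0))
    (X.contracts_same_two hs (cartan_self hn i) (skew_self hM i) ε)
    (X.contracts_same_neg_one hs ha ε) (X.contracts_same_neg_one hs ha' ε)
    (fun a b => X.commute_pos s i i _ _ a b) (fun a b => X.commute_neg s i i _ _ a b)
    (fun a b => X.commute_pos s i j _ _ a b) (fun a b => X.commute_neg s i j _ _ a b)
    e0 e1 e2 (fun c hc => e3 c (Or.inr hc))
    (fun y => by rw [zCoeff_geomSeries, zpow_neg, zpow_neg, hk, inv_pow])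
    (fun y => by
      rw [zCoeff_geomSeries, zpow_neg, skew_apply hM i j, neg_neg, hk]
      simp only [neg_eq_zero])
    (-k₁ - (ε : ℤ) * pairing n p i β - 1) (-k₂ - (ε : ℤ) * pairing n p i β - 1)
    (-l - (ε : ℤ) * pairing n p j β - 1) v _ (fun _ _ => rfl)
  have main' := congrArg (fun w => t ^ ((ε : ℤ) * (2 * twist n M i β + twist n M j β)) •
    w ⊗ₜ[𝕜] (expRoot n 𝕜 i ε * (expRoot n 𝕜 i ε * (expRoot n 𝕜 j ε * x)))) main
  rw [TensorProduct.zero_tmul, smul_zero] at main'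
  refine Eq.trans ?_ main'
  simp only [hS, LinearMap.add_apply, LinearMap.sub_apply, LinearMap.smul_apply,
    Module.End.mul_apply, X.vertexOp₃_tmul p hx v t0]
  simp only [c1, c2, smul_neg, sub_neg_eq_add, ha, ha',
    cartan_self hn, skew_self hM, skew_apply hM i j, TensorProduct.add_tmul, smul_add,
    ← TensorProduct.smul_tmul', smul_smul, hQ]
  have d1 : ∀ y : ℤ, y + 1 + 1 = y + 2 := fun y => by ring
  have d2 : ∀ y : ℤ, y + 1 - 2 = y - 1 := fun y => by ring
  have d3 : ∀ y : ℤ, y - 2 + 1 = y - 1 := fun y => by ring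
  have g1 : ∀ a b : ℤ, b + a + a = 2 * a + b := fun a b => by ring
  have g2 : ∀ a b : ℤ, a + b + a = 2 * a + b := fun a b => by ring
  have g3 : ∀ a b : ℤ, a + a + b = 2 * a + b := fun a b => by ring
  -- The powers of `t` from the twist are T², 1 and T⁻² with T = t^{m_ij}, which is why τ' = T and τ
  -- = T⁻¹ were chosen.
  have v1 : t ^ (-1 * -M i j + -1 * -M i j + 2 * 0) = (t ^ M i j) ^ 2 := by
    rw [← zpow_ofNat, ← zpow_mul]; congr 1; ring
  have v2 : t ^ (-1 * M i j + 2 * 0 + -1 * -M i j) = 1 := by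
    rw [← zpow_zero t]; congr 1; ring
  have v3 : t ^ (2 * 0 + -1 * M i j + -1 * M i j) = (t ^ M i j)⁻¹ ^ 2 := by
    rw [← zpow_ofNat, ← zpow_neg, ← zpow_mul]; congr 1; ring
  simp only [d1, d2, d3, v1, v2, v3, mul_one]
  rw [g1, g2, g3, mul_comm (_ + _)]

end Relations

end HeisRep

/-! ### The action of the quantum toroidal algebra -/

theorem map_kMode {A B : Type*} [Ring A] [Ring B] [Algebra Qq A] [Algebra Qq B] (φ : A →ₐ[Qq] B)
    (K : ℤˣ → A) (h : NZ → A) (ε : ℤˣ) (k : ℤ) :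
    φ (kMode K h ε k) = kMode (fun η => φ (K η)) (fun l => φ (h l)) ε k := by
  unfold kMode
  split_ifs
  · rw [map_mul, map_coeff_halfExp]
  · exact map_zero φ

theorem map_serre {A B : Type*} [Ring A] [Ring B] [Algebra Qq A] [Algebra Qq B] (φ : A →ₐ[Qq] B)
    (m : ℕ) (x : ℤ → A) (y : A) (k : Fin m → ℤ) :
    φ (serre m x y k) = serre m (fun l => φ (x l)) (φ y) k := by
  unfold serre
  simp only [map_sum, map_smul, map_mul, map_list_prod, List.map_take, List.map_drop,
    List.map_ofFn]
  rfl

theorem serre_one {A : Type*} [Ring A] [Algebra Qq A] (x : ℤ → A) (y : A) (k : Fin 1 → ℤ) :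
    serre 1 x y k = y * x (k 0) - x (k 0) * y := by
  simp [serre, Finset.sum_range_succ, qBinom, qFactorial, qInt_one, sub_eq_add_neg]

/-- The quantum binomials are 1, [2], 1, and the two brackets come from the two permutations. -/
theorem serre_two {A : Type*} [Ring A] [Algebra Qq A] (x : ℤ → A) (y : A) (k : Fin 2 → ℤ) :
    serre 2 x y k =
      (y * x (k 0) * x (k 1) - (q + q⁻¹) • (x (k 0) * y * x (k 1)) + x (k 0) * x (k 1) * y) +
      (y * x (k 1) * x (k 0) - (q + q⁻¹) • (x (k 1) * y * x (k 0)) + x (k 1) * x (k 0) * y) := by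
  have h2 : qInt 2 = q + q⁻¹ := by
    have := qInt_mul_two 1
    simpa [qInt_one] using this
  have h2' : q + q⁻¹ ≠ 0 := h2 ▸ qInt_ne_zero two_ne_zero
  have e : Finset.Icc 1 2 = {1, 2} := rfl
  have f0 : qFactorial 0 = 1 := rfl
  have f1 : qFactorial 1 = 1 := by simp [qFactorial, qInt_one]
  have f2 : qFactorial 2 = q + q⁻¹ := by simp [qFactorial, e, qInt_one, h2]
  have b0 : qBinom 2 0 = 1 := by simp [qBinom, f0, f2, h2']
  have b1 : qBinom 2 1 = q + q⁻¹ := by simp [qBinom, f1, f2]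
  have b2 : qBinom 2 2 = 1 := by simp [qBinom, f0, f2, h2']
  have key : ∀ σ : Equiv.Perm (Fin 2), ∑ r ∈ Finset.range 3, ((-1) ^ r * qBinom 2 r) •
      (((List.ofFn fun s => x (k (σ s))).take r).prod * y *
        ((List.ofFn fun s => x (k (σ s))).drop r).prod) =
      y * x (k (σ 0)) * x (k (σ 1)) - (q + q⁻¹) • (x (k (σ 0)) * y * x (k (σ 1))) +
        x (k (σ 0)) * x (k (σ 1)) * y := fun σ => by
    simp [Finset.sum_range_succ, b0, b1, b2, List.ofFn_succ, mul_assoc, sub_eq_add_neg]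
    rw [← neg_smul]
    congr 1
    ring
  have u : (Finset.univ : Finset (Equiv.Perm (Fin 2))) = {1, Equiv.swap 0 1} := by decide
  unfold serre
  simp only [key]
  rw [u, Finset.sum_pair (by decide)]
  simp

namespace HeisRep

variable {n : ℕ} {M : Matrix (Fin (n + 1)) (Fin (n + 1)) ℤ} {κ : Qq}
  {𝕜 : Type*} [Field 𝕜] [Algebra Qq 𝕜] {W : Type*} [AddCommGroup W] [Module 𝕜 W]
  (X : HeisRep n M κ 𝕜 W) (s t : 𝕜) (p : Fin (n + 1))

/-- The operators assigned to the generators of the quantum toroidal algebra. -/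
def genOp : Gen n → Module.End 𝕜 (W ⊗[𝕜] TwistAlg n 𝕜)
  | .E i k => X.vertexOp s t p i 1 k
  | .F i k => X.vertexOp s t p i (-1) k
  | .H i l => X.heisOp i l
  | .K i ε => diagOp W (pairing n p i) ε
  | .C ε => algebraMap 𝕜 _ (s ^ (ε : ℤ))
  | .D₁ ε => X.dOneOp p ε
  | .D₂ ε => diagOp W (fun β => β 0) ε

omit [Algebra Qq 𝕜] in
theorem coeff_halfExp_rTensor (N : Type*) [AddCommMonoid N] [Module 𝕜 N] (h : NZ → Module.End 𝕜 W)
    (c : ℕ → 𝕜) (ε : ℤˣ) (k : ℕ) :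
    PowerSeries.coeff k (halfExp c ε fun l => LinearMap.rTensor N (h l)) =
      LinearMap.rTensor N (PowerSeries.coeff k (halfExp c ε h)) := by
  let φ : Module.End 𝕜 W →ₐ[𝕜] Module.End 𝕜 (W ⊗[𝕜] N) := Module.End.rTensorAlgHom 𝕜 W N
  exact (map_coeff_halfExp φ c ε h k).symm

theorem coeff_halfExp_heisOp (c : ℕ → 𝕜) (ε : ℤˣ) (i : Fin (n + 1)) (k : ℕ) :
    PowerSeries.coeff k (halfExp c ε (X.heisOp i)) =
      LinearMap.rTensor (TwistAlg n 𝕜) (PowerSeries.coeff k (halfExp c ε (X.h i))) :=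
  coeff_halfExp_rTensor _ _ c ε k

theorem rTensor_diagOp (T : Module.End 𝕜 W) (f : (Fin (n + 1) → ℤ) → ℤ) (ε : ℤˣ) :
    diagOp W f ε * LinearMap.rTensor (TwistAlg n 𝕜) T =
      LinearMap.rTensor (TwistAlg n 𝕜) T * diagOp W f ε := by
  refine ext_hasWeight fun v x β hx => ?_
  simp only [Module.End.mul_apply, diagOp_tmul hx, map_smul, LinearMap.rTensor_tmul]

variable [Algebra Qq (Module.End 𝕜 (W ⊗[𝕜] TwistAlg n 𝕜))]
  [IsScalarTower Qq 𝕜 (Module.End 𝕜 (W ⊗[𝕜] TwistAlg n 𝕜))]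

/-- The diagonal operator commutes with the Heisenberg factor, so the order of the two does not
matter. The coefficients in ℚ(q) are first carried to 𝕜. -/
theorem kMode_genOp (i : Fin (n + 1)) (ε : ℤˣ) (k : ℤ) :
    kMode (fun η => X.genOp s t p (.K i η)) (fun l => X.genOp s t p (.H i l)) ε k =
      X.cartanMode p i ε k := by
  unfold kMode cartanMode zCoeff
  split_ifs
  · have := X.coeff_halfExp_heisOp (fun _ => algebraMap Qq 𝕜 (((ε : ℤ) : Qq) * (q - q⁻¹))) ε i
      ((ε : ℤ) * k).toNat
    rw [halfExp_algebraMap] at this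
    have e : (fun l => X.genOp s t p (.H i l)) = X.heisOp i := rfl
    rw [e, this]
    refine (rTensor_diagOp _ _ _).trans ?_
    rw [cartanSeries]
    simp only [map_mul, map_intCast]
  · rw [LinearMap.rTensor_zero, zero_mul]

variable {s t} (hs : s ^ 2 = algebraMap Qq 𝕜 q) 

include hs in
theorem lift_cPow (m : ℤ) :
    FreeAlgebra.lift Qq (X.genOp s t p) (cPow n m) = algebraMap 𝕜 _ (s ^ m) := by
  have s0 := s_ne_zero hs
  unfold cPow
  split_ifs with h
  · lift m to ℕ using h
    rw [map_pow, g, FreeAlgebra.lift_ι_apply]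
    simp [genOp]
  · obtain ⟨l, rfl⟩ : ∃ l : ℕ, m = -l := ⟨(-m).toNat, by omega⟩
    rw [map_pow, g, FreeAlgebra.lift_ι_apply]
    simp only [genOp, Units.val_neg, Units.val_one, zpow_neg, zpow_one, neg_neg, Int.toNat_natCast,
      zpow_natCast, ← map_pow, inv_pow]

variable (ht : t ^ 2 = algebraMap Qq 𝕜 κ) (hκ : κ ≠ 0) (hn : 1 < n) (hM : M.transpose = -M)

include hs ht hκ hn hM in
-- Off-diagonal Cartan entries are 0 or -1, so only `m = 1` (plain commutation) and `m = 2` occur;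
-- `m` is a variable so that its value can be substituted.
theorem serre_vertexOp {i j : Fin (n + 1)} (hij : i ≠ j) (ε : ℤˣ) (m : ℕ)
    (hm : m = (1 - cartan n i j).toNat) (k : Fin m → ℤ) (l : ℤ) :
    serre m (fun r => X.vertexOp s t p i ε r) (X.vertexOp s t p j ε l) k = 0 := by
  rcases cartan_of_ne hn hij with ha | ha
  · obtain rfl : m = 1 := by rw [hm, ha]; rfl
    rw [serre_one, X.vertexOp_comm_of_zero p ht hκ ha, sub_self]
  · obtain rfl : m = 2 := by rw [hm, ha]; rfl
    rw [serre_two]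
    exact X.vertexOp_serre p hs ht hκ hn hM ha ε (k 0) (k 1) l
      (fun k₁ k₂ => X.vertexOp s t p j ε l * X.vertexOp s t p i ε k₁ * X.vertexOp s t p i ε k₂ -
      (q + q⁻¹) •
        (X.vertexOp s t p i ε k₁ * X.vertexOp s t p j ε l * X.vertexOp s t p i ε k₂) +
      X.vertexOp s t p i ε k₁ * X.vertexOp s t p i ε k₂ * X.vertexOp s t p j ε l)
      (fun k₁ k₂ => by rw [algebraMap_smul])

include hs ht hκ hn hM in
theorem lift_rel {a b : Free n} (h : Rel n M κ a b) :
    FreeAlgebra.lift Qq (X.genOp s t p) a = FreeAlgebra.lift Qq (X.genOp s t p) b := by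
  have s0 := s_ne_zero hs
  have hq : ∀ m : ℤ, algebraMap Qq 𝕜 (q ^ m) = algebraMap Qq 𝕜 q ^ m := fun m => map_zpow₀ _ _ _
  have smul_def : ∀ (c : Qq) (T : Module.End 𝕜 (W ⊗[𝕜] TwistAlg n 𝕜)), c • T =
    algebraMap Qq 𝕜 c • T := fun c T => (algebraMap_smul 𝕜 c T).symm
  cases h with
  | c_inv ε =>
    simp only [map_mul, g, FreeAlgebra.lift_ι_apply, genOp, map_one]
    rw [← map_mul, ← zpow_add₀ s0]
    simp
  | d₁_inv ε =>
    simp only [map_mul, g, FreeAlgebra.lift_ι_apply, genOp, map_one]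
    exact X.dOneOp_mul_neg p ε
  | d₂_inv ε =>
    simp only [map_mul, g, FreeAlgebra.lift_ι_apply, genOp, map_one]
    exact diagOp_mul_neg _ ε
  | c_central ε x =>
    simp only [map_mul, g, FreeAlgebra.lift_ι_apply]
    exact Algebra.commutes _ _
  | k_inv i ε =>
    simp only [map_mul, g, FreeAlgebra.lift_ι_apply, genOp, map_one]
    exact diagOp_mul_neg _ ε
  | kk i j ε η =>
    simp only [map_mul, g, FreeAlgebra.lift_ι_apply, genOp]
    exact diagOp_comm _ _ ε η
  | kh i j ε l =>
    simp only [map_mul, g, FreeAlgebra.lift_ι_apply, genOp]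
    exact X.diagOp_heisOp _ ε j l
  | hh i j k l =>
    rw [apply_ite (FreeAlgebra.lift Qq (X.genOp s t p))]
    simp only [map_mul, map_sub, map_smul, map_zero, X.lift_cPow p hs, g, FreeAlgebra.lift_ι_apply,
      genOp]
    rw [X.heisOp_comm]
    refine if_congr Iff.rfl ?_ rfl
    rw [smul_def, ← map_sub, Algebra.algebraMap_eq_smul_one (_ - _), smul_smul, map_mul,
      map_mul, mul_assoc]
    congr 2
    rw [qInt, map_div₀, div_eq_inv_mul, map_inv₀, map_sub, map_sub, hq, hq, zpow_mul,
      ← mul_neg, zpow_mul, zpow_ofNat, hs]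
  | d₁k j ε η =>
    simp only [map_mul, g, FreeAlgebra.lift_ι_apply, genOp]
    exact X.dOneOp_diagOp p _ ε η
  | d₂k j ε η =>
    simp only [map_mul, g, FreeAlgebra.lift_ι_apply, genOp]
    exact diagOp_comm _ _ ε η
  | d₁h j l =>
    simp only [map_mul, map_smul, g, FreeAlgebra.lift_ι_apply, genOp]
    rw [smul_def, hq]
    exact X.dOneOp_heisOp p j l
  | d₂h j ε l =>
    simp only [map_mul, g, FreeAlgebra.lift_ι_apply, genOp]
    exact X.diagOp_heisOp _ ε j l
  | d₁e j k =>
    simp only [map_mul, map_smul, g, FreeAlgebra.lift_ι_apply, genOp]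
    rw [smul_def, hq]
    exact X.dOneOp_vertexOp p hn j 1 k
  | d₁f j k =>
    simp only [map_mul, map_smul, g, FreeAlgebra.lift_ι_apply, genOp]
    rw [smul_def, hq]
    exact X.dOneOp_vertexOp p hn j (-1) k
  | d₂e j k =>
    simp only [map_mul, map_smul, g, FreeAlgebra.lift_ι_apply, genOp]
    rw [smul_def, hq]
    refine X.diagOp_vertexOp p (fun β => ?_) k
    simp [Pi.single_apply, eq_comm]
  | d₂f j k =>
    simp only [map_mul, map_smul, g, FreeAlgebra.lift_ι_apply, genOp]
    rw [smul_def, hq]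
    refine X.diagOp_vertexOp p (fun β => ?_) k
    by_cases h : j = 0
    · subst h; simp
    · simp [Pi.single_apply, h, Ne.symm h]
  | ke i j k =>
    simp only [map_mul, map_smul, g, FreeAlgebra.lift_ι_apply, genOp]
    rw [smul_def, hq]
    refine X.diagOp_vertexOp p (fun β => ?_) k
    rw [pairing_add_single]; simp
  | kf i j k =>
    simp only [map_mul, map_smul, g, FreeAlgebra.lift_ι_apply, genOp]
    rw [smul_def, hq]
    refine X.diagOp_vertexOp p (fun β => ?_) k
    rw [pairing_add_single]; simp
  | he i j k l =>
    simp only [map_mul, map_sub, map_smul, X.lift_cPow p hs, g, FreeAlgebra.lift_ι_apply, genOp]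
    rw [X.heisOp_vertexOp, ← algebraMap_smul 𝕜 (structConst _ _ _ _ _ _), ← Algebra.smul_def (s ^ _),
      smul_smul, Units.val_one, Int.cast_one, one_mul, one_mul]
  | hf i j k l =>
    simp only [map_mul, map_sub, map_neg, map_smul, X.lift_cPow p hs, g, FreeAlgebra.lift_ι_apply,
      genOp]
    rw [X.heisOp_vertexOp, ← algebraMap_smul 𝕜 (structConst _ _ _ _ _ _), ← Algebra.smul_def (s ^ _),
      smul_smul, ← neg_smul, Units.val_neg, Units.val_one, Int.cast_neg, Int.cast_one, neg_one_mul,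
      neg_one_mul, neg_neg]
  | ee i j k l =>
    simp only [map_mul, map_sub, map_smul, g, FreeAlgebra.lift_ι_apply, genOp]
    have := X.vertexOp_exchange p hs ht hκ hn hM i j 1 k l
    simpa only [smul_def, hq, map_mul, map_zpow₀, Units.val_one, one_mul] using this
  | ff i j k l =>
    simp only [map_mul, map_sub, map_smul, g, FreeAlgebra.lift_ι_apply, genOp]
    have := X.vertexOp_exchange p hs ht hκ hn hM i j (-1) k l
    simpa only [smul_def, hq, map_mul, map_zpow₀, Units.val_neg, Units.val_one, neg_one_mul]
      using this
  | ef i j k l =>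
    rw [apply_ite (FreeAlgebra.lift Qq (X.genOp s t p))]
    simp only [map_mul, map_sub, map_smul, map_zero, X.lift_cPow p hs, map_kMode, g,
      FreeAlgebra.lift_ι_apply]
    split_ifs with hij
    · subst hij
      rw [X.kMode_genOp, X.kMode_genOp, smul_def, ← Algebra.smul_def, ← Algebra.smul_def,
        ← X.vertexOp_opp_self p hs ht hκ hn hM, smul_smul, ← map_mul,
        inv_mul_cancel₀ q_sub_inv_ne_zero, map_one, one_smul]
      rfl
    · exact sub_eq_zero.mpr (X.vertexOp_opp_of_ne p hs ht hκ hn hM hij k l)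
  | serreE i j hij k l =>
    rw [map_serre, map_zero]
    simp only [g, FreeAlgebra.lift_ι_apply, genOp]
    exact X.serre_vertexOp p hs ht hκ hn hM hij 1 _ rfl k l
  | serreF i j hij k l =>
    rw [map_serre, map_zero]
    simp only [g, FreeAlgebra.lift_ι_apply, genOp]
    exact X.serre_vertexOp p hs ht hκ hn hM hij (-1) _ rfl k l

/-- The action of the quantum toroidal algebra by vertex operators. -/
def toroidalAction : Uqtor n M κ →ₐ[Qq] Module.End 𝕜 (W ⊗[𝕜] TwistAlg n 𝕜) :=
  RingQuot.liftAlgHom Qq ⟨FreeAlgebra.lift Qq (X.genOp s t p),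
    fun _ _ h => X.lift_rel p hs ht hκ hn hM h⟩

theorem toroidalAction_gen (x : Gen n) :
    X.toroidalAction p hs ht hκ hn hM (gen M κ x) = X.genOp s t p x := by
  unfold toroidalAction gen
  rw [RingQuot.liftAlgHom_mkAlgHom_apply, g, FreeAlgebra.lift_ι_apply]

end HeisRep

/-! ### The Fock space representation -/

section Laurent

variable {𝕜 : Type*} [Field 𝕜] {W N : Type*} [AddCommGroup W] [Module 𝕜 W] [AddCommMonoid N]
  [Module 𝕜 N]

/-- Annihilation coefficients vanish at negative integers, so the sum over ℤ that defines a mode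
equals the sum over ℕ in `laurentCoeff`; the test on the exponent there is the vanishing of `X.pos`.
-/
theorem laurentCoeff_tmul (X : Modes 𝕜 W ℤ) {A B : PowerSeries (Module.End 𝕜 (W ⊗[𝕜] N))}
    (hA : ∀ k : ℕ, PowerSeries.coeff k A = LinearMap.rTensor N (X.pos k))
    (hB : ∀ k : ℕ, PowerSeries.coeff k B = LinearMap.rTensor N (X.neg k)) (m l : ℤ) (v : W)
    (y : N) : laurentCoeff 𝕜 A B m l (v ⊗ₜ[𝕜] y) = X.mode (l - m) v ⊗ₜ[𝕜] y := by
  have e : ∀ b : ℕ, (if 0 ≤ l - m + b then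
      PowerSeries.coeff (l - m + b).toNat A (PowerSeries.coeff b B (v ⊗ₜ[𝕜] y)) else 0) =
      X.pos (l - m + b) (X.neg b v) ⊗ₜ[𝕜] y := fun b => by
    split_ifs with h
    · rw [hA, hB, LinearMap.rTensor_tmul, LinearMap.rTensor_tmul, Int.toNat_of_nonneg h]
    · rw [X.pos_eq_zero _ h, LinearMap.zero_apply, TensorProduct.zero_tmul]
  have hfin := X.finite_support_mode (l - m) v
  have hinj : Function.Injective (Nat.cast : ℕ → ℤ) := Nat.cast_injective
  have hr : ∑ᶠ b : ℤ, X.pos (l - m + b) (X.neg b v) =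
      ∑ᶠ b : ℕ, X.pos (l - m + b) (X.neg b v) := by
    rw [← finsum_mem_range hinj (f := fun b : ℤ => X.pos (l - m + b) (X.neg b v)),
      ← finsum_mem_univ]
    refine finsum_mem_inter_support_eq' _ _ _ fun b hb => ⟨fun _ => ⟨b.toNat, ?_⟩, fun _ => trivial⟩
    refine Int.toNat_of_nonneg ?_
    by_contra h
    exact hb (by simp only; rw [X.neg_eq_zero _ h, LinearMap.zero_apply, map_zero])
  unfold laurentCoeff
  simp only [e]
  rw [Modes.mode_apply, hr]
  exact (((TensorProduct.mk 𝕜 W N).flip y).toAddMonoidHom.map_finsum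
    (hfin.preimage (f := (Nat.cast : ℕ → ℤ)) hinj.injOn)).symm

end Laurent

section Fock

variable (n : ℕ) (M : Matrix (Fin (n + 1)) (Fin (n + 1)) ℤ) (κ : Qq)
  (𝕜 : Type*) [Field 𝕜] [Algebra Qq 𝕜]

theorem zCoeff_halfExp_lsmul (c : ℕ → 𝕜) (ε : ℤˣ) (i : Fin (n + 1)) (a : ℤ) :
    zCoeff (halfExp c ε fun l => Algebra.lsmul 𝕜 𝕜 (Fock n M κ 𝕜) (heisH n M κ 𝕜 i l)) a =
      Algebra.lsmul 𝕜 𝕜 (Fock n M κ 𝕜) (zCoeff (halfExp c ε (heisH n M κ 𝕜 i)) a) := by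
  unfold zCoeff
  split_ifs
  · exact (map_coeff_halfExp (Algebra.lsmul 𝕜 𝕜 (Fock n M κ 𝕜)) c ε _ _).symm
  · exact (map_zero _).symm

theorem q_zpow_ne_zero (ε : ℤˣ) : algebraMap Qq 𝕜 q ^ (ε : ℤ) ≠ 0 :=
  zpow_ne_zero _ HeisRep.algebraMap_q_ne_zero

/-- The Fock space as a representation of the Heisenberg algebra. -/
def fockRep : HeisRep n M κ 𝕜 (Fock n M κ 𝕜) where
  h i l := Algebra.lsmul 𝕜 𝕜 (Fock n M κ 𝕜) (heisH n M κ 𝕜 i l)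
  comm i j k l := by
    rw [← map_mul, ← map_mul, ← map_sub, heisH_commutator]
    split_ifs
    · exact AlgHom.commutes _ _
    · exact map_zero _
  nil c i v := by
    simp only [zCoeff_halfExp_lsmul]
    exact finite_support_halfExp c i v
  D ε := degOp n M κ (q_zpow_ne_zero 𝕜 ε)
  D_mul ε := by
    refine LinearMap.ext fun v => ?_
    refine degOp_degOp _ _ ?_ v
    rw [← zpow_add₀ HeisRep.algebraMap_q_ne_zero, Units.val_neg, add_neg_cancel, zpow_zero]
  D_h ε i l := by
    refine LinearMap.ext fun v => ?_
    refine (degOp_smul _ _ _).trans ?_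
    rw [degMap_heisH, ← zpow_mul]
    exact smul_assoc (algebraMap Qq 𝕜 q ^ _) (heisH n M κ 𝕜 i l) (degOp n M κ _ v)
  D_halfExp ε c η i a := by
    refine LinearMap.ext fun v => ?_
    rw [zCoeff_halfExp_lsmul]
    refine (degOp_smul _ _ _).trans ?_
    rw [degMap_halfExp, ← zpow_mul]
    exact smul_assoc (algebraMap Qq 𝕜 q ^ _) (zCoeff (halfExp c η (heisH n M κ 𝕜 i)) a)
      (degOp n M κ _ v)

theorem opH_eq (i : Fin (n + 1)) : opH n M κ 𝕜 i = (fockRep n M κ 𝕜).heisOp i := rfl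

variable (s t : 𝕜) (p : Fin (n + 1))

theorem coeff_halfExp_opH (c : ℕ → 𝕜) (ε : ℤˣ) (i : Fin (n + 1)) (k : ℕ) :
    PowerSeries.coeff k (halfExp c ε (opH n M κ 𝕜 i)) = LinearMap.rTensor (TwistAlg n 𝕜)
      (zCoeff (halfExp c ε ((fockRep n M κ 𝕜).h i)) k) := by
  rw [opH_eq, HeisRep.coeff_halfExp_heisOp, zCoeff_natCast]

theorem laurentCoeff_ePlus (i : Fin (n + 1)) (m l : ℤ) (v : Fock n M κ 𝕜) (y : TwistAlg n 𝕜) :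
    laurentCoeff 𝕜 (ePlus n M κ 𝕜 s i) (eMinus n M κ 𝕜 s i) m l (v ⊗ₜ[𝕜] y) =
      ((fockRep n M κ 𝕜).vertexModes s i 1).mode (l - m) v ⊗ₜ[𝕜] y := by
  refine laurentCoeff_tmul _ (fun k => ?_) (fun k => ?_) m l v y
  · refine (coeff_halfExp_opH n M κ 𝕜 _ _ i k).trans (congrArg (fun c => LinearMap.rTensor _
      (zCoeff (halfExp c (-1) ((fockRep n M κ 𝕜).h i)) k)) (funext fun k => ?_))
    simp [HeisRep.vertexCoeff]
  · refine (coeff_halfExp_opH n M κ 𝕜 _ _ i k).trans (congrArg (fun c => LinearMap.rTensor _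
      (zCoeff (halfExp c (1) ((fockRep n M κ 𝕜).h i)) k)) (funext fun k => ?_))
    simp [HeisRep.vertexCoeff]

theorem laurentCoeff_fPlus (i : Fin (n + 1)) (m l : ℤ) (v : Fock n M κ 𝕜) (y : TwistAlg n 𝕜) :
    laurentCoeff 𝕜 (fPlus n M κ 𝕜 s i) (fMinus n M κ 𝕜 s i) m l (v ⊗ₜ[𝕜] y) =
      ((fockRep n M κ 𝕜).vertexModes s i (-1)).mode (l - m) v ⊗ₜ[𝕜] y := by
  refine laurentCoeff_tmul _ (fun k => ?_) (fun k => ?_) m l v y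
  · refine (coeff_halfExp_opH n M κ 𝕜 _ _ i k).trans (congrArg (fun c => LinearMap.rTensor _
      (zCoeff (halfExp c (-1) ((fockRep n M κ 𝕜).h i)) k)) (funext fun k => ?_))
    simp [HeisRep.vertexCoeff]
  · refine (coeff_halfExp_opH n M κ 𝕜 _ _ i k).trans (congrArg (fun c => LinearMap.rTensor _
      (zCoeff (halfExp c (1) ((fockRep n M κ 𝕜).h i)) k)) (funext fun k => ?_))
    simp [HeisRep.vertexCoeff]

/-- Local finiteness on the Fock space gives a bound for pure tensors, and maxima of bounds handle
sums. -/
theorem exists_coeff_halfExp_opH_eq_zero (c : ℕ → 𝕜) (i : Fin (n + 1)) (x : VSpace n M κ 𝕜) :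
    ∃ b₀ : ℕ, ∀ b : ℕ, b₀ ≤ b → PowerSeries.coeff b (halfExp c 1 (opH n M κ 𝕜 i)) x = 0 := by
  induction x using TensorProduct.induction_on with
  | zero => exact ⟨0, fun b _ => map_zero _⟩
  | tmul v y =>
    obtain ⟨B, hB⟩ := ((fockRep n M κ 𝕜).nil c i v).bddAbove
    refine ⟨B.toNat + 1, fun b hb => ?_⟩
    have h0 : zCoeff (halfExp c 1 ((fockRep n M κ 𝕜).h i)) b v = 0 := by
      by_contra h
      have := hB h
      omega
    rw [coeff_halfExp_opH, LinearMap.rTensor_tmul, h0, TensorProduct.zero_tmul]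
  | add x y hx hy =>
    obtain ⟨b₁, h₁⟩ := hx
    obtain ⟨b₂, h₂⟩ := hy
    refine ⟨max b₁ b₂, fun b hb => ?_⟩
    rw [map_add, h₁ b (le_trans (le_max_left _ _) hb), h₂ b (le_trans (le_max_right _ _) hb)]
    exact add_zero _

end Fock

/-! ### The module structure on `V(p)_n` -/

section Main

variable {n : ℕ} {M : Matrix (Fin (n + 1)) (Fin (n + 1)) ℤ} {κ : Qq}
  {𝕜 : Type*} [Field 𝕜] [Algebra Qq 𝕜] {s t : 𝕜} {p : Fin (n + 1)}

theorem IsVertexAction.unique {ρ ρ' : Uqtor n M κ →ₐ[Qq] Module.End 𝕜 (VSpace n M κ 𝕜)}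
    (h : IsVertexAction n M κ 𝕜 s p t ρ) (h' : IsVertexAction n M κ 𝕜 s p t ρ') : ρ = ρ' := by
  refine RingQuot.ringQuot_ext' _ _ _ (FreeAlgebra.hom_ext (funext fun x => ?_))
  change ρ (gen M κ x) = ρ' (gen M κ x)
  cases x with
  | E i k => exact ext_expLattice fun v β => (h.e_eq i k v β).trans (h'.e_eq i k v β).symm
  | F i k => exact ext_expLattice fun v β => (h.f_eq i k v β).trans (h'.f_eq i k v β).symm
  | H i l => exact (h.h_eq i l).trans (h'.h_eq i l).symm
  | K i ε => exact ext_expLattice fun v β => (h.k_eq i ε v β).trans (h'.k_eq i ε v β).symm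
  | C ε => exact LinearMap.ext fun v => (h.c_eq ε v).trans (h'.c_eq ε v).symm
  | D₁ ε =>
    -- `q^{±d₁}` is prescribed only on monomial vectors, so the Fock factor must also be reduced to
    -- its spanning set.
    refine ext_expLattice fun v β => ?_
    refine LinearMap.congr_fun (f := ρ (gen M κ (.D₁ ε)) ∘ₗ
      (TensorProduct.mk 𝕜 (Fock n M κ 𝕜) (TwistAlg n 𝕜)).flip (expLattice n 𝕜 β))
      (g := ρ' (gen M κ (.D₁ ε)) ∘ₗ
      (TensorProduct.mk 𝕜 (Fock n M κ 𝕜) (TwistAlg n 𝕜)).flip (expLattice n 𝕜 β)) ?_ v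
    exact ext_monomialVec fun L => (h.d₁_eq ε L β).trans (h'.d₁_eq ε L β).symm
  | D₂ ε => exact ext_expLattice fun v β => (h.d₂_eq ε v β).trans (h'.d₂_eq ε v β).symm

omit [Algebra Qq 𝕜] in
theorem smul_tmul_eq_of_eq {W N : Type*} [AddCommGroup W] [Module 𝕜 W] [AddCommMonoid N]
    [Module 𝕜 N] {a a' : 𝕜} {w w' : W} (ha : a = a') (hw : w = w') (y : N) :
    a • w ⊗ₜ[𝕜] y = (a' • w') ⊗ₜ[𝕜] y := by
  rw [ha, hw, TensorProduct.smul_tmul']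

omit [Algebra Qq 𝕜] in
theorem smul_smul_tmul_of_eq {W N : Type*} [AddCommGroup W] [Module 𝕜 W] [AddCommMonoid N]
    [Module 𝕜 N] {a b c : 𝕜} (h : a * b = c) (w : W) (y : N) :
    a • (b • w) ⊗ₜ[𝕜] y = c • w ⊗ₜ[𝕜] y := by
  rw [← TensorProduct.smul_tmul', smul_smul, h]

theorem prod_diagOp_tmul {W : Type*} [AddCommGroup W] [Module 𝕜 W] {x : TwistAlg n 𝕜}
    {β : Fin (n + 1) → ℤ} (hx : HasWeight x β) (v : W) {m : ℕ}
    (f : Fin m → (Fin (n + 1) → ℤ) → ℤ) :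
    (List.ofFn fun i => HeisRep.diagOp (𝕜 := 𝕜) W (f i) 1).prod (v ⊗ₜ[𝕜] x) =
      algebraMap Qq 𝕜 q ^ (∑ i, f i β) • v ⊗ₜ[𝕜] x := by
  induction m with
  | zero => simp
  | succ m ih =>
    rw [List.ofFn_succ, List.prod_cons, Module.End.mul_apply, ih, map_smul,
      HeisRep.diagOp_tmul hx, smul_smul, ← zpow_add₀ HeisRep.algebraMap_q_ne_zero,
      Fin.sum_univ_succ, Units.val_one, one_mul, add_comm (f 0 β)]

variable (hs : s ^ 2 = algebraMap Qq 𝕜 q) (ht : t ^ 2 = algebraMap Qq 𝕜 κ) (hκ : κ ≠ 0)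
  (hn : 1 < n) (hM : M.transpose = -M)

/-- The columns of the affine Cartan matrix sum to zero, so `β` drops out and `Λ_p` contributes 1.
-/
theorem sum_pairing (p : Fin (n + 1)) (β : Fin (n + 1) → ℤ) : ∑ i, pairing n p i β = 1 := by
  unfold pairing
  rw [Finset.sum_add_distrib, Finset.sum_comm]
  simp [← Finset.sum_mul, sum_cartan]

theorem isVertexAction_toroidalAction : IsVertexAction n M κ 𝕜 s p t
    ((fockRep n M κ 𝕜).toroidalAction p hs ht hκ hn hM) where
  c_eq ε x := by
    rw [HeisRep.toroidalAction_gen]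
    rfl
  d₁_eq ε L β := by
    rw [HeisRep.toroidalAction_gen]
    refine ((fockRep n M κ 𝕜).dOneOp_tmul p (hasWeight_expLattice β) _ ε).trans ?_
    have e : (fockRep n M κ 𝕜).D ε (monomialVec n M κ 𝕜 L) = _ :=
      degOp_monomialVec (q_zpow_ne_zero 𝕜 ε) L
    rw [e]
    refine smul_smul_tmul_of_eq ?_ _ _
    rw [← zpow_mul, ← zpow_add₀ HeisRep.algebraMap_q_ne_zero, ← mul_add]
    congr 2
    unfold degOne monDeg
    ring
  d₂_eq ε v β := by
    rw [HeisRep.toroidalAction_gen]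
    exact HeisRep.diagOp_tmul (hasWeight_expLattice β) v _ ε
  h_eq i l := by
    rw [HeisRep.toroidalAction_gen]
    rfl
  k_eq i ε v β := by
    rw [HeisRep.toroidalAction_gen]
    exact HeisRep.diagOp_tmul (hasWeight_expLattice β) v _ ε
  kMode_eq i ε k v β := by
    refine (LinearMap.congr_fun
      (map_kMode (A := Uqtor n M κ) (B := Module.End 𝕜 (VSpace n M κ 𝕜))
        ((fockRep n M κ 𝕜).toroidalAction p hs ht hκ hn hM) _ _ _ _) _).trans ?_
    simp only [HeisRep.toroidalAction_gen]
    rw [HeisRep.kMode_genOp]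
    refine ((fockRep n M κ 𝕜).cartanMode_tmul p v (hasWeight_expLattice β) i ε _).trans ?_
    rw [map_smul]
    refine congrArg _ ?_
    have hε : (ε : ℤ) * ((ε : ℤ) * k) = k := by
      rw [← mul_assoc, ← Units.val_mul, Int.units_mul_self, Units.val_one, one_mul]
    rw [hε, kExp, coeff_halfExp_opH]
    rfl
  e_eq i k v β := by
    rw [HeisRep.toroidalAction_gen]
    refine ((fockRep n M κ 𝕜).vertexOp_tmul s t p (hasWeight_expLattice β) v i 1 k).trans ?_
    have e : opExp n M κ 𝕜 i 1 (t ^ twist n M i β • vec n M κ 𝕜 v β) =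
      (t ^ twist n M i β • v) ⊗ₜ[𝕜] (expRoot n 𝕜 i 1 * expLattice n 𝕜 β) := rfl
    rw [e, laurentCoeff_ePlus, map_smul]
    exact smul_tmul_eq_of_eq (by simp) (by simp [sub_sub]) _
  f_eq i k v β := by
    rw [HeisRep.toroidalAction_gen]
    refine ((fockRep n M κ 𝕜).vertexOp_tmul s t p (hasWeight_expLattice β) v i (-1) k).trans ?_
    have e : opExp n M κ 𝕜 i (-1) (t ^ (-twist n M i β) • vec n M κ 𝕜 v β) =
      (t ^ (-twist n M i β) • v) ⊗ₜ[𝕜] (expRoot n 𝕜 i (-1) * expLattice n 𝕜 β) := rfl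
    rw [e, laurentCoeff_fPlus, map_smul]
    exact smul_tmul_eq_of_eq (by simp) (by congr 2; simp; ring) _

include hs in
theorem IsVertexAction.c_sq {ρ : Uqtor n M κ →ₐ[Qq] Module.End 𝕜 (VSpace n M κ 𝕜)}
    (h : IsVertexAction n M κ 𝕜 s p t ρ) (x : VSpace n M κ 𝕜) :
    ρ (gen M κ (.C 1) ^ 2) x = algebraMap Qq 𝕜 q • x := by
  have e : ρ (gen M κ (.C 1) ^ 2) = ρ (gen M κ (.C 1)) * ρ (gen M κ (.C 1)) := by
    rw [pow_two, map_mul]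
  rw [e, Module.End.mul_apply, h.c_eq, h.c_eq]
  refine smul_smul_of_eq (R := 𝕜) (W := VSpace n M κ 𝕜) ?_ x
  rw [← hs, pow_two]
  simp

theorem prod_k_toroidalAction (x : VSpace n M κ 𝕜) :
    (fockRep n M κ 𝕜).toroidalAction p hs ht hκ hn hM
      (List.ofFn fun i => gen M κ (.K i 1)).prod x = algebraMap Qq 𝕜 q • x := by
  rw [map_list_prod, List.map_ofFn]
  have e : (⇑((fockRep n M κ 𝕜).toroidalAction p hs ht hκ hn hM) ∘ fun i => gen M κ (.K i 1)) =
      fun i => HeisRep.diagOp (Fock n M κ 𝕜) (pairing n p i) 1 :=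
    funext fun i => HeisRep.toroidalAction_gen _ p hs ht hκ hn hM _
  rw [e]
  refine LinearMap.congr_fun (g := algebraMap Qq 𝕜 q • (1 : Module.End 𝕜 (VSpace n M κ 𝕜))) ?_ x
  refine ext_hasWeight fun v y β hy => ?_
  refine (prod_diagOp_tmul hy v _).trans ?_
  rw [sum_pairing, zpow_one]
  rfl

end Main

end

end QToroidal

theorem proposition3p4p2 (n : ℕ) (hn : 1 < n)
    (M : Matrix (Fin (n + 1)) (Fin (n + 1)) ℤ) (hM : M.transpose = -M)
    (κ : QToroidal.Qq) (hκ : κ ≠ 0)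
    (𝕜 : Type*) [Field 𝕜] [Algebra QToroidal.Qq 𝕜]
    (s t : 𝕜) (hs : s ^ 2 = algebraMap QToroidal.Qq 𝕜 QToroidal.q)
    (ht : t ^ 2 = algebraMap QToroidal.Qq 𝕜 κ) (p : Fin (n + 1)) :
    (∀ (i : Fin (n + 1)) (x : QToroidal.VSpace n M κ 𝕜), ∃ b₀ : ℕ, ∀ b : ℕ, b₀ ≤ b →
      PowerSeries.coeff b (QToroidal.eMinus n M κ 𝕜 s i) x = 0 ∧
      PowerSeries.coeff b (QToroidal.fMinus n M κ 𝕜 s i) x = 0) ∧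
    ∃ ρ : QToroidal.Uqtor n M κ →ₐ[QToroidal.Qq] Module.End 𝕜 (QToroidal.VSpace n M κ 𝕜),
      QToroidal.IsVertexAction n M κ 𝕜 s p t ρ ∧
      (∀ ρ' : QToroidal.Uqtor n M κ →ₐ[QToroidal.Qq] Module.End 𝕜 (QToroidal.VSpace n M κ 𝕜),
        QToroidal.IsVertexAction n M κ 𝕜 s p t ρ' → ρ' = ρ) ∧
      (∀ x : QToroidal.VSpace n M κ 𝕜,
        ρ (QToroidal.gen M κ (.C 1) ^ 2) x = algebraMap QToroidal.Qq 𝕜 QToroidal.q • x) ∧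
      (∀ x : QToroidal.VSpace n M κ 𝕜,
        ρ (List.ofFn fun i => QToroidal.gen M κ (.K i 1)).prod x =
          algebraMap QToroidal.Qq 𝕜 QToroidal.q • x) := by 
  refine ⟨fun i x => ?_,
    (QToroidal.fockRep n M κ 𝕜).toroidalAction p hs ht hκ hn hM,
    QToroidal.isVertexAction_toroidalAction hs ht hκ hn hM,
    fun ρ' h => h.unique (QToroidal.isVertexAction_toroidalAction hs ht hκ hn hM),
    (QToroidal.isVertexAction_toroidalAction hs ht hκ hn hM).c_sq hs,
    QToroidal.prod_k_toroidalAction hs ht hκ hn hM⟩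
  obtain ⟨b₁, h₁⟩ := QToroidal.exists_coeff_halfExp_opH_eq_zero n M κ 𝕜 _ i x
  obtain ⟨b₂, h₂⟩ := QToroidal.exists_coeff_halfExp_opH_eq_zero n M κ 𝕜 _ i x
  exact ⟨max b₁ b₂, fun b hb => ⟨h₁ b (le_trans (le_max_left _ _) hb),
    h₂ b (le_trans (le_max_right _ _) hb)⟩⟩
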